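/- Let $K\subset\mathbb{R}^2$ be a symmetric convex body ($K=-K$, compact, convex, with nonempty interior) whose boundary $\partial K$ is $C^\infty$ smooth and has everywhere positive curvature. Let $\|\cdot\|_K$ be the norm with unit ball $K$, let $\|\omega\|_{K^*}=\sup_{v\in K}\omega\cdot v$ be the dual norm, with unit ball $K^*$, and let $\sigma^K_t$ denote the Euclidean arc length measure on the circle $\{y:\|y\|_K=t\}$, normalized to have total mass $1$. Write $\hat f(\xi)=\int f(y)e^{-2\pi i y\cdot\xi}\,dy$, and similarly for measures; $f*\mu(x)=\int f(x-y)\,d\mu(y)$; and $\|f\|_{\dot H^{s}}^2=\int_{\mathbb{R}^2}|\xi|^{2s}|\hat f(\xi)|^2\,d\xi\in[0,\infty]$. Then there is a smooth, not necessarily positive, measure $\sigma^{K^*}$ on $\partial K^*=\{\omega:\|\omega\|_{K^*}=1\}$ (that is, a signed measure with a real $C^\infty$ density with respect to arc length on $\partial K^*$) such that, with $\sigma^{K^*}_r(A)=\sigma^{K^*}(A/r)$ for $r>0$, the following holds. For all $0<a\le b$ there is a constant $C_1$, depending only on $K,\sigma^{K^*},a,b$, and for every $\epsilon>0$ there is a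 constant $C_2$, depending only on $K,\sigma^{K^*},a,b,\epsilon$, such that for every $x\in\mathbb{R}^2$ and every integrable $f:\mathbb{R}^2\to\mathbb{C}$ that vanishes outside the annulus $\{y: a\le\|x-y\|_K\le b\}$, $$\int_0^\infty |f*\sigma^K_t(x)|^2\,t\,dt\;\le\; C_1\int_0^\infty \bigl|f*\widehat{\sigma^{K^*}_r}(x)\bigr|^2\,r\,dr\;+\;C_2\Bigl(\|f\|_{\dot H^{-\frac12+\epsilon}}^2+\|f\|_{\dot H^{-\frac12}}^2\Bigr).$$ (The terms on the right may be infinite.) -/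

import Mathlib

open MeasureTheory Set
open scoped ENNReal NNReal ContDiff FourierTransform

noncomputable section

namespace CurvedNorm

/-- The Euclidean plane. -/
abbrev Plane : Type := EuclideanSpace ℝ (Fin 2)

/-- `ρ` is a `C^∞` defining function of `K` on a neighbourhood of the boundary point `p`:
near `p` the set `K` is `{ρ ≤ 0}`, and `dρ(p) ≠ 0`. -/
def IsLocalDefiningFunction (K : Set Plane) (p : Plane) (ρ : Plane → ℝ) : Prop :=
  ∃ U : Set Plane, IsOpen U ∧ p ∈ U ∧ ContDiffOn ℝ ∞ ρ U ∧
    (∀ q ∈ U, q ∈ K ↔ ρ q ≤ 0) ∧ fderiv ℝ ρ p ≠ 0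

/-- The curvature at `p` of the level curve of `ρ` through `p`, with respect to the unit normal
`-∇ρ / |∇ρ|`, computed with the unit tangent vector `τ`: `D²ρ(p)(τ, τ) / |∇ρ(p)|`. -/
def levelCurvature (ρ : Plane → ℝ) (p τ : Plane) : ℝ :=
  fderiv ℝ (fderiv ℝ ρ) p τ τ / ‖fderiv ℝ ρ p‖

/-- The boundary of `K` is a `C^∞` curve of everywhere positive curvature (with respect to the
inner normal). When `K` is compact the curvature is then bounded from above and away from zero,
by continuity. -/
def HasSmoothCurvedBoundary (K : Set Plane) : Prop :=
  ∀ p ∈ frontier K, ∃ ρ : Plane → ℝ, IsLocalDefiningFunction K p ρ ∧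
    ∀ τ : Plane, ‖τ‖ = 1 → fderiv ℝ ρ p τ = 0 → 0 < levelCurvature ρ p τ

/-- A symmetric convex body in the plane (with nonempty interior) whose boundary is `C^∞` smooth
and has everywhere positive curvature. -/
structure IsSmoothCurvedBody (K : ConvexBody Plane) : Prop where
  interior_nonempty : (interior (K : Set Plane)).Nonempty
  symmetric : ∀ v ∈ (K : Set Plane), -v ∈ (K : Set Plane)
  smooth_curved : HasSmoothCurvedBoundary (K : Set Plane)

/-- The norm `‖·‖_K` whose unit ball is `K`. -/
def bodyNorm (K : ConvexBody Plane) (v : Plane) : ℝ := gauge (K : Set Plane) v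

/-- The dual norm `‖w‖_{K*} = sup_{v ∈ K} w · v`. -/
def dualNorm (K : ConvexBody Plane) (w : Plane) : ℝ :=
  sSup ((fun v : Plane => inner ℝ w v) '' (K : Set Plane))

/-- The circle of radius `t` about the origin in the norm `‖·‖_K`. -/
def normCircle (K : ConvexBody Plane) (t : ℝ) : Set Plane := {y | bodyNorm K y = t}

/-- The unit circle of the dual norm, which is the boundary of the dual body `K*`. -/
def dualUnitCircle (K : ConvexBody Plane) : Set Plane := {w | dualNorm K w = 1}

/-- Euclidean arc length on the curve `Γ` (one-dimensional Hausdorff measure). -/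
def arcLength (Γ : Set Plane) : Measure Plane := (Measure.hausdorffMeasure 1).restrict Γ

/-- Euclidean arc length on the circle of radius `t` of the norm `‖·‖_K`, normalized to have total
mass one. -/
def circleMeasure (K : ConvexBody Plane) (t : ℝ) : Measure Plane :=
  (arcLength (normCircle K t) univ)⁻¹ • arcLength (normCircle K t)

/-- `σ` is a smooth, not necessarily positive, measure on the curve `Γ`: it has a real `C^∞` density
with respect to arc length on `Γ`. -/
def IsSmoothMeasureOn (Γ : Set Plane) (σ : SignedMeasure Plane) : Prop :=
  ∃ g : Plane → ℝ, ContDiff ℝ ∞ g ∧ Integrable g (arcLength Γ) ∧ σ = (arcLength Γ).withDensityᵥ g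

/-- The dilate `σ_r` of a signed measure, `σ_r(A) = σ(A / r)`: the image of `σ` under `θ ↦ r θ`. -/
def dilate (σ : SignedMeasure Plane) (r : ℝ) : SignedMeasure Plane :=
  σ.map (fun θ : Plane => r • θ)

/-- The Fourier transform of a signed measure, `ξ ↦ ∫ e^{-2π i y · ξ} dσ(y)`. -/
def fourierMeasure (σ : SignedMeasure Plane) (ξ : Plane) : ℂ :=
  ∫ᵛ y, Complex.exp (-(2 * Real.pi * inner ℝ y ξ : ℝ) * Complex.I) ∂<•σ

/-- The convolution `f * μ (x) = ∫ f(x - y) dμ(y)` of a function with a positive measure. -/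
def convMeasure (f : Plane → ℂ) (μ : Measure Plane) (x : Plane) : ℂ := ∫ y, f (x - y) ∂μ

/-- The convolution `f * g (x) = ∫ f(y) g(x - y) dy` of two functions. -/
def conv (f g : Plane → ℂ) : Plane → ℂ :=
  MeasureTheory.convolution f g (ContinuousLinearMap.mul ℂ ℂ)

/-- The square of the homogeneous Sobolev norm of order `s`, `∫ |ξ|^{2s} |f̂(ξ)|² dξ`, for an
integrable function `f`; it may be infinite. -/
def sobolevNormSq (s : ℝ) (f : Plane → ℂ) : ℝ≥0∞ :=
  ∫⁻ ξ : Plane, ENNReal.ofReal (‖ξ‖ ^ (2 * s)) * ‖𝓕 f ξ‖ₑ ^ 2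

end CurvedNorm

end

/-! Let `n(β)` be the `K`-norm of the unit vector at angle `β`. It is the support function of `K*`,
and the hypotheses on `∂K` say that `n` is smooth with `n + n'' > 0`. For a symmetric measure with
smooth density on `∂K*`, the phase of the Fourier transform at `r y` has two nondegenerate critical
points, the points with normal `±y`, with critical values `±‖y‖_K`. Hence the transform equals
`r^{-1/2} A(y) cos(2π r ‖y‖_K - π/4)` plus a remainder. The density is free, and it is chosen so
that `A(y) dy`, in the coordinates `y = s p` with `p ∈ ∂K`, is a multiple of `√s ds` times arc
length on `∂K` (`polarDensity_mul_amplitude`). Up to the remainder and a constant, `√r · (f *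
σ̂_r)(x)` is then the cosine transform, with phase shift `π/4`, of `φ(s) = √s · (f * σ_s)(x)`, and
the left side of the theorem is the squared `L²` norm of `φ`.

The shifted cosine transform is bounded below in `lintegral_enorm_sq_le_cos`. Plancherel expresses
`‖φ‖²` as four times the squared norm of the cosine transform on the half line, minus twice a cross
term. The shift `π/4` makes the cross term the quadratic form of the Carleman kernel `1 / (2π(s +
s'))`. This form is the squared `L²` norm of a Laplace transform, hence nonnegative, and the term
can be dropped. The support of `φ` in `[a, ∞)` with `a > 0` keeps the kernel bounded.

On the annulus the remainder is `O(r^{-3/2})` with gradient `O(r^{-1/2})` for `r ≥ 1`, and both are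
`O(r^{-1/2})` for `r ≤ 1` (`exists_locKernel_bounds`). Interpolating between these two bounds by
duality (`enorm_integral_mul_sq_le`), the squared pairing of the remainder with `f` is at most a
multiple of `r^{-2-2e'}` times the Sobolev terms for large `r`, with `0 < e' ≤ ε`. This is
integrable against `r dr`, whereas `e' = 0` would give the divergent `dr / r`; hence the role of
`ε`.

The expansion itself comes from following `z^{1/2} ∫ h e^{-zp}` along `z = t - iλ` from `t = 0`, the
oscillatory integral, to `t = ∞`, where Laplace's method gives the leading constant
(`norm_cpow_mul_expIntegral_sub_le`). -/

noncomputable section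

namespace CurvedNorm

open Filter Topology Complex

/-! ### Smooth dependence of integrals on parameters. -/

section ParametricIntegral

variable {E : Type} [NormedAddCommGroup E] [NormedSpace ℝ E] [FiniteDimensional ℝ E]

theorem hasFDerivAt_intervalIntegral_param {G : Type} [NormedAddCommGroup G] [NormedSpace ℝ G]
    {F : E × ℝ → G} (hF : ContDiff ℝ 1 F) (a b : ℝ) (e : E) :
    HasFDerivAt (fun e => ∫ v in a..b, F (e, v))
      (∫ v in a..b, (fderiv ℝ F (e, v)).comp (ContinuousLinearMap.inl ℝ E ℝ)) e := by
  have hcF := hF.continuous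
  have hdF : Continuous (fderiv ℝ F) := hF.continuous_fderiv (by norm_num)
  have hcd : Continuous fun q : E × ℝ =>
      (fderiv ℝ F q).comp (ContinuousLinearMap.inl ℝ E ℝ) := hdF.clm_comp continuous_const
  have hK : IsCompact (Metric.closedBall e 1 ×ˢ uIcc a b) :=
    (isCompact_closedBall e 1).prod isCompact_uIcc
  obtain ⟨B, hB⟩ := hK.exists_bound_of_continuousOn hcd.continuousOn
  refine (intervalIntegral.hasFDerivAt_integral_of_dominated_of_fderiv_le
    (F := fun e v => F (e, v))
    (F' := fun e v => (fderiv ℝ F (e, v)).comp (ContinuousLinearMap.inl ℝ E ℝ))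
    (bound := fun _ => B) (s := Metric.ball e 1) (Metric.ball_mem_nhds e one_pos) ?_ ?_ ?_ ?_ ?_ ?_)
  · exact Eventually.of_forall fun x => (hcF.comp (by fun_prop)).aestronglyMeasurable
  · exact (hcF.comp (by fun_prop : Continuous fun v : ℝ => (e, v))).intervalIntegrable _ _
  · exact (hcd.comp (by fun_prop : Continuous fun v : ℝ => (e, v))).aestronglyMeasurable
  · refine Eventually.of_forall fun v hv x hx => hB (x, v) ⟨Metric.ball_subset_closedBall hx, ?_⟩
    exact uIoc_subset_uIcc hv
  · exact intervalIntegrable_const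
  · refine Eventually.of_forall fun v hv x hx => ?_
    have h1 : HasFDerivAt F (fderiv ℝ F (x, v)) (x, v) :=
      (hF.differentiable (by norm_num) _).hasFDerivAt
    have h2 : HasFDerivAt (fun x : E => (x, v)) (ContinuousLinearMap.inl ℝ E ℝ) x :=
      hasFDerivAt_prodMk_left x v
    exact h1.comp x h2

/-- The derivative is an integral of the same type with values in a space of linear maps, so the
target space has to vary in the induction on the order. -/
theorem contDiff_nat_intervalIntegral_param (a b : ℝ) (k : ℕ) :
    ∀ {G : Type} [NormedAddCommGroup G] [NormedSpace ℝ G]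
    {F : E × ℝ → G}, ContDiff ℝ ∞ F → ContDiff ℝ k (fun e => ∫ v in a..b, F (e, v)) := by
  induction k with
  | zero =>
    intro G _ _ F hF
    rw [Nat.cast_zero, contDiff_zero]
    exact continuous_iff_continuousAt.2 fun e =>
      (hasFDerivAt_intervalIntegral_param (hF.of_le (by exact_mod_cast le_top)) a b e).continuousAt
  | succ k ih =>
    intro G _ _ F hF
    have hd := hasFDerivAt_intervalIntegral_param (F := F) (hF.of_le (by exact_mod_cast le_top)) a b
    rw [Nat.cast_succ, contDiff_succ_iff_hasFDerivAt]
    refine ⟨_, ?_, hd⟩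
    apply ih (F := fun q : E × ℝ => (fderiv ℝ F q).comp (ContinuousLinearMap.inl ℝ E ℝ))
    exact (hF.fderiv_right (m := ∞) (by simp)).clm_comp contDiff_const

theorem contDiff_intervalIntegral_param {G : Type} [NormedAddCommGroup G] [NormedSpace ℝ G]
    {F : E × ℝ → G} (hF : ContDiff ℝ ∞ F) (a b : ℝ) :
    ContDiff ℝ ∞ (fun e => ∫ v in a..b, F (e, v)) :=
  contDiff_infty.2 fun k => contDiff_nat_intervalIntegral_param a b k hF

end ParametricIntegral

/-! ### Stationary phase with a complex parameter and an explicit remainder. -/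

section StationaryPhase

/-- The oscillatory (or Laplace) integral `∫ h e^{-zp}` over `[-R, R]`. -/
def expIntegral (R : ℝ) (h p : ℝ → ℝ) (z : ℂ) : ℂ :=
  ∫ x in (-R)..R, (h x : ℂ) * cexp (-z * p x)

/-- Integration by parts with `p' = x M`; the boundary terms vanish with `K`. A factor `p'` in the
amplitude is thus worth a factor `1 / z`. -/
theorem mul_expIntegral_eq {R : ℝ} {p M K K' : ℝ → ℝ} (hp : ∀ x, HasDerivAt p (x * M x) x)
    (hM : Continuous M) (hK : ∀ x, HasDerivAt K (K' x) x) (hK' : Continuous K')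
    (h1 : K R = 0) (h2 : K (-R) = 0) (z : ℂ) :
    z * expIntegral R (fun x => K x * (x * M x)) p z = expIntegral R K' p z := by
  have hpc : Continuous p := continuous_iff_continuousAt.2 fun x => (hp x).continuousAt
  have hKc : Continuous K := continuous_iff_continuousAt.2 fun x => (hK x).continuousAt
  have hd : ∀ x, HasDerivAt (fun x : ℝ => (K x : ℂ) * cexp (-z * p x))
      ((K' x : ℂ) * cexp (-z * p x) - z * (((K x * (x * M x) : ℝ) : ℂ) * cexp (-z * p x))) x := by
    intro x
    have e1 := (hK x).ofReal_comp.mul (((hp x).ofReal_comp.const_mul (-z)).cexp)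
    refine e1.congr_deriv ?_
    push_cast
    ring
  have := intervalIntegral.integral_eq_sub_of_hasDerivAt (a := -R) (b := R) (fun x _ => hd x)
    (by apply Continuous.intervalIntegrable; fun_prop)
  rw [intervalIntegral.integral_sub (by apply Continuous.intervalIntegrable; fun_prop)
    (by apply Continuous.intervalIntegrable; fun_prop), h1, h2,
    intervalIntegral.integral_const_mul] at this
  simp only [ofReal_zero, zero_mul, sub_self] at this
  rw [expIntegral, expIntegral]
  linear_combination -this

theorem norm_cexp_neg_mul_le_one {z : ℂ} (hz : 0 ≤ z.re) {t : ℝ} (ht : 0 ≤ t) :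
    ‖cexp (-z * t)‖ ≤ 1 := by
  rw [Complex.norm_exp]
  have : 0 ≤ z.re * t := by positivity
  simpa using this

theorem integral_inv_sq_add_sq_le {R δ : ℝ} (hδ : 0 < δ) :
    ∫ x in (-R)..R, 1 / (x ^ 2 + δ ^ 2) ≤ Real.pi / δ := by
  have hd : ∀ x, HasDerivAt (fun x : ℝ => Real.arctan (x / δ) / δ) (1 / (x ^ 2 + δ ^ 2)) x := by
    intro x
    have := (((hasDerivAt_id x).div_const δ).arctan).div_const δ
    refine this.congr_deriv ?_
    simp only [id]
    field_simp
    ring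
  have hc : Continuous fun x : ℝ => 1 / (x ^ 2 + δ ^ 2) :=
    continuous_const.div (by fun_prop) (fun x => by positivity)
  rw [intervalIntegral.integral_eq_sub_of_hasDerivAt (fun x _ => hd x) (hc.intervalIntegrable _ _)]
  have h1 := Real.arctan_lt_pi_div_two (R / δ)
  have h2 := Real.neg_pi_div_two_lt_arctan (-R / δ)
  rw [← sub_div]
  gcongr
  linarith

/-- Van der Corput's lemma for a phase with derivative `x M(x)`, in the right half plane. -/
theorem norm_expIntegral_le_inv_sqrt {R B : ℝ} (hR : 0 ≤ R) {p M G G' : ℝ → ℝ}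
    (hp0 : ∀ x, 0 ≤ p x) (hp : ∀ x, HasDerivAt p (x * M x) x) (hM : Continuous M)
    (hG : ∀ x, HasDerivAt G (G' x) x) (hG' : Continuous G') (h1 : G R = 0) (h2 : G (-R) = 0)
    (bF : ∀ x, |G x * M x| ≤ B) (bG : ∀ x, |G x| ≤ B) (bG' : ∀ x, |G' x| ≤ B)
    {z : ℂ} (hz : 0 ≤ z.re) (hz0 : z ≠ 0) :
    ‖expIntegral R (fun x => G x * M x) p z‖ ≤ (2 * Real.pi + R) * B / √‖z‖ := by
  have hpc : Continuous p := continuous_iff_continuousAt.2 fun x => (hp x).continuousAt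
  have hGc : Continuous G := continuous_iff_continuousAt.2 fun x => (hG x).continuousAt
  have hB : 0 ≤ B := (abs_nonneg _).trans (bG 0)
  have hzp : 0 < ‖z‖ := norm_pos_iff.2 hz0
  -- `δ = |z|^{-1/2}` is the width of the critical zone.
  obtain ⟨δ, hδ, hδz⟩ : ∃ δ : ℝ, 0 < δ ∧ δ ^ 2 * ‖z‖ = 1 :=
    ⟨1 / √‖z‖, by positivity, by rw [div_pow, Real.sq_sqrt hzp.le]; field_simp⟩
  have hsz : √‖z‖ = 1 / δ := by
    rw [Real.sqrt_eq_iff_mul_self_eq hzp.le (by positivity)]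
    field_simp; linarith
  have hpos : ∀ x : ℝ, 0 < x ^ 2 + δ ^ 2 := fun x => by positivity
  -- A smooth substitute for cutting at `|x| = δ`: `1 = δ² / (x² + δ²) + x · x / (x² + δ²)`. The
  -- first piece is estimated by its mass, of order `δ`; the second contains `p'` and is integrated
  -- by parts.
  set K : ℝ → ℝ := fun x => G x * (x / (x ^ 2 + δ ^ 2)) with hKdef
  set K' : ℝ → ℝ := fun x => G' x * (x / (x ^ 2 + δ ^ 2)) +
    G x * ((1 * (x ^ 2 + δ ^ 2) - x * (2 * x)) / (x ^ 2 + δ ^ 2) ^ 2) with hK'def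
  have hK : ∀ x, HasDerivAt K (K' x) x := by
    intro x
    have a1 : HasDerivAt (fun x : ℝ => x ^ 2 + δ ^ 2) (2 * x) x := by
      simpa using (hasDerivAt_pow 2 x).add_const (δ ^ 2)
    exact (hG x).mul ((hasDerivAt_id x).div a1 (hpos x).ne')
  have hcc : Continuous fun x : ℝ => x / (x ^ 2 + δ ^ 2) :=
    continuous_id.div (by fun_prop) fun x => (hpos x).ne'
  have hci : Continuous fun x : ℝ => 1 / (x ^ 2 + δ ^ 2) :=
    continuous_const.div (by fun_prop) fun x => (hpos x).ne'
  have hK'c : Continuous K' := by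
    refine (hG'.mul hcc).add (hGc.mul ?_)
    exact Continuous.div (by fun_prop) (by fun_prop) fun x => (pow_pos (hpos x) 2).ne'
  have hibp := mul_expIntegral_eq (R := R) hp hM hK hK'c (by simp [K, h1])
    (by simp [K, h2]) z
  have hsplit : expIntegral R (fun x => G x * M x) p z =
      expIntegral R (fun x => G x * M x * (δ ^ 2 * (1 / (x ^ 2 + δ ^ 2)))) p z +
      expIntegral R (fun x => K x * (x * M x)) p z := by
    have hKc : Continuous K := hGc.mul hcc
    rw [expIntegral, expIntegral, expIntegral, ← intervalIntegral.integral_add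
      (by apply Continuous.intervalIntegrable; fun_prop)
      (by apply Continuous.intervalIntegrable; fun_prop)]
    congr 1
    ext x
    rw [← add_mul, ← Complex.ofReal_add]
    congr 2
    simp only [K]
    have := (hpos x).ne'
    field_simp
    ring
  have hb1 : ‖expIntegral R (fun x => G x * M x * (δ ^ 2 * (1 / (x ^ 2 + δ ^ 2)))) p z‖ ≤
      B * δ ^ 2 * (Real.pi / δ) := by
    refine le_trans ?_ (mul_le_mul_of_nonneg_left (integral_inv_sq_add_sq_le (R := R) hδ) (by positivity))
    rw [← intervalIntegral.integral_const_mul]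
    refine intervalIntegral.norm_integral_le_of_norm_le (by linarith)
      (Eventually.of_forall fun x _ => ?_) (by apply Continuous.intervalIntegrable; fun_prop)
    rw [norm_mul, Complex.norm_real, Real.norm_eq_abs, abs_mul,
      abs_of_nonneg (by have := hpos x; positivity : 0 ≤ δ ^ 2 * (1 / (x ^ 2 + δ ^ 2)))]
    have := hpos x
    refine (mul_le_of_le_one_right (by positivity) (norm_cexp_neg_mul_le_one hz (hp0 x))).trans ?_
    rw [mul_assoc B]
    exact mul_le_mul_of_nonneg_right (bF x) (by positivity)
  have hb2 : ‖expIntegral R K' p z‖ ≤ B * (R / δ) + B * (Real.pi / δ) := by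
    have key : ∀ x, ‖(K' x : ℂ) * cexp (-z * p x)‖ ≤ B * (1 / (2 * δ)) + B * (1 / (x ^ 2 + δ ^ 2)) := by
      intro x
      have hx := hpos x
      rw [norm_mul, Complex.norm_real, Real.norm_eq_abs]
      refine (mul_le_of_le_one_right (by positivity) (norm_cexp_neg_mul_le_one hz (hp0 x))).trans ?_
      refine (abs_add_le _ _).trans (add_le_add ?_ ?_)
      · rw [abs_mul]
        refine mul_le_mul (bG' x) ?_ (abs_nonneg _) hB
        rw [abs_div, abs_of_pos hx, div_le_div_iff₀ hx (by positivity)]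
        nlinarith [sq_nonneg (|x| - δ), sq_abs x]
      · rw [abs_mul]
        refine mul_le_mul (bG x) ?_ (abs_nonneg _) hB
        rw [abs_div, abs_of_pos (pow_pos hx 2), div_le_div_iff₀ (by positivity) hx]
        have : |1 * (x ^ 2 + δ ^ 2) - x * (2 * x)| ≤ x ^ 2 + δ ^ 2 :=
          abs_le.2 ⟨by nlinarith [sq_nonneg x, sq_nonneg δ], by nlinarith [sq_nonneg x, sq_nonneg δ]⟩
        nlinarith
    have h3 := intervalIntegral.norm_integral_le_of_norm_le (a := -R) (b := R) (μ := volume)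
      (by linarith) (Eventually.of_forall fun x _ => key x)
      (by apply Continuous.intervalIntegrable; fun_prop)
    refine h3.trans ?_
    rw [intervalIntegral.integral_add (by simp)
      (by apply Continuous.intervalIntegrable; fun_prop), intervalIntegral.integral_const_mul,
      intervalIntegral.integral_const_mul]
    refine add_le_add (le_of_eq ?_)
      (mul_le_mul_of_nonneg_left (integral_inv_sq_add_sq_le (R := R) hδ) hB)
    rw [intervalIntegral.integral_const, smul_eq_mul]
    field_simp
    ring
  have hb3 : ‖expIntegral R (fun x => K x * (x * M x)) p z‖ ≤
      (B * (R / δ) + B * (Real.pi / δ)) * δ ^ 2 := by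
    have : ‖z‖ * ‖expIntegral R (fun x => K x * (x * M x)) p z‖ ≤
        B * (R / δ) + B * (Real.pi / δ) := by
      rw [← norm_mul, hibp]; exact hb2
    calc ‖expIntegral R (fun x => K x * (x * M x)) p z‖
        = (‖z‖ * ‖expIntegral R (fun x => K x * (x * M x)) p z‖) * δ ^ 2 := by
          linear_combination -(‖expIntegral R (fun x => K x * (x * M x)) p z‖) * hδz
      _ ≤ _ := mul_le_mul_of_nonneg_right this (by positivity)
  rw [hsplit, hsz]
  refine (norm_add_le _ _).trans ((add_le_add hb1 hb3).trans (le_of_eq ?_))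
  field_simp
  ring

theorem hasDerivAt_expIntegral {R : ℝ} {h p : ℝ → ℝ} (hh : Continuous h) (hp : Continuous p)
    (z : ℂ) :
    HasDerivAt (expIntegral R h p) (-expIntegral R (fun x => h x * p x) p z) z := by
  have hc : Continuous fun q : ℂ × ℝ => -(((h q.2 * p q.2 : ℝ) : ℂ) * cexp (-q.1 * p q.2)) := by
    fun_prop
  obtain ⟨B, hB⟩ := ((isCompact_closedBall z 1).prod
    (isCompact_uIcc (a := -R) (b := R))).exists_bound_of_continuousOn hc.continuousOn
  have key := intervalIntegral.hasDerivAt_integral_of_dominated_loc_of_deriv_le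
    (F := fun (w : ℂ) (x : ℝ) => (h x : ℂ) * cexp (-w * p x))
    (F' := fun w x => -(((h x * p x : ℝ) : ℂ) * cexp (-w * p x))) (bound := fun _ => B)
    (x₀ := z) (μ := volume) (a := -R) (b := R)
    (Metric.ball_mem_nhds z one_pos) ?_ ?_ ?_ ?_ ?_ ?_
  · refine key.2.congr_deriv ?_
    rw [intervalIntegral.integral_neg]; rfl
  · exact Eventually.of_forall fun x => by
      apply Continuous.aestronglyMeasurable; fun_prop
  · apply Continuous.intervalIntegrable; fun_prop
  · apply Continuous.aestronglyMeasurable; fun_prop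
  · refine Eventually.of_forall fun v hv x hx => hB (x, v) ⟨Metric.ball_subset_closedBall hx, ?_⟩
    exact uIoc_subset_uIcc hv
  · exact intervalIntegrable_const
  · refine Eventually.of_forall fun x _ w _ => ?_
    have := ((((hasDerivAt_id w).neg).mul_const (p x : ℂ)).cexp).const_mul (h x : ℂ)
    refine this.congr_deriv ?_
    simp only [Pi.neg_apply, id]
    push_cast
    ring

/-- Data for two integrations by parts in the oscillatory integral with amplitude `h` and phase
`p`, where `p' = x M(x)`. -/
structure PhaseData (R B c : ℝ) (p M h : ℝ → ℝ) where
  /-- the correction in `p / p' = x / 2 - x² E(x)` -/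
  E : ℝ → ℝ
  /-- the derivative of `E` -/
  E' : ℝ → ℝ
  /-- the derivative of the amplitude -/
  h' : ℝ → ℝ
  /-- the amplitude after the first integration by parts -/
  F : ℝ → ℝ
  /-- the derivative of `F`, divided by `M` -/
  G : ℝ → ℝ
  /-- the derivative of `G` -/
  G' : ℝ → ℝ
  R_nonneg : 0 ≤ R
  c_pos : 0 < c
  le_p : ∀ x, c * x ^ 2 ≤ p x
  p_deriv : ∀ x, HasDerivAt p (x * M x) x
  M_cont : Continuous M
  p_eq : ∀ x, p x = (x / 2 - x ^ 2 * E x) * (x * M x)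
  E_deriv : ∀ x, HasDerivAt E (E' x) x
  E'_cont : Continuous E'
  h_deriv : ∀ x, HasDerivAt h (h' x) x
  h'_cont : Continuous h'
  h_right : h R = 0
  h_left : h (-R) = 0
  F_eq : ∀ x, F x * M x = -h' x / 2 + 2 * (h x * E x) + x * (h' x * E x + h x * E' x)
  F_deriv : ∀ x, HasDerivAt F (G x * M x) x
  F_right : F R = 0
  F_left : F (-R) = 0
  G_deriv : ∀ x, HasDerivAt G (G' x) x
  G'_cont : Continuous G'
  G_right : G R = 0
  G_left : G (-R) = 0
  GM_bound : ∀ x, |G x * M x| ≤ B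
  G_bound : ∀ x, |G x| ≤ B
  G'_bound : ∀ x, |G' x| ≤ B

namespace PhaseData

variable {R B c : ℝ} {p M h : ℝ → ℝ}

/-- Multiplied by `z^{-1/2}`, the quantity inside the norm is the derivative of `z^{1/2} ∫ h
e^{-zp}`. Writing `p = (x/2 - x² E) p'`, one integration by parts cancels `h / 2` and leaves an
amplitude again divisible by `p'`. A second one gains `1 / z`, and van der Corput's lemma gains
`|z|^{-1/2}`. -/
theorem norm_half_sub_le (D : PhaseData R B c p M h) {z : ℂ} (hz : 0 ≤ z.re) (hz0 : z ≠ 0) :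
    ‖expIntegral R h p z / 2 - z * expIntegral R (fun x => h x * p x) p z‖ ≤
      (2 * Real.pi + R) * B / √‖z‖ / ‖z‖ := by
  have hpc : Continuous p := continuous_iff_continuousAt.2 fun x => (D.p_deriv x).continuousAt
  have hhc : Continuous h := continuous_iff_continuousAt.2 fun x => (D.h_deriv x).continuousAt
  have hEc : Continuous D.E := continuous_iff_continuousAt.2 fun x => (D.E_deriv x).continuousAt
  have hFc : Continuous D.F := continuous_iff_continuousAt.2 fun x => (D.F_deriv x).continuousAt
  have hGc : Continuous D.G := continuous_iff_continuousAt.2 fun x => (D.G_deriv x).continuousAt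
  have hh'c := D.h'_cont
  have hE'c := D.E'_cont
  have hMc := D.M_cont
  have hp0 : ∀ x, 0 ≤ p x := fun x =>
    (mul_nonneg D.c_pos.le (sq_nonneg x)).trans (D.le_p x)
  have hK : ∀ x, HasDerivAt (fun x => h x * (x / 2 - x ^ 2 * D.E x))
      (D.h' x * (x / 2 - x ^ 2 * D.E x) +
        h x * (1 / 2 - (2 * x * D.E x + x ^ 2 * D.E' x))) x := by
    intro x
    have e1 : HasDerivAt (fun x : ℝ => x / 2) (1 / 2) x := (hasDerivAt_id x).div_const 2
    have e2 : HasDerivAt (fun x : ℝ => x ^ 2) (2 * x) x := by simpa using hasDerivAt_pow 2 x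
    exact (D.h_deriv x).mul (e1.sub (e2.mul (D.E_deriv x)))
  have h1 := mul_expIntegral_eq (R := R) D.p_deriv hMc hK (by fun_prop) (by simp [D.h_right])
    (by simp [D.h_left]) z
  have h2 := mul_expIntegral_eq (R := R) D.p_deriv hMc D.F_deriv (by fun_prop) D.F_right D.F_left z
  have h3 := norm_expIntegral_le_inv_sqrt D.R_nonneg hp0 D.p_deriv hMc D.G_deriv D.G'_cont
    D.G_right D.G_left D.GM_bound D.G_bound D.G'_bound hz hz0
  have e0 : (fun x => h x * p x) = fun x => h x * (x / 2 - x ^ 2 * D.E x) * (x * M x) := by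
    ext x; rw [D.p_eq x]; ring
  have e3 : expIntegral R h p z / 2 - z * expIntegral R (fun x => h x * p x) p z =
      expIntegral R (fun x => D.F x * (x * M x)) p z := by
    rw [e0, h1]
    simp only [expIntegral]
    rw [← intervalIntegral.integral_div, ← intervalIntegral.integral_sub
      (by apply Continuous.intervalIntegrable; fun_prop)
      (by apply Continuous.intervalIntegrable; fun_prop)]
    congr 1
    ext x
    have : D.F x * (x * M x) = x * (D.F x * M x) := by ring
    rw [this, D.F_eq x]
    push_cast
    ring
  have hzp : 0 < ‖z‖ := norm_pos_iff.2 hz0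
  rw [e3, le_div_iff₀ hzp, mul_comm, ← norm_mul, h2]
  exact h3

/-- Laplace's method on a horizontal ray: substitute `x = u / √t` and dominate by `e^{-c u²}`. The
oscillating factor `e^{iλp}` tends to `1` because `p` vanishes at the origin. -/
theorem tendsto_sqrt_mul_expIntegral (D : PhaseData R B c p M h) (hR : 0 < R) (lam : ℝ) :
    Tendsto (fun t : ℝ => ((√t : ℝ) : ℂ) * expIntegral R h p (t - lam * I)) atTop
      (𝓝 ((h 0 * √(2 * Real.pi / M 0) : ℝ) : ℂ)) := by
  have hpc : Continuous p := continuous_iff_continuousAt.2 fun x => (D.p_deriv x).continuousAt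
  have hhc : Continuous h := continuous_iff_continuousAt.2 fun x => (D.h_deriv x).continuousAt
  have hEc : Continuous D.E := continuous_iff_continuousAt.2 fun x => (D.E_deriv x).continuousAt
  have hMc := D.M_cont
  set a : ℝ → ℂ := fun x => (h x : ℂ) * cexp (lam * I * p x) with ha
  have hac : Continuous a := by fun_prop
  obtain ⟨A, hA⟩ := (isCompact_uIcc (a := -R) (b := R)).exists_bound_of_continuousOn
    hac.continuousOn
  set Φ : ℝ → ℝ → ℂ := fun t u =>
    (Ioc (-(R * √t)) (R * √t)).indicator (fun u => a (u / √t) * cexp (-(t * p (u / √t) : ℝ))) u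
  have hp0 : p 0 = 0 := by rw [D.p_eq 0]; ring
  have ha0 : a 0 = h 0 := by simp [ha, hp0]
  have hlim : Tendsto (fun t => ∫ u, Φ t u) atTop
      (𝓝 (∫ u : ℝ, (h 0 : ℂ) * cexp (-(M 0 / 2 * u ^ 2 : ℝ)))) := by
    refine tendsto_integral_filter_of_dominated_convergence
      (fun u => A * Real.exp (-c * u ^ 2)) ?_ ?_ ?_ ?_
    · refine Eventually.of_forall fun t => ?_
      refine (Continuous.aestronglyMeasurable ?_).indicator measurableSet_Ioc
      fun_prop
    · filter_upwards [eventually_gt_atTop 0] with t ht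
      refine Eventually.of_forall fun u => ?_
      have hs : 0 < √t := Real.sqrt_pos.2 ht
      have hA0 : 0 ≤ A := (norm_nonneg _).trans (hA 0 (by
        rw [uIcc_of_le (by linarith)]; exact ⟨by linarith, hR.le⟩))
      simp only [Φ]
      by_cases hu : u ∈ Ioc (-(R * √t)) (R * √t)
      · rw [indicator_of_mem hu, norm_mul]
        refine mul_le_mul (hA _ ?_) ?_ (norm_nonneg _) hA0
        · rw [uIcc_of_le (by linarith)]
          refine ⟨?_, ?_⟩
          · rw [le_div_iff₀ hs]; linarith [hu.1]
          · rw [div_le_iff₀ hs]; exact hu.2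
        · rw [Complex.norm_exp, ← Complex.ofReal_neg, Complex.ofReal_re]
          refine Real.exp_le_exp.2 ?_
          have h1 := D.le_p (u / √t)
          rw [div_pow, Real.sq_sqrt ht.le] at h1
          have h2 : t * (c * (u ^ 2 / t)) ≤ t * p (u / √t) := mul_le_mul_of_nonneg_left h1 ht.le
          have h3 : t * (c * (u ^ 2 / t)) = c * u ^ 2 := by field_simp
          linarith
      · rw [indicator_of_notMem hu, norm_zero]
        positivity
    · exact (integrable_exp_neg_mul_sq D.c_pos).const_mul A
    · refine Eventually.of_forall fun u => ?_
      have hst : Tendsto (fun t : ℝ => √t) atTop atTop := Real.tendsto_sqrt_atTop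
      have hut : Tendsto (fun t : ℝ => u / √t) atTop (𝓝 0) := hst.const_div_atTop u
      -- The factorization of `p` turns `t p(u / √t)` into `u² (1/2 - x E(x)) M(x)` at `x = u / √t`,
      -- which is continuous at `x = 0`.
      have hev : ∀ᶠ t in atTop, a (u / √t) *
          cexp (-(u ^ 2 * ((1 / 2 - u / √t * D.E (u / √t)) * M (u / √t)) : ℝ)) = Φ t u := by
        have := (hst.const_mul_atTop hR).eventually_gt_atTop |u|
        filter_upwards [this, eventually_gt_atTop 0] with t ht ht0
        have hmem : u ∈ Ioc (-(R * √t)) (R * √t) :=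
          ⟨by linarith [neg_abs_le u], by linarith [le_abs_self u]⟩
        simp only [Φ]
        rw [indicator_of_mem hmem]
        congr 4
        rw [D.p_eq (u / √t)]
        have hs : 0 < √t := Real.sqrt_pos.2 ht0
        have h2 : t = √t * √t := (Real.mul_self_sqrt ht0.le).symm
        set s := √t
        rw [h2]
        field_simp
      refine Tendsto.congr' hev ?_
      have hg : Continuous fun x : ℝ => a x * cexp (-(u ^ 2 * ((1 / 2 - x * D.E x) * M x) : ℝ)) := by
        fun_prop
      have h1 := (hg.tendsto 0).comp hut
      have h2 : a 0 * cexp (-(u ^ 2 * ((1 / 2 - 0 * D.E 0) * M 0) : ℝ)) =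
          (h 0 : ℂ) * cexp (-(M 0 / 2 * u ^ 2 : ℝ)) := by
        rw [ha0]; congr 4; ring
      rw [h2] at h1
      exact h1
  have hgauss : ∫ u : ℝ, (h 0 : ℂ) * cexp (-(M 0 / 2 * u ^ 2 : ℝ)) =
      ((h 0 * √(2 * Real.pi / M 0) : ℝ) : ℂ) := by
    have h1 : ∀ u : ℝ, (h 0 : ℂ) * cexp (-(M 0 / 2 * u ^ 2 : ℝ)) =
        ((h 0 * Real.exp (-(M 0 / 2) * u ^ 2) : ℝ) : ℂ) := by
      intro u; push_cast; ring_nf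
    simp_rw [h1]
    rw [integral_complex_ofReal, integral_const_mul, integral_gaussian]
    rw [show Real.pi / (M 0 / 2) = 2 * Real.pi / M 0 by ring]
  rw [hgauss] at hlim
  refine hlim.congr' ?_
  filter_upwards [eventually_gt_atTop 0] with t ht
  have hs : 0 < √t := Real.sqrt_pos.2 ht
  simp only [Φ]
  rw [integral_indicator measurableSet_Ioc, ← intervalIntegral.integral_of_le (by
    have := mul_pos hR hs; linarith), expIntegral]
  have h3 := intervalIntegral.integral_comp_div (a := -(R * √t)) (b := R * √t)
    (fun x => a x * cexp (-(t * p x : ℝ))) hs.ne'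
  rw [h3, Complex.real_smul, neg_div, mul_div_assoc, div_self hs.ne', mul_one]
  congr 2
  ext x
  simp only [ha]
  rw [mul_assoc, ← Complex.exp_add]
  congr 2
  push_cast
  ring

/-- Along `z = t - iλ` the derivative of `z^{1/2} ∫ h e^{-zp}` is at most a constant over `|z|² = t²
+ λ²`, and the integral of this over `t ≥ 0` is that constant times `π / (2λ)`. The value at `t = ∞`
is known from Laplace's method, so the value at `t = 0` is known up to this error. -/
theorem norm_cpow_mul_expIntegral_sub_le (D : PhaseData R B c p M h) (hR : 0 < R) {lam : ℝ}
    (hlam : 0 < lam) :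
    ‖(-(lam * I)) ^ (1 / 2 : ℂ) * expIntegral R h p (-(lam * I)) -
      ((h 0 * √(2 * Real.pi / M 0) : ℝ) : ℂ)‖ ≤
      (2 * Real.pi + R) * B * (Real.pi / 2) / lam := by
  have hpc : Continuous p := continuous_iff_continuousAt.2 fun x => (D.p_deriv x).continuousAt
  have hhc : Continuous h := continuous_iff_continuousAt.2 fun x => (D.h_deriv x).continuousAt
  have hB : 0 ≤ B := (abs_nonneg _).trans (D.G_bound 0)
  set z : ℝ → ℂ := fun t => t - lam * I with hz
  have hre : ∀ t, (z t).re = t := fun t => by simp [hz]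
  have him : ∀ t, (z t).im = -lam := fun t => by simp [hz]
  have hz0 : ∀ t, z t ≠ 0 := fun t h => by
    have := him t; rw [h] at this; simp at this; linarith
  have hslit : ∀ t, z t ∈ slitPlane := fun t => Or.inr (by rw [him]; linarith)
  have hnorm : ∀ t, ‖z t‖ ^ 2 = t ^ 2 + lam ^ 2 := fun t => by
    rw [← Complex.normSq_eq_norm_sq, Complex.normSq_apply, hre, him]; ring
  set Ψ : ℝ → ℂ := fun t => z t ^ (1 / 2 : ℂ) * expIntegral R h p (z t) with hΨ
  have hzd : ∀ t, HasDerivAt z 1 t := fun t => by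
    simpa [hz] using (Complex.ofRealCLM.hasDerivAt (x := t)).sub_const (lam * I : ℂ)
  have hΨd : ∀ t, HasDerivAt Ψ (z t ^ (-(1 / 2) : ℂ) * (expIntegral R h p (z t) / 2 -
      z t * expIntegral R (fun x => h x * p x) p (z t))) t := by
    intro t
    have e0 : HasDerivAt (fun w : ℂ => w ^ (1 / 2 : ℂ)) ((1 / 2 : ℂ) * z t ^ (1 / 2 - 1 : ℂ))
        (z t) := by
      simpa using (hasDerivAt_id (z t)).cpow_const (c := (1 / 2 : ℂ)) (hslit t)
    have e1 := (e0.comp t (hzd t)).mul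
      ((hasDerivAt_expIntegral (R := R) hhc hpc (z t)).comp t (hzd t))
    refine e1.congr_deriv ?_
    have e2 : z t ^ (1 / 2 : ℂ) = z t ^ (-(1 / 2) : ℂ) * z t := by
      nth_rw 3 [← Complex.cpow_one (z t)]
      rw [← Complex.cpow_add _ _ (hz0 t)]; norm_num
    have e3 : z t ^ (1 / 2 - 1 : ℂ) = z t ^ (-(1 / 2) : ℂ) := by norm_num
    rw [e3, Function.comp, Function.comp, e2]
    ring
  set Q := (2 * Real.pi + R) * B with hQ
  have hQ0 : 0 ≤ Q := mul_nonneg (by linarith [Real.pi_pos]) hB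
  have hΨb : ∀ t, 0 ≤ t → ‖z t ^ (-(1 / 2) : ℂ) * (expIntegral R h p (z t) / 2 -
      z t * expIntegral R (fun x => h x * p x) p (z t))‖ ≤ Q / (t ^ 2 + lam ^ 2) := by
    intro t ht
    have hzp : 0 < ‖z t‖ := norm_pos_iff.2 (hz0 t)
    have e1 := D.norm_half_sub_le (z := z t) (by rw [hre]; exact ht) (hz0 t)
    have e2 : ‖z t ^ (-(1 / 2) : ℂ)‖ = 1 / √‖z t‖ := by
      have : (-(1 / 2) : ℂ) = ((-(1 / 2) : ℝ) : ℂ) := by push_cast; ring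
      rw [this, Complex.norm_cpow_real, Real.rpow_neg hzp.le, ← Real.sqrt_eq_rpow, one_div]
    rw [norm_mul, e2, ← hnorm]
    refine (mul_le_mul_of_nonneg_left e1 (by positivity)).trans (le_of_eq ?_)
    have h4 : √‖z t‖ ^ 2 = ‖z t‖ := Real.sq_sqrt hzp.le
    have h5 : 0 < √‖z t‖ := Real.sqrt_pos.2 hzp
    rw [← hQ]
    field_simp
    rw [h4]
    ring
  have hmain : ∀ T, 0 ≤ T → ‖Ψ T - Ψ 0‖ ≤ Q / lam * (Real.pi / 2) := by
    intro T hT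
    have e1 : ∀ x, HasDerivAt (fun t => Q / lam * Real.arctan (t / lam))
        (Q / (x ^ 2 + lam ^ 2)) x := by
      intro x
      have := (((hasDerivAt_id x).div_const lam).arctan).const_mul (Q / lam)
      refine this.congr_deriv ?_
      simp only [id]
      field_simp
      ring
    have e2 := image_norm_le_of_norm_deriv_right_le_deriv_boundary (a := 0) (b := T)
      (f := fun t => Ψ t - Ψ 0) (B := fun t => Q / lam * Real.arctan (t / lam))
      (fun t _ => ((hΨd t).continuousAt.sub continuousAt_const).continuousWithinAt)
      (fun t _ => ((hΨd t).sub_const _).hasDerivWithinAt) (by simp)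
      e1 (fun t ht => hΨb t ht.1)
      (right_mem_Icc.2 hT)
    refine e2.trans ?_
    exact mul_le_mul_of_nonneg_left (Real.arctan_lt_pi_div_two _).le (by positivity)
  have hlim : Tendsto Ψ atTop (𝓝 ((h 0 * √(2 * Real.pi / M 0) : ℝ) : ℂ)) := by
    have e1 := D.tendsto_sqrt_mul_expIntegral hR lam
    have e2 : Tendsto (fun t : ℝ => (1 - ((lam / t : ℝ) : ℂ) * I) ^ (1 / 2 : ℂ)) atTop (𝓝 1) := by
      have h1 : Tendsto (fun t : ℝ => (1 - ((lam / t : ℝ) : ℂ) * I)) atTop (𝓝 1) := by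
        have h2 : Tendsto (fun t : ℝ => lam / t) atTop (𝓝 0) := tendsto_id.const_div_atTop lam
        have h3 : Continuous fun x : ℝ => (1 - (x : ℂ) * I) := by fun_prop
        simpa [Function.comp_def] using (h3.tendsto 0).comp h2
      have h4 := (continuousAt_cpow_const (a := 1) (b := (1 / 2 : ℂ)) (by simp)).tendsto.comp h1
      simpa [Function.comp_def] using h4
    have e3 := e2.mul e1
    rw [one_mul] at e3
    refine e3.congr' ?_
    filter_upwards [eventually_gt_atTop 0] with t ht
    have hw0 : (1 - ((lam / t : ℝ) : ℂ) * I) ≠ 0 := fun h => by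
      have := congrArg Complex.re h; simp at this
    have h1 : z t = (t : ℂ) * (1 - ((lam / t : ℝ) : ℂ) * I) := by
      have : (t : ℂ) ≠ 0 := by exact_mod_cast ht.ne'
      simp only [hz]; push_cast; field_simp
    have h2 : z t ^ (1 / 2 : ℂ) = ((√t : ℝ) : ℂ) * (1 - ((lam / t : ℝ) : ℂ) * I) ^ (1 / 2 : ℂ) := by
      rw [Real.sqrt_eq_rpow, Complex.ofReal_cpow ht.le, Complex.cpow_def_of_ne_zero (hz0 t),
        Complex.cpow_def_of_ne_zero hw0, Complex.cpow_def_of_ne_zero (by exact_mod_cast ht.ne'),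
        ← Complex.exp_add, h1, Complex.log_ofReal_mul ht hw0, Complex.ofReal_log ht.le]
      congr 1
      push_cast
      ring
    simp only [hΨ]
    rw [h2]
    ring
  have h0 : z 0 = -(lam * I) := by simp [hz]
  have hfin := le_of_tendsto ((hlim.sub_const (Ψ 0)).norm)
    ((eventually_ge_atTop 0).mono hmain)
  rw [norm_sub_rev] at hfin
  simp only [hΨ, h0] at hfin
  refine hfin.trans (le_of_eq ?_)
  ring

end PhaseData

end StationaryPhase

/-! ### Families of phases and amplitudes, with bounds uniform in the direction. -/

section Families

/-- The partial derivative in the second variable. -/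
def dsnd (f : ℝ × ℝ → ℝ) (q : ℝ × ℝ) : ℝ := fderiv ℝ f q (0, 1)

/-- The partial derivative in the first variable. -/
def dfst (f : ℝ × ℝ → ℝ) (q : ℝ × ℝ) : ℝ := fderiv ℝ f q (1, 0)

theorem hasDerivAt_dsnd {f : ℝ × ℝ → ℝ} (hf : ContDiff ℝ ∞ f) (β x : ℝ) :
    HasDerivAt (fun x => f (β, x)) (dsnd f (β, x)) x := by
  have h1 := (hf.differentiable (by simp) (β, x)).hasFDerivAt
  exact h1.comp_hasDerivAt x ((hasDerivAt_const x β).prodMk (hasDerivAt_id x))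

theorem hasDerivAt_dfst {f : ℝ × ℝ → ℝ} (hf : ContDiff ℝ ∞ f) (β x : ℝ) :
    HasDerivAt (fun β => f (β, x)) (dfst f (β, x)) β := by
  have h1 := (hf.differentiable (by simp) (β, x)).hasFDerivAt
  exact h1.comp_hasDerivAt (f := fun b : ℝ => (b, x)) β
    ((hasDerivAt_id β).prodMk (hasDerivAt_const β x))

/-- Smooth functions on the strip that are `2π`-periodic in the first variable. -/
structure IsFamily (f : ℝ × ℝ → ℝ) : Prop where
  smooth : ContDiff ℝ ∞ f
  periodic : ∀ β x, f (β + 2 * Real.pi, x) = f (β, x)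

namespace IsFamily

variable {f g : ℝ × ℝ → ℝ}

theorem add (hf : IsFamily f) (hg : IsFamily g) : IsFamily fun q => f q + g q :=
  ⟨hf.smooth.add hg.smooth, fun β x => by simp only [hf.periodic, hg.periodic]⟩

theorem sub (hf : IsFamily f) (hg : IsFamily g) : IsFamily fun q => f q - g q :=
  ⟨hf.smooth.sub hg.smooth, fun β x => by simp only [hf.periodic, hg.periodic]⟩

theorem mul (hf : IsFamily f) (hg : IsFamily g) : IsFamily fun q => f q * g q :=
  ⟨hf.smooth.mul hg.smooth, fun β x => by simp only [hf.periodic, hg.periodic]⟩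

theorem div (hf : IsFamily f) (hg : IsFamily g) (h0 : ∀ q, g q ≠ 0) :
    IsFamily fun q => f q / g q :=
  ⟨hf.smooth.div hg.smooth h0, fun β x => by simp only [hf.periodic, hg.periodic]⟩

theorem ofSnd {k : ℝ → ℝ} (hk : ContDiff ℝ ∞ k) : IsFamily fun q => k q.2 :=
  ⟨hk.comp contDiff_snd, fun _ _ => rfl⟩

theorem fderiv_periodic (hf : IsFamily f) (β x : ℝ) :
    fderiv ℝ f (β + 2 * Real.pi, x) = fderiv ℝ f (β, x) := by
  have h1 : (fun q : ℝ × ℝ => f (q + (2 * Real.pi, 0))) = f := by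
    ext ⟨b, y⟩
    simp [hf.periodic]
  have h2 := fderiv_comp_add_right (𝕜 := ℝ) (f := f) (x := (β, x)) (2 * Real.pi, 0)
  rw [h1] at h2
  simpa using h2.symm

theorem dsnd (hf : IsFamily f) : IsFamily (dsnd f) :=
  ⟨(hf.smooth.fderiv_right (m := ∞) (by simp)).clm_apply contDiff_const, fun β x => by
    simp only [CurvedNorm.dsnd, hf.fderiv_periodic]⟩

theorem dfst (hf : IsFamily f) : IsFamily (dfst f) :=
  ⟨(hf.smooth.fderiv_right (m := ∞) (by simp)).clm_apply contDiff_const, fun β x => by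
    simp only [CurvedNorm.dfst, hf.fderiv_periodic]⟩

end IsFamily

/-- Families supported in `|x| ≤ 5/2`. -/
structure IsAmplitude (f : ℝ × ℝ → ℝ) : Prop extends IsFamily f where
  supp : ∀ β x, 5 / 2 < |x| → f (β, x) = 0

namespace IsAmplitude

variable {f g : ℝ × ℝ → ℝ}

theorem add (hf : IsAmplitude f) (hg : IsAmplitude g) : IsAmplitude fun q => f q + g q :=
  ⟨hf.toIsFamily.add hg.toIsFamily, fun β x hx => by simp [hf.supp β x hx, hg.supp β x hx]⟩

theorem sub (hf : IsAmplitude f) (hg : IsAmplitude g) : IsAmplitude fun q => f q - g q :=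
  ⟨hf.toIsFamily.sub hg.toIsFamily, fun β x hx => by simp [hf.supp β x hx, hg.supp β x hx]⟩

theorem mul_right (hf : IsAmplitude f) (hg : IsFamily g) : IsAmplitude fun q => f q * g q :=
  ⟨hf.toIsFamily.mul hg, fun β x hx => by simp [hf.supp β x hx]⟩

theorem div (hf : IsAmplitude f) (hg : IsFamily g) (h0 : ∀ q, g q ≠ 0) :
    IsAmplitude fun q => f q / g q :=
  ⟨hf.toIsFamily.div hg h0, fun β x hx => by simp [hf.supp β x hx]⟩

theorem fderiv_eq_zero (hf : IsAmplitude f) {β x : ℝ} (hx : 5 / 2 < |x|) :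
    fderiv ℝ f (β, x) = 0 := by
  have h1 : f =ᶠ[𝓝 (β, x)] fun _ => 0 := by
    have : IsOpen {q : ℝ × ℝ | 5 / 2 < |q.2|} := isOpen_lt continuous_const (by fun_prop)
    filter_upwards [this.mem_nhds hx] with q hq
    exact hf.supp q.1 q.2 hq
  rw [h1.fderiv_eq]
  simp

theorem dsnd (hf : IsAmplitude f) : IsAmplitude (dsnd f) :=
  ⟨hf.toIsFamily.dsnd, fun β x hx => by simp [CurvedNorm.dsnd, hf.fderiv_eq_zero hx]⟩

theorem dfst (hf : IsAmplitude f) : IsAmplitude (dfst f) :=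
  ⟨hf.toIsFamily.dfst, fun β x hx => by simp [CurvedNorm.dfst, hf.fderiv_eq_zero hx]⟩

/-- Compactness in `x` comes from the support and in `β` from periodicity. All uniformity in the
direction rests on this. -/
theorem bounded (hf : IsAmplitude f) : ∃ B, ∀ q, |f q| ≤ B := by
  obtain ⟨B, hB⟩ := ((isCompact_Icc (a := (0 : ℝ)) (b := 2 * Real.pi)).prod
    (isCompact_Icc (a := -(5 / 2 : ℝ)) (b := 5 / 2))).exists_bound_of_continuousOn
    hf.smooth.continuous.continuousOn
  refine ⟨max B 0, fun q => ?_⟩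
  obtain ⟨β, x⟩ := q
  by_cases hx : 5 / 2 < |x|
  · simp [hf.supp β x hx]
  · have hper : Function.Periodic (fun β => f (β, x)) (2 * Real.pi) := fun β => hf.periodic β x
    obtain ⟨y, hy, hxy⟩ := hper.exists_mem_Ico₀ Real.two_pi_pos β
    rw [show f (β, x) = f (y, x) from hxy]
    exact (hB (y, x) ⟨⟨hy.1, hy.2.le⟩, abs_le.1 (not_lt.1 hx)⟩).trans (le_max_left _ _)

theorem right (hf : IsAmplitude f) (β : ℝ) : f (β, 3) = 0 := hf.supp _ _ (by norm_num)

theorem left (hf : IsAmplitude f) (β : ℝ) : f (β, -3) = 0 := hf.supp _ _ (by norm_num)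

end IsAmplitude

/-- The second-order remainder in `∫₀ˣ t M(t) dt = x² M(x) / 2 - x³ S(x)`. -/
def phaseRem (M : ℝ × ℝ → ℝ) (q : ℝ × ℝ) : ℝ :=
  ∫ v in (0 : ℝ)..1, v ^ 2 / 2 * dsnd M (q.1, v * q.2)

/-- The phase `∫₀ˣ t M(t) dt`. -/
def phase (M : ℝ × ℝ → ℝ) (q : ℝ × ℝ) : ℝ := q.2 ^ 2 * M q / 2 - q.2 ^ 3 * phaseRem M q

variable {M h : ℝ × ℝ → ℝ}

theorem IsFamily.phaseRem (hM : IsFamily M) : IsFamily (phaseRem M) := by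
  refine ⟨?_, fun β x => ?_⟩
  · apply contDiff_intervalIntegral_param
      (F := fun r : (ℝ × ℝ) × ℝ => r.2 ^ 2 / 2 * CurvedNorm.dsnd M (r.1.1, r.2 * r.1.2))
    refine ContDiff.mul (by fun_prop) (hM.dsnd.smooth.comp (by fun_prop))
  · simp only [CurvedNorm.phaseRem, hM.dsnd.periodic]

theorem IsFamily.phase (hM : IsFamily M) : IsFamily (phase M) := by
  refine ⟨?_, fun β x => ?_⟩
  · have h1 := hM.smooth
    have h2 := hM.phaseRem.smooth
    unfold CurvedNorm.phase
    fun_prop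
  · simp only [CurvedNorm.phase, hM.periodic, hM.phaseRem.periodic]

/-- Integration by parts gives `∫₀ˣ t M = x² M / 2 - ∫₀ˣ (t² / 2) ∂ₓM`, and `t = v x` exhibits the
last integral as `x³` times a smooth function. In this form the division of the phase by its
derivative `x M` is visibly smooth at `x = 0`. -/
theorem hasDerivAt_phase (hM : IsFamily M) (β x : ℝ) :
    HasDerivAt (fun x => phase M (β, x)) (x * M (β, x)) x := by
  have hc : Continuous fun t : ℝ => t ^ 2 / 2 * dsnd M (β, t) := by
    have := hM.dsnd.smooth.continuous
    fun_prop
  have h1 : ∀ x : ℝ, x ^ 3 * phaseRem M (β, x) = ∫ t in (0 : ℝ)..x, t ^ 2 / 2 * dsnd M (β, t) := by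
    intro x
    have := intervalIntegral.smul_integral_comp_mul_right (a := 0) (b := 1)
      (fun t : ℝ => t ^ 2 / 2 * dsnd M (β, t)) x
    rw [zero_mul, one_mul] at this
    rw [← this, phaseRem, smul_eq_mul, ← intervalIntegral.integral_const_mul,
      ← intervalIntegral.integral_const_mul]
    congr 1
    ext v
    ring
  have h2 : HasDerivAt (fun x : ℝ => x ^ 3 * phaseRem M (β, x)) (x ^ 2 / 2 * dsnd M (β, x)) x := by
    simp_rw [h1]
    exact intervalIntegral.integral_hasDerivAt_right (hc.intervalIntegrable _ _)
      (hc.stronglyMeasurableAtFilter _ _) hc.continuousAt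
  have h3 : HasDerivAt (fun x : ℝ => x ^ 2) (2 * x) x := by simpa using hasDerivAt_pow 2 x
  have h4 := ((h3.mul (hasDerivAt_dsnd hM.smooth β x)).div_const 2).sub h2
  refine h4.congr_deriv ?_
  ring

theorem phase_zero (β : ℝ) : phase M (β, 0) = 0 := by simp [phase]

theorem le_phase (hM : IsFamily M) {c : ℝ} (hc : ∀ q, c ≤ M q) (β x : ℝ) :
    c / 2 * x ^ 2 ≤ phase M (β, x) := by
  have hd : ∀ x, HasDerivAt (fun x => phase M (β, x) - c / 2 * x ^ 2) (x * (M (β, x) - c)) x := by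
    intro x
    have h3 : HasDerivAt (fun x : ℝ => x ^ 2) (2 * x) x := by simpa using hasDerivAt_pow 2 x
    refine ((hasDerivAt_phase hM β x).sub (h3.const_mul (c / 2))).congr_deriv ?_
    ring
  have h0 : phase M (β, 0) - c / 2 * 0 ^ 2 = 0 := by rw [phase_zero]; ring
  have hcont : Continuous fun x => phase M (β, x) - c / 2 * x ^ 2 :=
    continuous_iff_continuousAt.2 fun x => (hd x).continuousAt
  rcases le_total 0 x with hx | hx
  · have := monotoneOn_of_deriv_nonneg (convex_Ici (0 : ℝ)) hcont.continuousOn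
      (fun y _ => (hd y).differentiableAt.differentiableWithinAt) (fun y hy => by
        rw [(hd y).deriv]
        rw [interior_Ici] at hy
        exact mul_nonneg (le_of_lt hy) (sub_nonneg.2 (hc _)))
      (mem_Ici.2 le_rfl) (mem_Ici.2 hx) hx
    simp only [h0] at this
    linarith
  · have := antitoneOn_of_deriv_nonpos (convex_Iic (0 : ℝ)) hcont.continuousOn
      (fun y _ => (hd y).differentiableAt.differentiableWithinAt) (fun y hy => by
        rw [(hd y).deriv]
        rw [interior_Iic] at hy
        exact mul_nonpos_of_nonpos_of_nonneg (le_of_lt hy) (sub_nonneg.2 (hc _)))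
      (mem_Iic.2 hx) (mem_Iic.2 le_rfl) hx
    simp only [h0] at this
    linarith

/-- The oscillatory integrals `∫ h(β, x) e^{i λ p(β, x)} dx`. -/
def oscIntegral (M h : ℝ × ℝ → ℝ) (β lam : ℝ) : ℂ :=
  expIntegral 3 (fun x => h (β, x)) (fun x => phase M (β, x)) (-(lam * I))

theorem exists_oscIntegral_le (hM : IsFamily M) {c : ℝ} (hc0 : 0 < c) (hc : ∀ q, c ≤ M q)
    (hh : IsAmplitude h) :
    ∃ C, ∀ β lam : ℝ, 0 < lam → ‖oscIntegral M h β lam‖ ≤ C / √lam := by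
  have hM0 : ∀ q, M q ≠ 0 := fun q => (hc0.trans_le (hc q)).ne'
  have hG := hh.div hM hM0
  obtain ⟨B1, h1⟩ := hh.bounded
  obtain ⟨B2, h2⟩ := hG.bounded
  obtain ⟨B3, h3⟩ := hG.dsnd.bounded
  set B := max B1 (max B2 B3)
  refine ⟨(2 * Real.pi + 3) * B, fun β lam hl => ?_⟩
  have hcx : Continuous fun x : ℝ => (β, x) := by fun_prop
  have key := norm_expIntegral_le_inv_sqrt (R := 3) (B := B) (by norm_num)
    (p := fun x => phase M (β, x))
    (M := fun x => M (β, x)) (G := fun x => h (β, x) / M (β, x))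
    (G' := fun x => dsnd (fun q => h q / M q) (β, x))
    (fun x => (by positivity : (0 : ℝ) ≤ c / 2 * x ^ 2).trans (le_phase hM hc β x))
    (hasDerivAt_phase hM β) (hM.smooth.continuous.comp hcx)
    (hasDerivAt_dsnd hG.smooth β) (hG.dsnd.smooth.continuous.comp hcx)
    (hG.right β) (hG.left β)
    (fun x => by
      rw [div_mul_cancel₀ _ (hM0 _)]
      exact (h1 _).trans (le_max_left _ _))
    (fun x => (h2 (β, x)).trans ((le_max_left _ _).trans (le_max_right _ _)))
    (fun x => (h3 (β, x)).trans ((le_max_right _ _).trans (le_max_right _ _)))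
    (z := -(lam * I)) (by simp) (by simp [hl.ne'])
  have e1 : ‖(-(lam * I) : ℂ)‖ = lam := by simp [abs_of_pos hl]
  rw [e1] at key
  have e2 : (fun x => h (β, x) / M (β, x) * M (β, x)) = fun x => h (β, x) := by
    ext x; rw [div_mul_cancel₀ _ (hM0 _)]
  rw [e2] at key
  exact key

/-- The quotient of the phase by `x M` is `x/2 - x² phaseRem / M`, which dictates `E`; the fields of
`PhaseData` then determine `F` and `G`. The lower bound on `M` keeps the quotients smooth, and
boundedness of amplitudes makes `B` independent of `β`. -/
theorem exists_phaseData (hM : IsFamily M) {c : ℝ} (hc0 : 0 < c) (hc : ∀ q, c ≤ M q)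
    (hh : IsAmplitude h) :
    ∃ B, ∀ β, Nonempty (PhaseData 3 B (c / 2) (fun x => phase M (β, x)) (fun x => M (β, x))
      (fun x => h (β, x))) := by
  have hM0 : ∀ q, M q ≠ 0 := fun q => (hc0.trans_le (hc q)).ne'
  set E : ℝ × ℝ → ℝ := fun q => phaseRem M q / M q with hEdef
  have hE : IsFamily E := hM.phaseRem.div hM hM0
  set F : ℝ × ℝ → ℝ := fun q =>
    (h q * E q * 2 - dsnd h q * (1 / 2) + dsnd (fun q => h q * E q) q * q.2) / M q with hFdef
  have hF : IsAmplitude F :=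
    ((((hh.mul_right hE).mul_right (IsFamily.ofSnd contDiff_const)).sub
      (hh.dsnd.mul_right (IsFamily.ofSnd contDiff_const))).add
      ((hh.mul_right hE).dsnd.mul_right (IsFamily.ofSnd contDiff_id))).div hM hM0
  set G : ℝ × ℝ → ℝ := fun q => dsnd F q / M q with hGdef
  have hG : IsAmplitude G := hF.dsnd.div hM hM0
  obtain ⟨B1, h1⟩ := hF.dsnd.bounded
  obtain ⟨B2, h2⟩ := hG.bounded
  obtain ⟨B3, h3⟩ := hG.dsnd.bounded
  have hGM : ∀ q, G q * M q = dsnd F q := fun q => div_mul_cancel₀ _ (hM0 _)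
  refine ⟨max B1 (max B2 B3), fun β => ?_⟩
  have hcx : Continuous fun x : ℝ => (β, x) := by fun_prop
  exact ⟨
  { E := fun x => E (β, x)
    E' := fun x => dsnd E (β, x)
    h' := fun x => dsnd h (β, x)
    F := fun x => F (β, x)
    G := fun x => G (β, x)
    G' := fun x => dsnd G (β, x)
    R_nonneg := by norm_num
    c_pos := by positivity
    le_p := le_phase hM hc β
    p_deriv := hasDerivAt_phase hM β
    M_cont := hM.smooth.continuous.comp hcx
    p_eq := fun x => by
      have := hM0 (β, x)
      simp only [phase, hEdef]
      field_simp
    E_deriv := hasDerivAt_dsnd hE.smooth β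
    E'_cont := hE.dsnd.smooth.continuous.comp hcx
    h_deriv := hasDerivAt_dsnd hh.smooth β
    h'_cont := hh.dsnd.smooth.continuous.comp hcx
    h_right := hh.right β
    h_left := hh.left β
    F_eq := fun x => by
      have e1 := ((hasDerivAt_dsnd hh.smooth β x).mul (hasDerivAt_dsnd hE.smooth β x)).unique
        (hasDerivAt_dsnd (hh.mul_right hE).smooth β x)
      simp only [hFdef]
      rw [div_mul_cancel₀ _ (hM0 _), ← e1]
      ring
    F_deriv := fun x => by
      rw [hGM]; exact hasDerivAt_dsnd hF.smooth β x
    F_right := hF.right β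
    F_left := hF.left β
    G_deriv := hasDerivAt_dsnd hG.smooth β
    G'_cont := hG.dsnd.smooth.continuous.comp hcx
    G_right := hG.right β
    G_left := hG.left β
    GM_bound := fun x => by
      rw [hGM]; exact (h1 _).trans (le_max_left _ _)
    G_bound := fun x => (h2 (β, x)).trans ((le_max_left _ _).trans (le_max_right _ _))
    G'_bound := fun x => (h3 (β, x)).trans ((le_max_right _ _).trans (le_max_right _ _)) }⟩

/-- The leading term of the stationary phase expansion. -/
def leadingTerm (M h : ℝ × ℝ → ℝ) (β lam : ℝ) : ℂ :=
  ((h (β, 0) * √(2 * Real.pi / M (β, 0)) / √lam : ℝ) : ℂ) * cexp ((Real.pi / 4 : ℝ) * I)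

theorem neg_mul_I_cpow {lam : ℝ} (hl : 0 < lam) :
    (-(lam * I)) ^ (1 / 2 : ℂ) = ((√lam : ℝ) : ℂ) * cexp (-((Real.pi / 4 : ℝ) * I)) := by
  have h1 : (-(lam * I) : ℂ) = (lam : ℂ) * (-I) := by ring
  have h0 : (-(lam * I) : ℂ) ≠ 0 := by simp [hl.ne']
  rw [Complex.cpow_def_of_ne_zero h0, h1, Complex.log_ofReal_mul hl (by simp), Complex.log_neg_I,
    Real.sqrt_eq_rpow, Complex.ofReal_cpow hl.le,
    Complex.cpow_def_of_ne_zero (by exact_mod_cast hl.ne'), ← Complex.exp_add,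
    Complex.ofReal_log hl.le]
  congr 1
  push_cast
  ring

/-- The second estimate says that `λ dI/dλ + I/2` is small, where `I` is the oscillatory integral.
The leading term is homogeneous of degree `-1/2` in `λ` and makes the same expression vanish, so the
two estimates together control the `λ`-derivative of the remainder. -/
theorem exists_stationary_phase (hM : IsFamily M) {c : ℝ} (hc0 : 0 < c) (hc : ∀ q, c ≤ M q)
    (hh : IsAmplitude h) :
    ∃ C, ∀ β lam : ℝ, 0 < lam →
      ‖oscIntegral M h β lam - leadingTerm M h β lam‖ ≤ C / (lam * √lam) ∧
      ‖oscIntegral M h β lam / 2 + lam * I * oscIntegral M (fun q => h q * phase M q) β lam‖ ≤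
        C / (lam * √lam) := by
  obtain ⟨B, hB⟩ := exists_phaseData hM hc0 hc hh
  have hB0 : 0 ≤ B := (abs_nonneg _).trans ((hB 0).some.G_bound 0)
  refine ⟨(2 * Real.pi + 3) * B * (Real.pi / 2), fun β lam hl => ?_⟩
  obtain ⟨D⟩ := hB β
  have hs : 0 < √lam := Real.sqrt_pos.2 hl
  have e1 : ‖(-(lam * I) : ℂ)‖ = lam := by simp [abs_of_pos hl]
  constructor
  · have k1 := D.norm_cpow_mul_expIntegral_sub_le (by norm_num) hl
    rw [neg_mul_I_cpow hl] at k1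
    have k2 : oscIntegral M h β lam - leadingTerm M h β lam =
        ((1 / √lam : ℝ) : ℂ) * cexp ((Real.pi / 4 : ℝ) * I) *
        (((√lam : ℝ) : ℂ) * cexp (-((Real.pi / 4 : ℝ) * I)) * oscIntegral M h β lam -
          ((h (β, 0) * √(2 * Real.pi / M (β, 0)) : ℝ) : ℂ)) := by
      have hs' : ((√lam : ℝ) : ℂ) ≠ 0 := by exact_mod_cast hs.ne'
      rw [leadingTerm, Complex.exp_neg]
      have := Complex.exp_ne_zero ((Real.pi / 4 : ℝ) * I)
      push_cast
      field_simp
    rw [k2, norm_mul, norm_mul, Complex.norm_exp_ofReal_mul_I, mul_one, Complex.norm_real,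
      Real.norm_eq_abs, abs_of_pos (by positivity)]
    refine (mul_le_mul_of_nonneg_left k1 (by positivity)).trans (le_of_eq ?_)
    field_simp
  · have k1 := D.norm_half_sub_le (z := -(lam * I)) (by simp) (by simp [hl.ne'])
    rw [e1] at k1
    have k2 : oscIntegral M h β lam / 2 + lam * I * oscIntegral M (fun q => h q * phase M q) β lam =
        expIntegral 3 (fun x => h (β, x)) (fun x => phase M (β, x)) (-(lam * I)) / 2 -
        -(lam * I) * expIntegral 3 (fun x => h (β, x) * phase M (β, x))
          (fun x => phase M (β, x)) (-(lam * I)) := by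
      simp only [oscIntegral]; ring
    rw [k2]
    refine k1.trans ?_
    rw [div_div, mul_comm (√lam)]
    have : (1 : ℝ) ≤ Real.pi / 2 := by linarith [Real.two_le_pi]
    have h5 : 0 ≤ (2 * Real.pi + 3) * B := by have := Real.pi_pos; positivity
    exact div_le_div_of_nonneg_right (by nlinarith) (by positivity)

theorem hasDerivAt_oscIntegral_lam (hM : IsFamily M) (hh : IsAmplitude h) (β lam : ℝ) :
    HasDerivAt (fun lam : ℝ => oscIntegral M h β lam)
      (I * oscIntegral M (fun q => h q * phase M q) β lam) lam := by
  have hcx : Continuous fun x : ℝ => (β, x) := by fun_prop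
  have h1 := hasDerivAt_expIntegral (R := 3) (hh.smooth.continuous.comp hcx)
    (hM.phase.smooth.continuous.comp hcx) (-(lam * I))
  have h2 : HasDerivAt (fun lam : ℝ => (-(lam * I) : ℂ)) (-I) lam := by
    have := ((Complex.ofRealCLM.hasDerivAt (x := lam)).mul_const I).neg
    exact this.congr_deriv (by simp)
  refine (h1.comp lam h2).congr_deriv ?_
  simp only [oscIntegral, Function.comp_def]
  ring

/-- The amplitude of the `β`-derivative of the oscillatory integral. -/
def fstAmplitude (M h : ℝ × ℝ → ℝ) (q : ℝ × ℝ) : ℝ :=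
  dfst h q - dsnd (fun q => h q * (q.2 * (dfst M q / 2 - q.2 * dfst (phaseRem M) q) / M q)) q

theorem isFamily_quot (hM : IsFamily M) (hM0 : ∀ q, M q ≠ 0) :
    IsFamily fun q => q.2 * (dfst M q / 2 - q.2 * dfst (phaseRem M) q) / M q :=
  ((IsFamily.ofSnd contDiff_id).mul ((hM.dfst.div (IsFamily.ofSnd contDiff_const)
    (fun _ => by norm_num)).sub ((IsFamily.ofSnd contDiff_id).mul hM.phaseRem.dfst))).div hM hM0

theorem isAmplitude_fstAmplitude (hM : IsFamily M) (hM0 : ∀ q, M q ≠ 0) (hh : IsAmplitude h) :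
    IsAmplitude (fstAmplitude M h) :=
  hh.dfst.sub (hh.mul_right (isFamily_quot hM hM0)).dsnd

/-- The `β`-derivative of the phase vanishes to second order at `x = 0`, so it is a smooth multiple
of `x M`, the `x`-derivative of the phase. Integration by parts absorbs the factor `λ` that
differentiation brings down, and the result is again an oscillatory integral with a smooth
amplitude. -/
theorem hasDerivAt_oscIntegral_fst (hM : IsFamily M) (hM0 : ∀ q, M q ≠ 0) (hh : IsAmplitude h)
    (β lam : ℝ) :
    HasDerivAt (fun β : ℝ => oscIntegral M h β lam)
      (oscIntegral M (fstAmplitude M h) β lam) β := by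
  set z : ℂ := -(lam * I) with hz
  have hps := hM.phase.smooth
  have hhs := hh.smooth
  set F : ℝ × ℝ → ℂ := fun q => (h q : ℂ) * cexp (-z * phase M q) with hF
  have hFs : ContDiff ℝ 1 F := by
    have h1 : ContDiff ℝ 1 fun q => (h q : ℂ) :=
      (Complex.ofRealCLM.contDiff.comp hhs).of_le (by exact_mod_cast le_top)
    have h2 : ContDiff ℝ 1 fun q => (phase M q : ℂ) :=
      (Complex.ofRealCLM.contDiff.comp hps).of_le (by exact_mod_cast le_top)
    exact h1.mul (contDiff_const.mul h2).cexp
  have hQ := hh.mul_right (isFamily_quot hM hM0)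
  have key := (hasFDerivAt_intervalIntegral_param hFs (-3) 3 β).hasDerivAt
  refine key.congr_deriv ?_
  have hdc : Continuous fun v : ℝ => (fderiv ℝ F (β, v)).comp (ContinuousLinearMap.inl ℝ ℝ ℝ) :=
    ((hFs.continuous_fderiv (by norm_num)).comp (by fun_prop)).clm_comp continuous_const
  rw [ContinuousLinearMap.intervalIntegral_apply (hdc.intervalIntegrable _ _)]
  have hcx : Continuous fun x : ℝ => (β, x) := by fun_prop
  have e1 : ∀ x, dfst (phase M) (β, x) =
      (x * (dfst M (β, x) / 2 - x * dfst (phaseRem M) (β, x)) / M (β, x)) * (x * M (β, x)) := by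
    intro x
    have d1 := (((hasDerivAt_dfst hM.smooth β x).const_mul (x ^ 2)).div_const 2).sub
      ((hasDerivAt_dfst hM.phaseRem.smooth β x).const_mul (x ^ 3))
    rw [(hasDerivAt_dfst hps β x).unique d1]
    have := hM0 (β, x)
    field_simp
  have e2 : ∀ x, (fderiv ℝ F (β, x)).comp (ContinuousLinearMap.inl ℝ ℝ ℝ) 1 =
      (dfst h (β, x) : ℂ) * cexp (-z * phase M (β, x)) -
      z * (((h (β, x) * (x * (dfst M (β, x) / 2 - x * dfst (phaseRem M) (β, x)) / M (β, x)) *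
        (x * M (β, x)) : ℝ) : ℂ) * cexp (-z * phase M (β, x))) := by
    intro x
    have d1 : HasDerivAt (fun β => F (β, x))
        ((fderiv ℝ F (β, x)).comp (ContinuousLinearMap.inl ℝ ℝ ℝ) 1) β :=
      ((hFs.differentiable (by norm_num) (β, x)).hasFDerivAt).comp_hasDerivAt
        (f := fun b : ℝ => (b, x)) β ((hasDerivAt_id β).prodMk (hasDerivAt_const β x))
    have d2 := ((hasDerivAt_dfst hhs β x).ofReal_comp).mul
      (((hasDerivAt_dfst hps β x).ofReal_comp.const_mul (-z)).cexp)
    rw [d1.unique d2, e1]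
    push_cast
    ring
  have hibp := mul_expIntegral_eq (R := 3) (hasDerivAt_phase hM β) (hM.smooth.continuous.comp hcx)
    (hasDerivAt_dsnd hQ.smooth β) (hQ.dsnd.smooth.continuous.comp hcx) (hQ.right β) (hQ.left β) z
  have hphc : Continuous fun x => phase M (β, x) := hps.continuous.comp hcx
  have hhc : Continuous fun x => h (β, x) := hhs.continuous.comp hcx
  have hdc1 : Continuous fun x => dfst h (β, x) := hh.dfst.smooth.continuous.comp hcx
  have hdc2 : Continuous fun x => dsnd (fun q => h q * (q.2 * (dfst M q / 2 -
      q.2 * dfst (phaseRem M) q) / M q)) (β, x) := hQ.dsnd.smooth.continuous.comp hcx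
  have hdc3 : Continuous fun x => h (β, x) * (x * (dfst M (β, x) / 2 -
      x * dfst (phaseRem M) (β, x)) / M (β, x)) := hQ.smooth.continuous.comp hcx
  have hMc : Continuous fun x => M (β, x) := hM.smooth.continuous.comp hcx
  simp_rw [e2]
  have hdc4 : Continuous fun x : ℝ => z * (((h (β, x) * (x * (dfst M (β, x) / 2 -
      x * dfst (phaseRem M) (β, x)) / M (β, x)) * (x * M (β, x)) : ℝ) : ℂ) *
        cexp (-z * phase M (β, x))) := by
    refine continuous_const.mul (Continuous.mul ?_ (by fun_prop))
    exact Complex.continuous_ofReal.comp (hdc3.mul (continuous_id.mul hMc))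
  rw [intervalIntegral.integral_sub (by apply Continuous.intervalIntegrable; fun_prop)
    (hdc4.intervalIntegrable _ _),
    intervalIntegral.integral_const_mul]
  have hibp' : z * ∫ (x : ℝ) in (-3)..3,
      ((h (β, x) * (x * (dfst M (β, x) / 2 - x * dfst (phaseRem M) (β, x)) / M (β, x)) *
        (x * M (β, x)) : ℝ) : ℂ) * cexp (-z * phase M (β, x)) = _ := hibp
  rw [hibp']
  simp only [oscIntegral, expIntegral, fstAmplitude]
  rw [← intervalIntegral.integral_sub (by apply Continuous.intervalIntegrable; fun_prop)
    (by apply Continuous.intervalIntegrable; fun_prop)]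
  congr 1
  ext x
  push_cast
  ring

end Families

/-! ### Support functions, and stationary phase for the measure on the dual curve. -/

section Support

/-- `n` is the support function, on the unit circle, of a smooth symmetric planar body of positive
curvature. -/
structure IsSupport (n : ℝ → ℝ) : Prop where
  smooth : ContDiff ℝ ∞ n
  periodic : ∀ α, n (α + Real.pi) = n α
  pos : ∀ α, 0 < n α
  curv : ∀ α, 0 < n α + deriv (deriv n) α

/-- The unit vector at angle `α`. -/
def unitVec (α : ℝ) : Plane := !₂[Real.cos α, Real.sin α]

/-- The unit vector at angle `α + π / 2`. -/
def unitVec' (α : ℝ) : Plane := !₂[-Real.sin α, Real.cos α]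

/-- The radius of curvature of the curve with support function `n`. -/
def curvRadius (n : ℝ → ℝ) (α : ℝ) : ℝ := n α + deriv (deriv n) α

/-- The point with outer normal `unitVec α` of the curve with support function `n`. -/
def supportPoint (n : ℝ → ℝ) (α : ℝ) : Plane := n α • unitVec α + deriv n α • unitVec' α

/-- The leading amplitude in the expansion of the Fourier transform of the measure `angDensity`. -/
def leadAmp (n : ℝ → ℝ) (α : ℝ) : ℝ := √((n α ^ 2 + deriv n α ^ 2) / n α)

/-- The density of the measure in the angular variable. -/
def angDensity (n : ℝ → ℝ) (α : ℝ) : ℝ := √(curvRadius n α) * leadAmp n α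

/-- The Fourier transform of the measure with density `angDensity`. -/
def sigHat (n : ℝ → ℝ) (y : Plane) : ℝ :=
  ∫ α in (-Real.pi)..Real.pi, angDensity n α * Real.cos (2 * Real.pi * inner ℝ (supportPoint n α) y)

/-- The leading term of `sigHat` in polar coordinates. -/
def mainPolar (n : ℝ → ℝ) (ρ β : ℝ) : ℝ :=
  2 * leadAmp n β / √ρ * Real.cos (2 * Real.pi * ρ * n β - Real.pi / 4)

theorem inner_plane (v w : Plane) : inner ℝ v w = v 0 * w 0 + v 1 * w 1 := by
  simp [PiLp.inner_apply, Fin.sum_univ_two]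
  ring

theorem inner_supportPoint (n : ℝ → ℝ) (α ρ β : ℝ) :
    inner ℝ (supportPoint n α) (ρ • unitVec β) =
      ρ * (n α * Real.cos (α - β) - deriv n α * Real.sin (α - β)) := by
  rw [inner_plane, Real.cos_sub, Real.sin_sub]
  simp [supportPoint, unitVec, unitVec']
  ring

namespace IsSupport

variable {n : ℝ → ℝ} (hn : IsSupport n)

include hn

theorem deriv_smooth : ContDiff ℝ ∞ (deriv n) :=
  ((contDiff_infty_iff_deriv (𝕜 := ℝ)).1 hn.smooth).2

theorem deriv2_smooth : ContDiff ℝ ∞ (deriv (deriv n)) :=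
  ((contDiff_infty_iff_deriv (𝕜 := ℝ)).1 hn.deriv_smooth).2

theorem curvRadius_smooth : ContDiff ℝ ∞ (curvRadius n) := hn.smooth.add hn.deriv2_smooth

theorem hasDerivAt (α : ℝ) : HasDerivAt n (deriv n α) α :=
  (hn.smooth.differentiable (by simp) α).hasDerivAt

theorem hasDerivAt_deriv (α : ℝ) : HasDerivAt (deriv n) (deriv (deriv n) α) α :=
  (hn.deriv_smooth.differentiable (by simp) α).hasDerivAt

theorem deriv_periodic (α : ℝ) : deriv n (α + Real.pi) = deriv n α := by
  have : (fun x => n (x + Real.pi)) = n := funext hn.periodic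
  conv_rhs => rw [← this]
  rw [deriv_comp_add_const]

theorem deriv2_periodic (α : ℝ) : deriv (deriv n) (α + Real.pi) = deriv (deriv n) α := by
  have : (fun x => deriv n (x + Real.pi)) = deriv n := funext hn.deriv_periodic
  conv_rhs => rw [← this]
  rw [deriv_comp_add_const]

theorem curvRadius_periodic (α : ℝ) : curvRadius n (α + Real.pi) = curvRadius n α := by
  simp only [curvRadius, hn.periodic, hn.deriv2_periodic]

theorem curvRadius_pos (α : ℝ) : 0 < curvRadius n α := hn.curv α

theorem quot_pos (α : ℝ) : 0 < (n α ^ 2 + deriv n α ^ 2) / n α := by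
  have := hn.pos α
  positivity

theorem leadAmp_pos (α : ℝ) : 0 < leadAmp n α := Real.sqrt_pos.2 (hn.quot_pos α)

theorem angDensity_pos (α : ℝ) : 0 < angDensity n α :=
  mul_pos (Real.sqrt_pos.2 (hn.curv α)) (hn.leadAmp_pos α)

theorem leadAmp_smooth : ContDiff ℝ ∞ (leadAmp n) :=
  ContDiff.sqrt (((hn.smooth.pow 2).add (hn.deriv_smooth.pow 2)).div hn.smooth
    fun α => (hn.pos α).ne') fun α => (hn.quot_pos α).ne'

theorem angDensity_smooth : ContDiff ℝ ∞ (angDensity n) :=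
  (ContDiff.sqrt hn.curvRadius_smooth fun α => (hn.curv α).ne').mul hn.leadAmp_smooth

theorem leadAmp_periodic (α : ℝ) : leadAmp n (α + Real.pi) = leadAmp n α := by
  simp only [leadAmp, hn.periodic, hn.deriv_periodic]

theorem angDensity_periodic (α : ℝ) : angDensity n (α + Real.pi) = angDensity n α := by
  simp only [angDensity, hn.leadAmp_periodic, hn.curvRadius_periodic]

omit hn in
theorem two_pi_of_pi {f : ℝ → ℝ} (hf : ∀ α, f (α + Real.pi) = f α) (α : ℝ) :
    f (α + 2 * Real.pi) = f α := by
  rw [two_mul, ← add_assoc, hf, hf]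

end IsSupport

theorem exists_bound_of_periodic {f : ℝ → ℝ} (hf : Continuous f)
    (hp : ∀ α, f (α + Real.pi) = f α) : ∃ B, ∀ α, |f α| ≤ B := by
  obtain ⟨B, hB⟩ := (isCompact_Icc (a := (0 : ℝ)) (b := Real.pi)).exists_bound_of_continuousOn
    hf.continuousOn
  refine ⟨B, fun α => ?_⟩
  obtain ⟨y, hy, hxy⟩ := Function.Periodic.exists_mem_Ico₀ hp Real.pi_pos α
  rw [hxy]
  exact hB y ⟨hy.1, hy.2.le⟩

theorem exists_pos_le_of_periodic {f : ℝ → ℝ} (hf : Continuous f)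
    (hp : ∀ α, f (α + Real.pi) = f α) (h0 : ∀ α, 0 < f α) : ∃ c, 0 < c ∧ ∀ α, c ≤ f α := by
  obtain ⟨x, -, hx⟩ := (isCompact_Icc (a := (0 : ℝ)) (b := Real.pi)).exists_isMinOn
    ⟨0, le_rfl, Real.pi_pos.le⟩ hf.continuousOn
  refine ⟨f x, h0 x, fun α => ?_⟩
  obtain ⟨y, hy, hxy⟩ := Function.Periodic.exists_mem_Ico₀ hp Real.pi_pos α
  rw [hxy]
  exact hx ⟨hy.1, hy.2.le⟩

theorem contDiff_sinc_integral :
    ContDiff ℝ ∞ fun x : ℝ => ∫ v in (0 : ℝ)..1, Real.cos (v * x) :=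
  contDiff_intervalIntegral_param (F := fun q : ℝ × ℝ => Real.cos (q.2 * q.1)) (by fun_prop) 0 1

theorem mul_sinc_integral (x : ℝ) : x * ∫ v in (0 : ℝ)..1, Real.cos (v * x) = Real.sin x := by
  have := intervalIntegral.smul_integral_comp_mul_right (a := 0) (b := 1) (fun t => Real.cos t) x
  rw [smul_eq_mul] at this
  rw [this]
  simp

/-- A smooth positive function which agrees with `sin x / x` for `|x| ≤ 11/5`. -/
theorem exists_modified_sinc : ∃ s : ℝ → ℝ, ContDiff ℝ ∞ s ∧ (∃ c, 0 < c ∧ ∀ x, c ≤ s x) ∧ s 0 = 1 ∧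
    ∀ x, |x| ≤ 11 / 5 → x * s x = Real.sin x := by
  -- The outer radius `3` is below `π`, so `sin x / x` is positive wherever `κ` is nonzero; beyond
  -- the inner radius `11/5` the function `cutoff` vanishes.
  let κ : ContDiffBump (0 : ℝ) := ⟨11 / 5, 3, by norm_num, by norm_num⟩
  set k : ℝ → ℝ := fun x => ∫ v in (0 : ℝ)..1, Real.cos (v * x) with hk
  have hκ : ContDiff ℝ ∞ κ := κ.contDiff
  set s : ℝ → ℝ := fun x => κ x * k x + (1 - κ x) with hs
  have hsm : ContDiff ℝ ∞ s :=
    (hκ.mul contDiff_sinc_integral).add (contDiff_const.sub hκ)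
  have hkpos : ∀ x, |x| < Real.pi → 0 < k x := by
    intro x hx
    rcases eq_or_ne x 0 with rfl | h0
    · simp [hk]
    · have h1 : 0 < x * Real.sin x := by
        rcases lt_or_gt_of_ne h0 with h | h
        · exact mul_pos_of_neg_of_neg h (Real.sin_neg_of_neg_of_neg_pi_lt h (abs_lt.1 hx).1)
        · exact mul_pos h (Real.sin_pos_of_pos_of_lt_pi h (abs_lt.1 hx).2)
      rw [← mul_sinc_integral x, ← mul_assoc] at h1
      exact pos_of_mul_pos_right h1 (mul_self_nonneg x)
  have hout : ∀ x : ℝ, 3 ≤ |x| → s x = 1 := by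
    intro x hx
    have : κ x = 0 := κ.zero_of_le_dist (by simpa [κ] using hx)
    simp [hs, this]
  have hin : ∀ x : ℝ, |x| ≤ 11 / 5 → s x = k x := by
    intro x hx
    have : κ x = 1 := κ.one_of_mem_closedBall (by simpa [κ] using hx)
    simp [hs, this]
  have hpos : ∀ x, 0 < s x := by
    intro x
    rcases le_or_gt 3 |x| with hx | hx
    · rw [hout x hx]; norm_num
    · have h1 := hkpos x (hx.trans Real.pi_gt_three)
      have h2 := κ.nonneg' x
      have h3 : κ x ≤ 1 := κ.le_one
      rcases h3.lt_or_eq with h | h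
      · have := mul_nonneg h2 h1.le
        simp only [hs]; linarith
      · simp only [hs, h]; linarith
  obtain ⟨x, -, hx⟩ := (isCompact_Icc (a := (-3 : ℝ)) (b := 3)).exists_isMinOn
    ⟨0, by norm_num⟩ hsm.continuous.continuousOn
  refine ⟨s, hsm, ⟨s x, hpos x, fun y => ?_⟩, ?_, fun y hy => ?_⟩
  · rcases le_or_gt |y| 3 with hy | hy
    · exact hx (abs_le.1 hy)
    · rw [hout y hy.le, ← hout 3 (by norm_num)]
      exact hx (by norm_num)
  · rw [hin 0 (by norm_num)]; simp [hk]
  · rw [hin y hy, mul_sinc_integral]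

/-- A smooth cutoff whose translates by multiples of `π` form a partition of unity. -/
def cutoff (x : ℝ) : ℝ := Real.smoothTransition (x + 2) - Real.smoothTransition (x + 2 - Real.pi)

theorem cutoff_smooth : ContDiff ℝ ∞ cutoff :=
  (Real.smoothTransition.contDiff.comp (by fun_prop)).sub
    (Real.smoothTransition.contDiff.comp (by fun_prop))

theorem cutoff_eq_zero {x : ℝ} (hx : 11 / 5 < |x|) : cutoff x = 0 := by
  have := Real.pi_lt_d2
  rcases lt_abs.1 hx with h | h
  · rw [cutoff, Real.smoothTransition.one_of_one_le (by linarith),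
      Real.smoothTransition.one_of_one_le (by linarith), sub_self]
  · rw [cutoff, Real.smoothTransition.zero_of_nonpos (by linarith),
      Real.smoothTransition.zero_of_nonpos (by linarith [Real.pi_pos]), sub_self]

theorem cutoff_zero : cutoff 0 = 1 := by
  rw [cutoff, Real.smoothTransition.one_of_one_le (by norm_num),
      Real.smoothTransition.zero_of_nonpos (by linarith [Real.pi_gt_three]), sub_zero]

/-- The critical points `β` and `β + π` contribute equally, so a window around `β` suffices, counted
twice. The two pieces of `cutoff` differ by a translation by `π`, hence the integral telescopes to
one over a single period, on which the transition function is `1`. -/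
theorem integral_mul_cutoff {F : ℝ → ℝ} (hF : Continuous F) (hp : ∀ x, F (x + Real.pi) = F x)
    (β : ℝ) :
    2 * ∫ x in (-3 : ℝ)..3, F (β + x) * cutoff x = ∫ α in (-Real.pi)..Real.pi, F α := by
  have hτ : Continuous Real.smoothTransition := Real.smoothTransition.continuous
  set f : ℝ → ℝ := fun x => F (β + x) * Real.smoothTransition (x + 2) with hf
  have hfc : Continuous f := by fun_prop
  have hi : ∀ a b, IntervalIntegrable f volume a b := fun a b => hfc.intervalIntegrable a b
  have h1 : ∀ x, F (β + x) * cutoff x = f x - f (x - Real.pi) := by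
    intro x
    have : F (β + (x - Real.pi)) = F (β + x) := by
      rw [← hp (β + (x - Real.pi))]; congr 1; ring
    simp only [hf, cutoff, this, show x - Real.pi + 2 = x + 2 - Real.pi by ring]
    ring
  have h2 : ∫ x in (-3 : ℝ)..3, F (β + x) * cutoff x = ∫ x in (3 - Real.pi)..3, f x := by
    simp_rw [h1]
    rw [intervalIntegral.integral_sub (hi _ _)
      ((by fun_prop : Continuous fun x => f (x - Real.pi)).intervalIntegrable _ _),
      intervalIntegral.integral_comp_sub_right (fun x => f x),
      ← intervalIntegral.integral_add_adjacent_intervals (hi (-3) (3 - Real.pi)) (hi _ 3),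
      ← intervalIntegral.integral_add_adjacent_intervals (hi (-3 - Real.pi) (-3)) (hi _ _)]
    have h3 : ∫ x in (-3 - Real.pi)..(-3), f x = 0 := by
      refine intervalIntegral.integral_zero_ae (Eventually.of_forall fun x hx => ?_)
      rw [uIoc_of_le (by linarith [Real.pi_pos])] at hx
      simp only [hf]
      rw [Real.smoothTransition.zero_of_nonpos (by linarith [hx.2]), mul_zero]
    rw [h3]; ring
  have h4 : ∫ x in (3 - Real.pi)..3, f x = ∫ x in (3 - Real.pi)..3, F (β + x) := by
    refine intervalIntegral.integral_congr fun x hx => ?_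
    rw [uIcc_of_le (by linarith [Real.pi_pos])] at hx
    simp only [hf]
    rw [Real.smoothTransition.one_of_one_le (by linarith [hx.1, Real.pi_lt_d2]), mul_one]
  have hper : Function.Periodic F Real.pi := hp
  have h5 : ∫ x in (3 - Real.pi)..3, F (β + x) = ∫ x in (0 : ℝ)..Real.pi, F x := by
    rw [intervalIntegral.integral_comp_add_left (fun x => F x)]
    have := hper.intervalIntegral_add_eq (β + (3 - Real.pi)) 0
    rw [zero_add] at this
    rw [← this]; congr 1; ring
  have h6 : ∫ x in (-Real.pi)..0, F x = ∫ x in (0 : ℝ)..Real.pi, F x := by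
    have := hper.intervalIntegral_add_eq (-Real.pi) 0
    simpa using this
  rw [h2, h4, h5, ← intervalIntegral.integral_add_adjacent_intervals
    (hF.intervalIntegrable (-Real.pi) 0) (hF.intervalIntegrable 0 Real.pi), h6]
  ring

/-- The remainder of the stationary phase expansion in polar coordinates. -/
def remPolar (n : ℝ → ℝ) (ρ β : ℝ) : ℝ := sigHat n (ρ • unitVec β) - mainPolar n ρ β

theorem IsFamily.ofPeriodic {k : ℝ → ℝ} (hk : ContDiff ℝ ∞ k) (hp : ∀ x, k (x + Real.pi) = k x) :
    IsFamily fun q => k (q.1 + q.2) :=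
  ⟨hk.comp (by fun_prop), fun β x => by
    simp only
    rw [show β + 2 * Real.pi + x = β + x + 2 * Real.pi by ring, IsSupport.two_pi_of_pi hp]⟩

/-- The function `n(β + x) cos x - n'(β + x) sin x` has derivative `-curvRadius(β + x) sin x` in
`x`. It therefore equals `n(β) - ∫₀ˣ t M` with `M = curvRadius(β + t) · sin t / t`. Where the cutoff
vanishes, `sin t / t` can be modified to stay positive, which gives the global lower bound on `M`.
-/
theorem IsSupport.exists_remPolar_eq {n : ℝ → ℝ} (hn : IsSupport n) :
    ∃ M h : ℝ × ℝ → ℝ, IsFamily M ∧ IsAmplitude h ∧ (∃ c, 0 < c ∧ ∀ q, c ≤ M q) ∧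
      (∀ β, h (β, 0) * √(2 * Real.pi / M (β, 0)) = √(2 * Real.pi) * leadAmp n β) ∧
      ∀ ρ β : ℝ, 0 < ρ → remPolar n ρ β = 2 * (cexp (((-(2 * Real.pi * ρ * n β) : ℝ) : ℂ) * I) *
        (oscIntegral M h β (2 * Real.pi * ρ) - leadingTerm M h β (2 * Real.pi * ρ))).re := by
  obtain ⟨s, hs, ⟨c, hc0, hc⟩, hs0, hsin⟩ := exists_modified_sinc
  obtain ⟨c', hc'0, hc'⟩ := exists_pos_le_of_periodic hn.curvRadius_smooth.continuous
    hn.curvRadius_periodic hn.curvRadius_pos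
  set M : ℝ × ℝ → ℝ := fun q => curvRadius n (q.1 + q.2) * s q.2 with hMdef
  set h : ℝ × ℝ → ℝ := fun q => angDensity n (q.1 + q.2) * cutoff q.2 with hhdef
  have hM : IsFamily M :=
    (IsFamily.ofPeriodic hn.curvRadius_smooth hn.curvRadius_periodic).mul (IsFamily.ofSnd hs)
  have hh : IsAmplitude h :=
    ⟨(IsFamily.ofPeriodic hn.angDensity_smooth hn.angDensity_periodic).mul
      (IsFamily.ofSnd cutoff_smooth), fun β x hx => by
        simp [hhdef, cutoff_eq_zero (show 11 / 5 < |x| by linarith)]⟩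
  clear_value M h
  -- The factor `√curvRadius` of `angDensity` cancels the one produced by `M(β, 0)`, leaving
  -- `leadAmp`.
  have hlead : ∀ β, h (β, 0) * √(2 * Real.pi / M (β, 0)) = √(2 * Real.pi) * leadAmp n β := by
    intro β
    have h1 := hn.curvRadius_pos β
    simp only [hhdef, hMdef, add_zero, hs0, mul_one, cutoff_zero, angDensity]
    rw [Real.sqrt_div (by positivity)]
    have := Real.sqrt_pos.2 h1
    field_simp
  refine ⟨M, h, hM, hh, ⟨c' * c, by positivity, fun q => by
    rw [hMdef]
    exact mul_le_mul (hc' _) (hc _) hc0.le ((hn.curvRadius_pos _).le)⟩, hlead, fun ρ β hρ => ?_⟩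
  have hphase : ∀ x, |x| ≤ 11 / 5 → n β - phase M (β, x) =
      n (β + x) * Real.cos x - deriv n (β + x) * Real.sin x := by
    intro x hx
    have hd : ∀ x, HasDerivAt (fun x => n (β + x) * Real.cos x - deriv n (β + x) * Real.sin x +
        phase M (β, x)) (curvRadius n (β + x) * (x * s x - Real.sin x)) x := by
      intro x
      have d1 : HasDerivAt (fun x => n (β + x)) (deriv n (β + x)) x := by
        simpa using (hn.hasDerivAt (β + x)).comp_const_add β x
      have d2 : HasDerivAt (fun x => deriv n (β + x)) (deriv (deriv n) (β + x)) x := by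
        simpa using (hn.hasDerivAt_deriv (β + x)).comp_const_add β x
      refine (((d1.mul (Real.hasDerivAt_cos x)).sub (d2.mul (Real.hasDerivAt_sin x))).add
        (hasDerivAt_phase hM β x)).congr_deriv ?_
      simp only [hMdef, curvRadius]
      ring
    have := (convex_Icc (-(11 / 5) : ℝ) (11 / 5)).norm_image_sub_le_of_norm_hasDerivWithin_le
      (C := 0) (fun y _ => (hd y).hasDerivWithinAt) (fun y hy => by
        rw [hsin y (abs_le.2 hy), sub_self, mul_zero, norm_zero])
      (x := 0) (y := x) (by norm_num) (abs_le.1 hx)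
    rw [zero_mul, norm_le_zero_iff] at this
    simp only [add_zero, Real.cos_zero, Real.sin_zero, phase_zero] at this
    linarith
  have hsig : sigHat n (ρ • unitVec β) =
      2 * (cexp (((-(2 * Real.pi * ρ * n β) : ℝ) : ℂ) * I) *
        oscIntegral M h β (2 * Real.pi * ρ)).re := by
    set F : ℝ → ℝ := fun α => angDensity n α *
      Real.cos (2 * Real.pi * inner ℝ (supportPoint n α) (ρ • unitVec β)) with hFdef
    have hFeq : ∀ α, F α = angDensity n α * Real.cos (2 * Real.pi *
        (ρ * (n α * Real.cos (α - β) - deriv n α * Real.sin (α - β)))) := fun α => by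
      simp only [hFdef, inner_supportPoint]
    have hFc : Continuous F := by
      have e1 := hn.angDensity_smooth.continuous
      have e2 := hn.smooth.continuous
      have e3 := hn.deriv_smooth.continuous
      simp_rw [funext hFeq]
      fun_prop
    -- The inner product changes sign under `α ↦ α + π`, and the cosine is even.
    have hFp : ∀ α, F (α + Real.pi) = F α := by
      intro α
      rw [hFeq, hFeq, hn.angDensity_periodic, hn.periodic, hn.deriv_periodic,
        show α + Real.pi - β = (α - β) + Real.pi by ring, Real.cos_add_pi, Real.sin_add_pi]
      congr 1
      rw [← Real.cos_neg]
      congr 1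
      ring
    have h1 := integral_mul_cutoff hFc hFp β
    have h2 : sigHat n (ρ • unitVec β) = ∫ α in (-Real.pi)..Real.pi, F α := rfl
    rw [h2, ← h1]
    congr 1
    have hcx : Continuous fun x : ℝ => (β, x) := by fun_prop
    have hc1 : Continuous fun x : ℝ => h (β, x) := hh.smooth.continuous.comp hcx
    have hc2 : Continuous fun x : ℝ => phase M (β, x) := hM.phase.smooth.continuous.comp hcx
    rw [oscIntegral, expIntegral, ← intervalIntegral.integral_const_mul]
    have h3 := Complex.reCLM.intervalIntegral_comp_comm (μ := volume) (a := -3) (b := 3)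
      (f := fun x : ℝ => cexp (((-(2 * Real.pi * ρ * n β) : ℝ) : ℂ) * I) *
        ((h (β, x) : ℂ) * cexp (-(-(((2 * Real.pi * ρ : ℝ) : ℂ) * I)) * phase M (β, x))))
      (Continuous.intervalIntegrable (continuous_const.mul ((Complex.continuous_ofReal.comp hc1).mul
        (Complex.continuous_exp.comp
          (continuous_const.mul (Complex.continuous_ofReal.comp hc2))))) _ _)
    simp only [Complex.reCLM_apply] at h3
    rw [← h3]
    congr 1
    ext x
    have h4 : cexp (((-(2 * Real.pi * ρ * n β) : ℝ) : ℂ) * I) *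
        ((h (β, x) : ℂ) * cexp (-(-(((2 * Real.pi * ρ : ℝ) : ℂ) * I)) * phase M (β, x))) =
        (h (β, x) : ℂ) *
          cexp (((2 * Real.pi * ρ * (phase M (β, x) - n β) : ℝ) : ℂ) * I) := by
      rw [mul_left_comm, ← Complex.exp_add]
      congr 2
      push_cast
      ring
    rw [h4, Complex.re_ofReal_mul, Complex.exp_ofReal_mul_I_re]
    by_cases hx : 11 / 5 < |x|
    · simp [hhdef, cutoff_eq_zero hx]
    · have h5 := hphase x (not_lt.1 hx)
      rw [hFeq, add_sub_cancel_left, ← h5]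
      simp only [hhdef]
      rw [show 2 * Real.pi * ρ * (phase M (β, x) - n β) =
        -(2 * Real.pi * (ρ * (n β - phase M (β, x)))) by ring, Real.cos_neg]
      ring
  rw [remPolar, hsig, mul_sub (cexp _), Complex.sub_re, mul_sub]
  congr 1
  rw [mainPolar, leadingTerm, hlead, mul_left_comm, ← Complex.exp_add, Complex.re_ofReal_mul,
    ← add_mul, ← Complex.ofReal_add, Complex.exp_ofReal_mul_I_re,
    Real.sqrt_mul Real.two_pi_pos.le ρ]
  have h5 : 0 < √(2 * Real.pi) := Real.sqrt_pos.2 Real.two_pi_pos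
  have h6 : 0 < √ρ := Real.sqrt_pos.2 hρ
  rw [← Real.cos_neg (-(2 * Real.pi * ρ * n β) + Real.pi / 4)]
  rw [show -(-(2 * Real.pi * ρ * n β) + Real.pi / 4) = 2 * Real.pi * ρ * n β - Real.pi / 4 by ring]
  field_simp

end Support

/-! ### Size and derivatives of the remainder in polar coordinates. -/

section Remainder

theorem hasDerivAt_leadingTerm (M h : ℝ × ℝ → ℝ) (β : ℝ) {lam : ℝ} (hl : 0 < lam) :
    HasDerivAt (fun lam => leadingTerm M h β lam) (-leadingTerm M h β lam / (2 * lam)) lam := by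
  have hs : 0 < √lam := Real.sqrt_pos.2 hl
  have h1 := ((Real.hasDerivAt_sqrt hl.ne').inv hs.ne').const_mul
    (h (β, 0) * √(2 * Real.pi / M (β, 0)))
  have h2 := (h1.ofReal_comp).mul_const (cexp ((Real.pi / 4 : ℝ) * I))
  have h3 : (fun lam : ℝ => (((h (β, 0) * √(2 * Real.pi / M (β, 0))) * (√lam)⁻¹ : ℝ) : ℂ) *
      cexp ((Real.pi / 4 : ℝ) * I)) = fun lam => leadingTerm M h β lam := by
    ext lam; rw [leadingTerm, ← div_eq_mul_inv (_ * _)]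
  have h4 : (-(1 / (2 * √lam)) / √lam ^ 2) = -(√lam)⁻¹ / (2 * lam) := by
    rw [Real.sq_sqrt hl.le]
    field_simp
  simp only [Pi.inv_apply] at h2
  rw [h3, h4] at h2
  refine h2.congr_deriv ?_
  rw [leadingTerm]
  push_cast
  ring

theorem norm_two_mul_re_le (z : ℂ) : |2 * z.re| ≤ 2 * ‖z‖ := by
  rw [abs_mul, abs_two]
  exact mul_le_mul_of_nonneg_left (Complex.abs_re_le_norm z) zero_le_two

/-- In `ρ`, differentiating the prefactor `e^{-iλn}` only gives a bounded multiple of the remainder,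
and the rest is small by homogeneity of the leading term. In `β`, differentiating the prefactor
costs a factor `ρ`, which leaves `ρ^{-1/2}`. To that precision the derivatives of the integral and
of the leading term can be bounded separately. -/
theorem IsSupport.exists_remPolar_bounds {n : ℝ → ℝ} (hn : IsSupport n) :
    ∃ C, 0 ≤ C ∧ ∀ ρ β : ℝ, 0 < ρ → |remPolar n ρ β| ≤ C / (ρ * √ρ) ∧
      (∃ d, HasDerivAt (fun ρ => remPolar n ρ β) d ρ ∧
        |d| ≤ C * (1 + 1 / ρ) / (ρ * √ρ)) ∧
      ∃ d, HasDerivAt (fun β => remPolar n ρ β) d β ∧ |d| ≤ C / √ρ := by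
  obtain ⟨M, h, hM, hh, ⟨c, hc0, hc⟩, hlead, hT⟩ := hn.exists_remPolar_eq
  have hM0 : ∀ q, M q ≠ 0 := fun q => (hc0.trans_le (hc q)).ne'
  obtain ⟨C1, hC1⟩ := exists_stationary_phase hM hc0 hc hh
  obtain ⟨C2, hC2⟩ := exists_oscIntegral_le hM hc0 hc (isAmplitude_fstAmplitude hM hM0 hh)
  obtain ⟨B0, hB0⟩ := exists_bound_of_periodic hn.smooth.continuous hn.periodic
  obtain ⟨B1, hB1⟩ := exists_bound_of_periodic hn.deriv_smooth.continuous hn.deriv_periodic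
  have hLs := hn.leadAmp_smooth
  have hLd : ContDiff ℝ ∞ (deriv (leadAmp n)) := ((contDiff_infty_iff_deriv (𝕜 := ℝ)).1 hLs).2
  have hLp : ∀ α, deriv (leadAmp n) (α + Real.pi) = deriv (leadAmp n) α := by
    intro α
    have : (fun x => leadAmp n (x + Real.pi)) = leadAmp n := funext hn.leadAmp_periodic
    conv_rhs => rw [← this]
    rw [deriv_comp_add_const]
  obtain ⟨B2, hB2⟩ := exists_bound_of_periodic hLd.continuous hLp
  have hC10 : 0 ≤ C1 := by
    have := (norm_nonneg _).trans (hC1 0 1 one_pos).1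
    simpa using this
  have hC20 : 0 ≤ C2 := by
    have := (norm_nonneg _).trans (hC2 0 1 one_pos)
    simpa using this
  have hB00 : 0 ≤ B0 := (abs_nonneg _).trans (hB0 0)
  have hB10 : 0 ≤ B1 := (abs_nonneg _).trans (hB1 0)
  have hB20 : 0 ≤ B2 := (abs_nonneg _).trans (hB2 0)
  have hpi := Real.pi_pos
  have hpi4 : Real.pi ≤ 4 := Real.pi_le_four
  -- The three summands serve the value, the `ρ`-derivative and the `β`-derivative; `16` is an upper
  -- bound for `4π`.
  set A := 2 * C1 + 16 * (B0 * C1 + 2 * C1) + 2 * (B1 * C1 + C2 + √(2 * Real.pi) * B2) with hA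
  have hA1 : 2 * C1 ≤ A := by
    have : 0 ≤ √(2 * Real.pi) * B2 := by positivity
    nlinarith [mul_nonneg hB00 hC10, mul_nonneg hB10 hC10]
  have hA2 : 16 * (B0 * C1 + 2 * C1) ≤ A := by
    have : 0 ≤ √(2 * Real.pi) * B2 := by positivity
    nlinarith [mul_nonneg hB00 hC10, mul_nonneg hB10 hC10]
  have hA3 : 2 * (B1 * C1 + C2 + √(2 * Real.pi) * B2) ≤ A := by
    nlinarith [mul_nonneg hB00 hC10, mul_nonneg hB10 hC10]
  refine ⟨A, by linarith, fun ρ β hρ => ?_⟩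
  set lam := 2 * Real.pi * ρ with hlamdef
  have hl : 0 < lam := by positivity
  have hρl : ρ ≤ lam := by
    have : (1 : ℝ) ≤ 2 * Real.pi := by linarith [Real.pi_gt_three]
    nlinarith
  have hsρ : 0 < √ρ := Real.sqrt_pos.2 hρ
  have hsl : √ρ ≤ √lam := Real.sqrt_le_sqrt hρl
  have hsl0 : 0 < √lam := Real.sqrt_pos.2 hl
  set D := oscIntegral M h β lam - leadingTerm M h β lam with hD
  obtain ⟨hDb, hOb⟩ := hC1 β lam hl
  have hle : C1 / (lam * √lam) ≤ C1 / (ρ * √ρ) :=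
    div_le_div_of_nonneg_left hC10 (by positivity) (mul_le_mul hρl hsl hsρ.le hl.le)
  have hdbl : 2 * Real.pi * ρ = lam := rfl
  refine ⟨?_, ?_, ?_⟩
  · rw [hT ρ β hρ]
    refine (norm_two_mul_re_le _).trans ?_
    rw [norm_mul, Complex.norm_exp_ofReal_mul_I, one_mul]
    calc 2 * ‖D‖ ≤ 2 * (C1 / (ρ * √ρ)) := by linarith
      _ = 2 * C1 / (ρ * √ρ) := by ring
      _ ≤ A / (ρ * √ρ) := div_le_div_of_nonneg_right hA1 (by positivity)
  · set O := oscIntegral M (fun q => h q * phase M q) β lam with hO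
    set Dl : ℂ := I * O - -leadingTerm M h β lam / (2 * lam) with hDl
    have hDlb : ‖Dl‖ ≤ 2 * C1 / (lam * √lam) / lam := by
      -- With `D` the integral minus its leading term, `λ dD/dλ` is the quantity bounded by `hOb`
      -- minus `D / 2`.
      have e1 : Dl = ((oscIntegral M h β lam / 2 + lam * I * O) - D / 2) / lam := by
        have : (lam : ℂ) ≠ 0 := by exact_mod_cast hl.ne'
        rw [hDl, hD]
        field_simp
        ring
      rw [e1, norm_div, Complex.norm_real, Real.norm_eq_abs, abs_of_pos hl]
      refine div_le_div_of_nonneg_right ((norm_sub_le _ _).trans ?_) hl.le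
      have : ‖D / 2‖ = ‖D‖ / 2 := by simp
      rw [this]
      have h0 := norm_nonneg D
      have : 2 * C1 / (lam * √lam) = C1 / (lam * √lam) + C1 / (lam * √lam) := by ring
      linarith
    have hlin : HasDerivAt (fun ρ : ℝ => 2 * Real.pi * ρ) (2 * Real.pi) ρ := by
      simpa using (hasDerivAt_id ρ).const_mul (2 * Real.pi)
    have d1 : HasDerivAt (fun ρ : ℝ => oscIntegral M h β (2 * Real.pi * ρ) -
        leadingTerm M h β (2 * Real.pi * ρ)) ((2 * Real.pi) • Dl) ρ :=
      HasDerivAt.scomp (h := fun ρ : ℝ => 2 * Real.pi * ρ)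
        (g₁ := fun l => oscIntegral M h β l - leadingTerm M h β l) ρ
        ((hasDerivAt_oscIntegral_lam hM hh β lam).sub (hasDerivAt_leadingTerm M h β hl)) hlin
    have d2 : HasDerivAt (fun ρ : ℝ => cexp (((-(2 * Real.pi * ρ * n β) : ℝ) : ℂ) * I))
        (cexp (((-(2 * Real.pi * ρ * n β) : ℝ) : ℂ) * I) *
          (((-(2 * Real.pi * n β) : ℝ) : ℂ) * I)) ρ := by
      have := (((hlin.mul_const (n β)).neg).ofReal_comp.mul_const I).cexp
      exact this
    have d3 := (Complex.reCLM.hasFDerivAt.comp_hasDerivAt ρ (d2.mul d1)).const_mul 2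
    refine ⟨_, d3.congr_of_eventuallyEq ?_, ?_⟩
    · filter_upwards [lt_mem_nhds hρ] with r hr
      rw [hT r β hr]
      rfl
    · simp only [Complex.reCLM_apply]
      refine (norm_two_mul_re_le _).trans ?_
      have hn1 : ‖cexp (((-(2 * Real.pi * ρ * n β) : ℝ) : ℂ) * I)‖ = 1 :=
        Complex.norm_exp_ofReal_mul_I _
      have e1 : ‖cexp (((-(2 * Real.pi * ρ * n β) : ℝ) : ℂ) * I) *
          (((-(2 * Real.pi * n β) : ℝ) : ℂ) * I) * D‖ ≤ 2 * Real.pi * B0 * (C1 / (ρ * √ρ)) := by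
        rw [norm_mul, norm_mul, hn1, one_mul, norm_mul, Complex.norm_I, mul_one, Complex.norm_real,
          Real.norm_eq_abs, abs_neg, abs_mul, abs_of_pos Real.two_pi_pos]
        exact mul_le_mul (mul_le_mul_of_nonneg_left (hB0 β) Real.two_pi_pos.le)
          (hDb.trans hle) (norm_nonneg _) (by positivity)
      have e2 : ‖cexp (((-(2 * Real.pi * ρ * n β) : ℝ) : ℂ) * I) * ((2 * Real.pi) • Dl)‖ ≤
          2 * Real.pi * (2 * C1 / (ρ * √ρ) / ρ) := by
        rw [norm_mul, hn1, one_mul, norm_smul, Real.norm_eq_abs, abs_of_pos Real.two_pi_pos]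
        refine mul_le_mul_of_nonneg_left (hDlb.trans ?_) Real.two_pi_pos.le
        rw [div_div, div_div]
        exact div_le_div_of_nonneg_left (by positivity) (by positivity)
          (mul_le_mul (mul_le_mul hρl hsl hsρ.le hl.le) hρl hρ.le (by positivity))
      refine (mul_le_mul_of_nonneg_left ((norm_add_le _ _).trans (add_le_add e1 e2))
        zero_le_two).trans ?_
      rw [mul_div_assoc A]
      refine le_trans ?_ (mul_le_mul_of_nonneg_right hA2 (by positivity))
      have e3 : 2 * (2 * Real.pi * B0 * (C1 / (ρ * √ρ)) + 2 * Real.pi * (2 * C1 / (ρ * √ρ) / ρ)) =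
          4 * Real.pi * (B0 * C1 + 2 * C1 * (1 / ρ)) * (1 / (ρ * √ρ)) := by
        field_simp
        ring
      rw [e3, div_eq_mul_one_div (1 + 1 / ρ), ← mul_assoc]
      refine mul_le_mul_of_nonneg_right ?_ (by positivity)
      have hr : 0 ≤ 1 / ρ := by positivity
      have h1 := mul_nonneg hB00 hC10
      have h2 := mul_nonneg h1 hr
      have h3 := mul_nonneg hC10 hr
      have h4 : 0 ≤ B0 * C1 + 2 * C1 * (1 / ρ) := by nlinarith
      calc 4 * Real.pi * (B0 * C1 + 2 * C1 * (1 / ρ))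
          ≤ 16 * (B0 * C1 + 2 * C1 * (1 / ρ)) := by
            apply mul_le_mul_of_nonneg_right (by linarith) h4
        _ ≤ _ := by nlinarith
  · have d1 : HasDerivAt (fun β : ℝ => leadingTerm M h β lam)
        (((√(2 * Real.pi) * deriv (leadAmp n) β / √lam : ℝ) : ℂ) *
          cexp ((Real.pi / 4 : ℝ) * I)) β := by
      have := ((((hLs.differentiable (by simp) β).hasDerivAt.const_mul
        (√(2 * Real.pi))).div_const (√lam)).ofReal_comp).mul_const (cexp ((Real.pi / 4 : ℝ) * I))
      refine this.congr_of_eventuallyEq (Eventually.of_forall fun b => ?_)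
      simp only [leadingTerm, hlead]
    have d2 : HasDerivAt (fun β : ℝ => cexp (((-(2 * Real.pi * ρ * n β) : ℝ) : ℂ) * I))
        (cexp (((-(2 * Real.pi * ρ * n β) : ℝ) : ℂ) * I) *
          (((-(2 * Real.pi * ρ * deriv n β) : ℝ) : ℂ) * I)) β :=
      ((((hn.hasDerivAt β).const_mul (2 * Real.pi * ρ)).neg).ofReal_comp.mul_const I).cexp
    have d3 := (Complex.reCLM.hasFDerivAt.comp_hasDerivAt β
      (d2.mul ((hasDerivAt_oscIntegral_fst hM hM0 hh β lam).sub d1))).const_mul 2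
    refine ⟨_, d3.congr_of_eventuallyEq (Eventually.of_forall fun b => ?_), ?_⟩
    · simp only []
      rw [hT ρ b hρ]
      rfl
    · simp only [Complex.reCLM_apply]
      refine (norm_two_mul_re_le _).trans ?_
      have hn1 : ‖cexp (((-(2 * Real.pi * ρ * n β) : ℝ) : ℂ) * I)‖ = 1 :=
        Complex.norm_exp_ofReal_mul_I _
      have hls : 1 / √lam ≤ 1 / √ρ := one_div_le_one_div_of_le hsρ hsl
      have e1 : ‖cexp (((-(2 * Real.pi * ρ * n β) : ℝ) : ℂ) * I) *
          (((-(2 * Real.pi * ρ * deriv n β) : ℝ) : ℂ) * I) * D‖ ≤ B1 * C1 * (1 / √lam) := by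
        rw [norm_mul, norm_mul, hn1, one_mul, norm_mul, Complex.norm_I, mul_one, Complex.norm_real,
          Real.norm_eq_abs, abs_neg, abs_mul, hdbl, abs_of_pos hl]
        calc lam * |deriv n β| * ‖D‖ ≤ lam * B1 * (C1 / (lam * √lam)) :=
              mul_le_mul (mul_le_mul_of_nonneg_left (hB1 β) hl.le) hDb (norm_nonneg _)
                (by positivity)
          _ = B1 * C1 * (1 / √lam) := by field_simp
      have e2 : ‖cexp (((-(2 * Real.pi * ρ * n β) : ℝ) : ℂ) * I) *
          (oscIntegral M (fstAmplitude M h) β lam -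
          ((√(2 * Real.pi) * deriv (leadAmp n) β / √lam : ℝ) : ℂ) *
            cexp ((Real.pi / 4 : ℝ) * I))‖ ≤ (C2 + √(2 * Real.pi) * B2) * (1 / √lam) := by
        rw [norm_mul, hn1, one_mul]
        refine (norm_sub_le _ _).trans ?_
        rw [norm_mul, Complex.norm_exp_ofReal_mul_I, mul_one, Complex.norm_real, Real.norm_eq_abs,
          abs_div, abs_mul, abs_of_nonneg (Real.sqrt_nonneg _), abs_of_pos hsl0, add_mul]
        refine add_le_add ((hC2 β lam hl).trans_eq (by ring)) ?_
        rw [div_eq_mul_one_div]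
        refine mul_le_mul_of_nonneg_right (mul_le_mul_of_nonneg_left (hB2 β) (by positivity))
          (by positivity)
      refine (mul_le_mul_of_nonneg_left ((norm_add_le _ _).trans (add_le_add e1 e2))
        zero_le_two).trans ?_
      calc 2 * (B1 * C1 * (1 / √lam) + (C2 + √(2 * Real.pi) * B2) * (1 / √lam))
          = 2 * (B1 * C1 + C2 + √(2 * Real.pi) * B2) * (1 / √lam) := by ring
        _ ≤ A * (1 / √ρ) := mul_le_mul hA3 hls (by positivity) (by linarith)
        _ = A / √ρ := by ring

end Remainder

/-! ### Polar coordinates in the plane. -/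

section Polar

/-- The plane as the complex numbers. -/
def toComplex (y : Plane) : ℂ := ⟨y 0, y 1⟩

/-- The polar angle. -/
def angle (y : Plane) : ℝ := Complex.arg (toComplex y)

theorem toComplex_eq (y : Plane) : toComplex y = (y 0 : ℂ) + (y 1 : ℂ) * I :=
  Complex.mk_eq_add_mul_I _ _

theorem norm_toComplex (y : Plane) : ‖toComplex y‖ = ‖y‖ := by
  rw [EuclideanSpace.norm_eq, Complex.norm_eq_sqrt_sq_add_sq, Fin.sum_univ_two]
  simp [toComplex]

theorem toComplex_injective : Function.Injective toComplex := by
  intro v w h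
  have h1 := congrArg Complex.re h
  have h2 := congrArg Complex.im h
  ext i
  fin_cases i
  · exact h1
  · exact h2

theorem toComplex_polar (ρ β : ℝ) : toComplex (ρ • unitVec β) = ρ * cexp (β * I) := by
  rw [toComplex_eq, Complex.exp_mul_I]
  simp [unitVec]
  ring

theorem contDiff_toComplex : ContDiff ℝ ∞ toComplex := by
  have : toComplex = fun y : Plane => (y 0 : ℂ) + (y 1 : ℂ) * I := funext toComplex_eq
  rw [this]
  have h : ∀ i : Fin 2, ContDiff ℝ ∞ fun y : Plane => ((y i : ℝ) : ℂ) := fun i =>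
    Complex.ofRealCLM.contDiff.comp (contDiff_piLp_apply 2)
  exact (h 0).add ((h 1).mul contDiff_const)

theorem norm_unitVec (β : ℝ) : ‖unitVec β‖ = 1 := by
  rw [EuclideanSpace.norm_eq, Fin.sum_univ_two]
  simp [unitVec]

theorem norm_polar {ρ : ℝ} (hρ : 0 ≤ ρ) (β : ℝ) : ‖ρ • unitVec β‖ = ρ := by
  rw [norm_smul, norm_unitVec, mul_one, Real.norm_eq_abs, abs_of_nonneg hρ]

theorem norm_smul_unitVec_angle (y : Plane) : ‖y‖ • unitVec (angle y) = y := by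
  apply toComplex_injective
  rw [toComplex_polar, ← norm_toComplex, angle, Complex.norm_mul_exp_arg_mul_I]

theorem angle_polar {F : ℝ → ℝ} (hF : ∀ α, F (α + 2 * Real.pi) = F α) {ρ : ℝ} (hρ : 0 < ρ)
    (β : ℝ) : F (angle (ρ • unitVec β)) = F β := by
  have hp : Function.Periodic F (2 * Real.pi) := hF
  rw [angle, toComplex_polar, Complex.exp_mul_I, Complex.arg_mul_cos_add_sin_mul_I_eq_toIocMod hρ,
    toIocMod]
  rw [zsmul_eq_mul]
  exact hp.sub_int_mul_eq _

/-- The argument jumps along the negative axis. Rotating by the angle of `y` brings `y` to the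
positive axis, where the logarithm is smooth, and the period of `F` hides the multiple of `2π`. -/
theorem contDiffAt_comp_angle {F : ℝ → ℝ} (hFs : ContDiff ℝ ∞ F)
    (hF : ∀ α, F (α + 2 * Real.pi) = F α) {y : Plane} (hy : y ≠ 0) :
    ContDiffAt ℝ ∞ (fun y => F (angle y)) y := by
  set β := angle y with hβ
  set r : Plane → ℂ := fun w => toComplex w * cexp (-(β * I)) with hr
  have hrs : ContDiff ℝ ∞ r := contDiff_toComplex.mul contDiff_const
  have hry : r y = (‖y‖ : ℂ) := by
    simp only [hr]
    conv_lhs => rw [← norm_smul_unitVec_angle y]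
    rw [toComplex_polar, mul_assoc, ← Complex.exp_add]
    simp [hβ]
  have hslit : r y ∈ slitPlane := by
    rw [hry]; exact Complex.ofReal_mem_slitPlane.2 (norm_pos_iff.2 hy)
  have hev : ∀ᶠ w in 𝓝 y, r w ∈ slitPlane :=
    hrs.continuous.continuousAt (Complex.isOpen_slitPlane.mem_nhds hslit)
  have hg : ContDiffAt ℝ ∞ (fun w => F (β + (Complex.log (r w)).im)) y := by
    have h1 : ContDiffAt ℝ ∞ (fun w => Complex.log (r w)) y :=
      ((Complex.contDiffAt_log (n := ∞) hslit).restrict_scalars ℝ).comp y hrs.contDiffAt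
    have h2 : ContDiffAt ℝ ∞ (fun w => (Complex.log (r w)).im) y :=
      Complex.imCLM.contDiff.contDiffAt.comp y h1
    exact hFs.contDiffAt.comp y (contDiffAt_const.add h2)
  refine hg.congr_of_eventuallyEq ?_
  filter_upwards [hev] with w hw
  have hw0 : r w ≠ 0 := Complex.slitPlane_ne_zero hw
  have hwn : ‖r w‖ = ‖w‖ := by
    simp only [hr]
    rw [norm_mul, norm_toComplex, ← neg_mul, ← Complex.ofReal_neg, Complex.norm_exp_ofReal_mul_I,
      mul_one]
  have hwp : 0 < ‖w‖ := by rw [← hwn]; exact norm_pos_iff.2 hw0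
  have e : w = ‖w‖ • unitVec (β + (Complex.log (r w)).im) := by
    apply toComplex_injective
    rw [toComplex_polar, Complex.log_im, Complex.ofReal_add, add_mul, Complex.exp_add,
      mul_left_comm, ← hwn, Complex.norm_mul_exp_arg_mul_I]
    simp only [hr]
    rw [mul_left_comm, ← Complex.exp_add]
    simp
  conv_lhs => rw [e]
  exact angle_polar hF hwp _

theorem norm_clm_le_polar (L : Plane →L[ℝ] ℝ) (β : ℝ) :
    ‖L‖ ≤ |L (unitVec β)| + |L (unitVec' β)| := by
  refine ContinuousLinearMap.opNorm_le_bound _ (by positivity) fun v => ?_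
  have hv : v = (v 0 * Real.cos β + v 1 * Real.sin β) • unitVec β +
      (-(v 0 * Real.sin β) + v 1 * Real.cos β) • unitVec' β := by
    have := Real.sin_sq_add_cos_sq β
    ext i
    fin_cases i
    · simp [unitVec, unitVec']; linear_combination (-v 0) * this
    · simp [unitVec, unitVec']; linear_combination (-v 1) * this
  have hnorm : ‖v‖ ^ 2 = v 0 ^ 2 + v 1 ^ 2 := by
    rw [EuclideanSpace.norm_sq_eq, Fin.sum_univ_two]; simp
  have h1 : |v 0 * Real.cos β + v 1 * Real.sin β| ≤ ‖v‖ := by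
    apply abs_le_of_sq_le_sq _ (norm_nonneg _)
    rw [hnorm]
    nlinarith [sq_nonneg (v 0 * Real.sin β - v 1 * Real.cos β), Real.sin_sq_add_cos_sq β]
  have h2 : |-(v 0 * Real.sin β) + v 1 * Real.cos β| ≤ ‖v‖ := by
    apply abs_le_of_sq_le_sq _ (norm_nonneg _)
    rw [hnorm]
    nlinarith [sq_nonneg (v 0 * Real.cos β + v 1 * Real.sin β), Real.sin_sq_add_cos_sq β]
  conv_lhs => rw [hv]
  rw [map_add, map_smul, map_smul, Real.norm_eq_abs, smul_eq_mul, smul_eq_mul]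
  refine (abs_add_le _ _).trans ?_
  rw [abs_mul, abs_mul, add_mul, mul_comm _ ‖v‖, mul_comm _ ‖v‖]
  gcongr

theorem hasDerivAt_unitVec (β : ℝ) : HasDerivAt unitVec (unitVec' β) β := by
  have h1 : unitVec = fun β => Real.cos β • (!₂[1, 0] : Plane) + Real.sin β • !₂[0, 1] := by
    ext β i
    fin_cases i <;> simp [unitVec]
  rw [h1]
  refine (((Real.hasDerivAt_cos β).smul_const _).add
    ((Real.hasDerivAt_sin β).smul_const _)).congr_deriv ?_
  ext i
  fin_cases i <;> simp [unitVec']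

theorem contDiff_unitVec : ContDiff ℝ ∞ unitVec := by
  rw [contDiff_piLp]
  intro i
  fin_cases i
  · simpa [unitVec] using Real.contDiff_cos
  · simpa [unitVec] using Real.contDiff_sin

theorem contDiff_unitVec' : ContDiff ℝ ∞ unitVec' := by
  rw [contDiff_piLp]
  intro i
  fin_cases i
  · simpa [unitVec'] using Real.contDiff_sin.neg
  · simpa [unitVec'] using Real.contDiff_cos

end Polar

/-! ### Main kernel and localized remainder kernel. -/

section Kernel

variable {n : ℝ → ℝ}

/-- The leading term of `sigHat n (r • y)`, multiplied by `√r`. -/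
def mainKernel (n : ℝ → ℝ) (q : ℝ × Plane) : ℝ :=
  2 * leadAmp n (angle q.2) / √‖q.2‖ *
    Real.cos (2 * Real.pi * q.1 * ‖q.2‖ * n (angle q.2) - Real.pi / 4)

theorem IsSupport.contDiff_supportPoint (hn : IsSupport n) : ContDiff ℝ ∞ (supportPoint n) :=
  (hn.smooth.smul contDiff_unitVec).add (hn.deriv_smooth.smul contDiff_unitVec')

theorem IsSupport.contDiff_sigHat (hn : IsSupport n) : ContDiff ℝ ∞ (sigHat n) := by
  apply contDiff_intervalIntegral_param (F := fun q : Plane × ℝ => angDensity n q.2 *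
    Real.cos (2 * Real.pi * inner ℝ (supportPoint n q.2) q.1))
  have h1 := hn.angDensity_smooth
  have h2 := hn.contDiff_supportPoint
  exact (h1.comp contDiff_snd).mul (Real.contDiff_cos.comp
    (contDiff_const.mul ((h2.comp contDiff_snd).inner ℝ contDiff_fst)))

theorem IsSupport.contDiffAt_mainKernel (hn : IsSupport n) {q : ℝ × Plane} (hq : q.2 ≠ 0) :
    ContDiffAt ℝ ∞ (mainKernel n) q := by
  have h1 : ContDiffAt ℝ ∞ (fun q : ℝ × Plane => leadAmp n (angle q.2)) q :=
    ContDiffAt.comp (g := fun y => leadAmp n (angle y)) q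
      (contDiffAt_comp_angle hn.leadAmp_smooth
      (IsSupport.two_pi_of_pi hn.leadAmp_periodic) hq) contDiffAt_snd
  have h2 : ContDiffAt ℝ ∞ (fun q : ℝ × Plane => n (angle q.2)) q :=
    ContDiffAt.comp (g := fun y => n (angle y)) q (contDiffAt_comp_angle hn.smooth
      (IsSupport.two_pi_of_pi hn.periodic) hq) contDiffAt_snd
  have h3 : ContDiffAt ℝ ∞ (fun q : ℝ × Plane => ‖q.2‖) q := contDiffAt_snd.norm ℝ hq
  have h4 : ContDiffAt ℝ ∞ (fun q : ℝ × Plane => √‖q.2‖) q := h3.sqrt (norm_ne_zero_iff.2 hq)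
  have h5 : √‖q.2‖ ≠ 0 := (Real.sqrt_pos.2 (norm_pos_iff.2 hq)).ne'
  exact ((contDiffAt_const.mul h1).div h4 h5).mul (Real.contDiff_cos.contDiffAt.comp q
    ((((contDiffAt_const.mul contDiffAt_fst).mul h3).mul h2).sub contDiffAt_const))

/-- The remainder of the expansion of `sigHat n (r • y)`. -/
def remKernel (n : ℝ → ℝ) (r : ℝ) (y : Plane) : ℝ :=
  sigHat n (r • y) - (√r)⁻¹ * mainKernel n (r, y)

theorem IsSupport.mainKernel_polar (hn : IsSupport n) (r : ℝ) {ρ : ℝ} (hρ : 0 < ρ) (β : ℝ) :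
    mainKernel n (r, ρ • unitVec β) =
      2 * leadAmp n β / √ρ * Real.cos (2 * Real.pi * r * ρ * n β - Real.pi / 4) := by
  simp only [mainKernel]
  rw [norm_polar hρ.le, angle_polar (IsSupport.two_pi_of_pi hn.leadAmp_periodic) hρ,
    angle_polar (IsSupport.two_pi_of_pi hn.periodic) hρ]

theorem IsSupport.remKernel_polar (hn : IsSupport n) {r ρ : ℝ} (hr : 0 < r) (hρ : 0 < ρ) (β : ℝ) :
    remKernel n r (ρ • unitVec β) = remPolar n (r * ρ) β := by
  rw [remKernel, remPolar, hn.mainKernel_polar r hρ, mainPolar, smul_smul,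
    Real.sqrt_mul hr.le, mul_assoc (2 * Real.pi) r ρ]
  congr 1
  have := Real.sqrt_pos.2 hr
  field_simp

theorem IsSupport.contDiffAt_remKernel (hn : IsSupport n) (r : ℝ) {y : Plane} (hy : y ≠ 0) :
    ContDiffAt ℝ ∞ (remKernel n r) y := by
  have h1 : ContDiffAt ℝ ∞ (fun y : Plane => mainKernel n (r, y)) y :=
    ContDiffAt.comp (g := mainKernel n) (f := fun y : Plane => (r, y)) y
      (hn.contDiffAt_mainKernel (q := (r, y)) hy) (contDiffAt_const.prodMk contDiffAt_id)
  have h2 : ContDiffAt ℝ ∞ (fun y : Plane => sigHat n (r • y)) y :=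
    (hn.contDiff_sigHat.comp (contDiff_const_smul r)).contDiffAt
  exact h2.sub (contDiffAt_const.mul h1)

/-- The scaling `y ↦ r y` multiplies the radial derivative by `r` and leaves the derivative in the
angle unchanged. So the radial bound of order `ρ^{-3/2}` and the angular bound of order `ρ^{-1/2}`
both become `r^{-1/2}`. -/
theorem IsSupport.exists_remKernel_bounds (hn : IsSupport n) {c : ℝ} (hc : 0 < c) :
    ∃ C, 0 ≤ C ∧ ∀ (r : ℝ) (y : Plane), 1 ≤ r → c ≤ ‖y‖ → |remKernel n r y| ≤ C / (r * √r) ∧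
      ‖fderiv ℝ (remKernel n r) y‖ ≤ C / √r := by
  obtain ⟨C, hC0, hC⟩ := hn.exists_remPolar_bounds
  refine ⟨C / (c * √c) + C * (1 + 1 / c) / (c * √c) + C / (c * √c), by positivity,
    fun r y hr hy => ?_⟩
  have hr0 : 0 < r := one_pos.trans_le hr
  set ρ := ‖y‖ with hρ
  set β := angle y with hβ
  have hρ0 : 0 < ρ := hc.trans_le hy
  have hye : y = ρ • unitVec β := (norm_smul_unitVec_angle y).symm
  have hy0 : y ≠ 0 := norm_pos_iff.1 hρ0
  obtain ⟨h1, ⟨d1, hd1, hd1b⟩, ⟨d2, hd2, hd2b⟩⟩ := hC (r * ρ) β (by positivity)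
  have hsc : 0 < √c := Real.sqrt_pos.2 hc
  have hsr : 0 < √r := Real.sqrt_pos.2 hr0
  have hsρ : √c ≤ √ρ := Real.sqrt_le_sqrt hy
  have hsρ0 : 0 < √ρ := Real.sqrt_pos.2 hρ0
  have hsrρ : √(r * ρ) = √r * √ρ := Real.sqrt_mul hr0.le ρ
  have hinv : 1 / (ρ * √ρ) ≤ 1 / (c * √c) :=
    one_div_le_one_div_of_le (by positivity) (mul_le_mul hy hsρ hsc.le hρ0.le)
  constructor
  · rw [hye, hn.remKernel_polar hr0 hρ0]
    refine h1.trans ?_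
    rw [hsrρ]
    calc C / (r * ρ * (√r * √ρ)) = C * (1 / (ρ * √ρ)) / (r * √r) := by field_simp
      _ ≤ C * (1 / (c * √c)) / (r * √r) := by gcongr
      _ ≤ _ := by
        refine div_le_div_of_nonneg_right ?_ (by positivity)
        have h3 : 0 ≤ C * (1 + 1 / c) / (c * √c) := by positivity
        have h4 : 0 ≤ C / (c * √c) := by positivity
        rw [mul_one_div]; linarith
  · have hdiff := (hn.contDiffAt_remKernel r hy0).differentiableAt (by simp)
    have hf := hdiff.hasFDerivAt
    rw [hye] at hf
    set L := fderiv ℝ (remKernel n r) (ρ • unitVec β) with hL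
    have e1 : L (unitVec β) = d1 * r := by
      have k1 : HasDerivAt (fun t : ℝ => remKernel n r (t • unitVec β)) (L (unitVec β)) ρ := by
        have := HasFDerivAt.comp_hasDerivAt (f := fun t : ℝ => t • unitVec β) ρ hf
          ((hasDerivAt_id ρ).smul_const (unitVec β))
        exact this.congr_deriv (by simp)
      have k2 : HasDerivAt (fun t : ℝ => remPolar n (r * t) β) (d1 * r) ρ := by
        have := HasDerivAt.comp (h₂ := fun ρ => remPolar n ρ β) (h := fun t : ℝ => r * t) ρ hd1
          ((hasDerivAt_id ρ).const_mul r)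
        exact this.congr_deriv (by simp)
      refine k1.unique (k2.congr_of_eventuallyEq ?_)
      filter_upwards [lt_mem_nhds hρ0] with t ht
      exact hn.remKernel_polar hr0 ht β
    have e2 : ρ * L (unitVec' β) = d2 := by
      have k1 : HasDerivAt (fun b : ℝ => remKernel n r (ρ • unitVec b)) (ρ * L (unitVec' β)) β := by
        have := HasFDerivAt.comp_hasDerivAt (f := fun b => ρ • unitVec b) β hf
          ((hasDerivAt_unitVec β).const_smul ρ)
        exact this.congr_deriv (by simp)
      refine k1.unique (hd2.congr_of_eventuallyEq (Eventually.of_forall fun b => ?_))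
      exact hn.remKernel_polar hr0 hρ0 b
    have hfy : fderiv ℝ (remKernel n r) y = L := by rw [hL, ← hye]
    rw [hfy]
    refine (norm_clm_le_polar L β).trans ?_
    have b1 : |L (unitVec β)| ≤ C * (1 + 1 / c) / (c * √c) / √r := by
      rw [e1, abs_mul, abs_of_pos hr0]
      calc |d1| * r ≤ C * (1 + 1 / (r * ρ)) / (r * ρ * √(r * ρ)) * r := by gcongr
        _ = C * (1 + 1 / (r * ρ)) * (1 / (ρ * √ρ)) / √r := by
          rw [hsrρ]; field_simp
        _ ≤ C * (1 + 1 / c) * (1 / (c * √c)) / √r := by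
          have : 1 / (r * ρ) ≤ 1 / c := one_div_le_one_div_of_le hc (by nlinarith)
          gcongr
        _ = _ := by ring
    have b2 : |L (unitVec' β)| ≤ C / (c * √c) / √r := by
      have : |L (unitVec' β)| = |d2| / ρ := by
        rw [← e2, abs_mul, abs_of_pos hρ0]; field_simp
      rw [this]
      calc |d2| / ρ ≤ C / √(r * ρ) / ρ := by gcongr
        _ = C * (1 / (ρ * √ρ)) / √r := by rw [hsrρ]; field_simp
        _ ≤ C * (1 / (c * √c)) / √r := by gcongr
        _ = _ := by ring
    refine (add_le_add b1 b2).trans ?_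
    rw [← add_div]
    refine div_le_div_of_nonneg_right ?_ hsr.le
    have h4 : 0 ≤ C / (c * √c) := by positivity
    linarith

/-- The remainder kernel, localized by a cutoff. -/
def locKernel (n : ℝ → ℝ) (ψ : Plane → ℝ) (r : ℝ) (y : Plane) : ℝ := ψ y * remKernel n r y

/-- The norm and the angle are singular only at the origin, where the cutoff vanishes identically.
Smoothness is joint and includes `r = 0`, which compactness arguments for small `r` need. -/
theorem IsSupport.contDiff_cutoff_mul_mainKernel (hn : IsSupport n) {ψ : Plane → ℝ}
    (hψ : ContDiff ℝ ∞ ψ) (h0 : (0 : Plane) ∉ tsupport ψ) :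
    ContDiff ℝ ∞ fun q : ℝ × Plane => ψ q.2 * mainKernel n q := by
  rw [contDiff_iff_contDiffAt]
  intro q
  rcases eq_or_ne q.2 0 with h | h
  · have : (fun q : ℝ × Plane => ψ q.2 * mainKernel n q) =ᶠ[𝓝 q] fun _ => 0 := by
      have h1 : ∀ᶠ y in 𝓝 q.2, ψ y = 0 := by
        rw [h]; exact notMem_tsupport_iff_eventuallyEq.1 h0
      filter_upwards [continuous_snd.continuousAt.eventually h1] with p hp
      simp [hp]
    exact contDiffAt_const.congr_of_eventuallyEq this
  · exact (hψ.comp contDiff_snd).contDiffAt.mul (hn.contDiffAt_mainKernel h)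

theorem locKernel_eq (n : ℝ → ℝ) (ψ : Plane → ℝ) (r : ℝ) (y : Plane) :
    locKernel n ψ r y = ψ y * sigHat n (r • y) - (√r)⁻¹ * (ψ y * mainKernel n (r, y)) := by
  rw [locKernel, remKernel]; ring

theorem IsSupport.contDiff_locKernel (hn : IsSupport n) {ψ : Plane → ℝ}
    (hψ : ContDiff ℝ ∞ ψ) (h0 : (0 : Plane) ∉ tsupport ψ) (r : ℝ) :
    ContDiff ℝ ∞ (locKernel n ψ r) := by
  rw [funext (locKernel_eq n ψ r)]
  have h1 : ContDiff ℝ ∞ fun y : Plane => sigHat n (r • y) :=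
    hn.contDiff_sigHat.comp (contDiff_const_smul r)
  have h2 : ContDiff ℝ ∞ fun y : Plane => ψ y * mainKernel n (r, y) :=
    ContDiff.comp (g := fun q : ℝ × Plane => ψ q.2 * mainKernel n q) (f := fun y : Plane => (r, y))
      (hn.contDiff_cutoff_mul_mainKernel hψ h0) (contDiff_const.prodMk contDiff_id)
  exact (hψ.mul h1).sub (contDiff_const.mul h2)

theorem exists_bound_param {F : ℝ × Plane → ℝ} (hF : ContDiff ℝ ∞ F) (R : ℝ)
    (h0 : ∀ q : ℝ × Plane, R < ‖q.2‖ → F q = 0) :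
    ∃ B, 0 ≤ B ∧ ∀ (r : ℝ) (y : Plane), 0 ≤ r → r ≤ 1 →
      |F (r, y)| ≤ B ∧ ‖fderiv ℝ (fun y => F (r, y)) y‖ ≤ B := by
  have hK : IsCompact ((Icc (0 : ℝ) 1) ×ˢ (Metric.closedBall (0 : Plane) R)) :=
    isCompact_Icc.prod (isCompact_closedBall _ _)
  obtain ⟨B1, hB1⟩ := hK.exists_bound_of_continuousOn hF.continuous.continuousOn
  obtain ⟨B2, hB2⟩ := hK.exists_bound_of_continuousOn
    ((hF.continuous_fderiv (by simp)).clm_comp (continuous_const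
      (y := ContinuousLinearMap.inr ℝ ℝ Plane))).continuousOn
  have hfd : ∀ r y, fderiv ℝ (fun y => F (r, y)) y =
      (fderiv ℝ F (r, y)).comp (ContinuousLinearMap.inr ℝ ℝ Plane) := fun r y =>
    ((hF.differentiable (by simp) (r, y)).hasFDerivAt.comp y (hasFDerivAt_prodMk_right r y)).fderiv
  refine ⟨max (max B1 B2) 0, le_max_right _ _, fun r y hr0 hr1 => ?_⟩
  by_cases hy : R < ‖y‖
  · have : (fun y => F (r, y)) =ᶠ[𝓝 y] fun _ => 0 := by
      have ho : IsOpen {y : Plane | R < ‖y‖} := isOpen_lt continuous_const continuous_norm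
      filter_upwards [ho.mem_nhds hy] with w hw
      exact h0 (r, w) hw
    rw [this.fderiv_eq, h0 (r, y) hy]
    simp
  · have hm : (r, y) ∈ (Icc (0 : ℝ) 1) ×ˢ (Metric.closedBall (0 : Plane) R) :=
      ⟨⟨hr0, hr1⟩, by simpa using hy⟩
    refine ⟨(hB1 _ hm).trans ((le_max_left _ _).trans (le_max_left _ _)), ?_⟩
    rw [hfd]
    exact (hB2 _ hm).trans ((le_max_right _ _).trans (le_max_left _ _))

/-- For `r ≤ 1` no expansion is needed: `ψ · sigHat(r ·)` and `ψ · mainKernel(r, ·)` are bounded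
with their gradients by compactness, and only the explicit factor `r^{-1/2}` of the latter is
singular. For `r ≥ 1` the product rule reduces everything to the bounds on `remKernel`. -/
theorem IsSupport.exists_locKernel_bounds (hn : IsSupport n) {ψ : Plane → ℝ}
    (hψ : ContDiff ℝ ∞ ψ) (hcs : HasCompactSupport ψ) (h0 : (0 : Plane) ∉ tsupport ψ) :
    ∃ C, 0 ≤ C ∧ ∀ (r : ℝ) (y : Plane), 0 < r →
      (r ≤ 1 → |locKernel n ψ r y| ≤ C / √r) ∧ (1 ≤ r → |locKernel n ψ r y| ≤ C / (r * √r)) ∧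
      ‖fderiv ℝ (locKernel n ψ r) y‖ ≤ C / √r := by
  obtain ⟨c, hc, hcball⟩ : ∃ c, 0 < c ∧ ∀ y ∈ tsupport ψ, c ≤ ‖y‖ := by
    obtain ⟨ε, hε, hb⟩ := Metric.isOpen_iff.1 (isClosed_tsupport ψ).isOpen_compl 0 h0
    refine ⟨ε, hε, fun y hy => ?_⟩
    by_contra h
    exact hb (by simpa using h) hy
  obtain ⟨R, hR⟩ := hcs.isCompact.isBounded.exists_norm_le
  obtain ⟨C1, hC10, hC1⟩ := hn.exists_remKernel_bounds hc
  have hout : ∀ y : Plane, R < ‖y‖ → ψ y = 0 := fun y hy =>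
    image_eq_zero_of_notMem_tsupport fun h => (hR y h).not_gt hy
  have hsm1 : ContDiff ℝ ∞ fun q : ℝ × Plane => ψ q.2 * sigHat n (q.1 • q.2) :=
    (hψ.comp contDiff_snd).mul (hn.contDiff_sigHat.comp (contDiff_fst.smul contDiff_snd))
  have hsm2 := hn.contDiff_cutoff_mul_mainKernel hψ h0
  obtain ⟨B1, hB10, hB1⟩ := exists_bound_param hsm1 R fun q hq => by simp [hout _ hq]
  obtain ⟨B2, hB20, hB2⟩ := exists_bound_param hsm2 R fun q hq => by simp [hout _ hq]
  obtain ⟨P, hP⟩ := hψ.continuous.bounded_above_of_compact_support hcs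
  obtain ⟨P', hP'⟩ := (hψ.continuous_fderiv (by simp)).bounded_above_of_compact_support
    (hcs.fderiv (𝕜 := ℝ))
  have hP0 : 0 ≤ P := (norm_nonneg _).trans (hP 0)
  have hP'0 : 0 ≤ P' := (norm_nonneg _).trans (hP' 0)
  refine ⟨B1 + B2 + P * C1 + P' * C1, by positivity, fun r y hr => ?_⟩
  have hsr : 0 < √r := Real.sqrt_pos.2 hr
  have small : r ≤ 1 → |locKernel n ψ r y| ≤ (B1 + B2 + P * C1 + P' * C1) / √r ∧
      ‖fderiv ℝ (locKernel n ψ r) y‖ ≤ (B1 + B2 + P * C1 + P' * C1) / √r := by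
    intro hr1
    have hs1 : √r ≤ 1 := Real.sqrt_le_one.2 hr1
    obtain ⟨a1, a2⟩ := hB1 r y hr.le hr1
    obtain ⟨b1, b2⟩ := hB2 r y hr.le hr1
    have hle : B1 + (√r)⁻¹ * B2 ≤ (B1 + B2 + P * C1 + P' * C1) / √r := by
      rw [le_div_iff₀ hsr]
      have : (B1 + (√r)⁻¹ * B2) * √r = B1 * √r + B2 := by field_simp
      rw [this]
      nlinarith [mul_nonneg hP0 hC10, mul_nonneg hP'0 hC10]
    constructor
    · rw [locKernel_eq]
      refine (abs_sub _ _).trans (le_trans (add_le_add a1 ?_) hle)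
      rw [abs_mul, abs_of_pos (inv_pos.2 hsr)]
      exact mul_le_mul_of_nonneg_left b1 (inv_pos.2 hsr).le
    · have d1 : DifferentiableAt ℝ (fun y => ψ y * sigHat n (r • y)) y :=
        (ContDiff.comp (g := fun q : ℝ × Plane => ψ q.2 * sigHat n (q.1 • q.2))
          (f := fun y : Plane => (r, y)) hsm1 (contDiff_const.prodMk contDiff_id)).differentiable
          (by simp) y
      have d2 : DifferentiableAt ℝ (fun y => ψ y * mainKernel n (r, y)) y :=
        (ContDiff.comp (g := fun q : ℝ × Plane => ψ q.2 * mainKernel n q)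
          (f := fun y : Plane => (r, y)) hsm2 (contDiff_const.prodMk contDiff_id)).differentiable
          (by simp) y
      have d3 := (d1.hasFDerivAt.sub (d2.hasFDerivAt.const_mul (√r)⁻¹)).fderiv
      rw [funext (locKernel_eq n ψ r)]
      refine (congrArg norm d3).le.trans ?_
      refine (norm_sub_le _ _).trans (le_trans (add_le_add a2 ?_) hle)
      rw [norm_smul, Real.norm_eq_abs, abs_of_pos (inv_pos.2 hsr)]
      exact mul_le_mul_of_nonneg_left b2 (inv_pos.2 hsr).le
  have large : 1 ≤ r → |locKernel n ψ r y| ≤ (B1 + B2 + P * C1 + P' * C1) / (r * √r) ∧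
      ‖fderiv ℝ (locKernel n ψ r) y‖ ≤ (B1 + B2 + P * C1 + P' * C1) / √r := by
    intro hr1
    by_cases hy : y ∈ tsupport ψ
    · obtain ⟨a1, a2⟩ := hC1 r y hr1 (hcball y hy)
      have hy0 : y ≠ 0 := fun h => h0 (h ▸ hy)
      constructor
      · rw [locKernel, abs_mul]
        refine (mul_le_mul (hP y) a1 (abs_nonneg _) hP0).trans ?_
        rw [← mul_div_assoc]
        exact div_le_div_of_nonneg_right (by nlinarith [mul_nonneg hP'0 hC10]) (by positivity)
      · have d1 := (hψ.differentiable (by simp) y).hasFDerivAt.mul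
          ((hn.contDiffAt_remKernel r hy0).differentiableAt (by simp)).hasFDerivAt
        have d2 : fderiv ℝ (locKernel n ψ r) y = _ := d1.fderiv
        rw [d2]
        refine (norm_add_le _ _).trans ?_
        rw [norm_smul, norm_smul]
        have b1 : ‖ψ y‖ * ‖fderiv ℝ (remKernel n r) y‖ ≤ P * (C1 / √r) :=
          mul_le_mul (hP y) a2 (norm_nonneg _) hP0
        have b2 : ‖remKernel n r y‖ * ‖fderiv ℝ ψ y‖ ≤ C1 / √r * P' := by
          refine mul_le_mul (a1.trans ?_) (hP' y) (norm_nonneg _) (by positivity)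
          exact div_le_div_of_nonneg_left hC10 hsr (by nlinarith)
        refine (add_le_add b1 b2).trans ?_
        have : P * (C1 / √r) + C1 / √r * P' = (P * C1 + P' * C1) / √r := by ring
        rw [this]
        exact div_le_div_of_nonneg_right (by linarith) hsr.le
    · have hz : locKernel n ψ r =ᶠ[𝓝 y] fun _ => 0 := by
        filter_upwards [notMem_tsupport_iff_eventuallyEq.1 hy] with w hw
        simp only [Pi.zero_apply] at hw
        simp [locKernel, hw]
      rw [hz.fderiv_eq, hz.eq_of_nhds]
      simp only [abs_zero, fderiv_const_apply, norm_zero]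
      exact ⟨by positivity, by positivity⟩
  refine ⟨fun h => (small h).1, fun h => (large h).1, ?_⟩
  rcases le_total r 1 with h | h
  · exact (small h).2
  · exact (large h).2

end Kernel

/-! ### Pairing with homogeneous Sobolev norms of negative order. -/

section Duality

open SchwartzMap LineDeriv

theorem integral_mul_fourier_schwartz {V : Type*} [NormedAddCommGroup V] [InnerProductSpace ℝ V]
    [FiniteDimensional ℝ V] [MeasurableSpace V] [BorelSpace V] {g : V → ℂ} (hg : Integrable g)
    (η : 𝓢(V, ℂ)) :
    ∫ y, g y * 𝓕 η y = ∫ ξ, 𝓕 g ξ * η ξ := by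
  have h := VectorFourier.integral_fourierIntegral_smul_eq_flip (L := innerₗ V)
    Real.continuous_fourierChar continuous_inner hg
    (η.integrable (μ := volume))
  have hflip : (innerₗ V).flip = innerₗ V := by
    ext x y
    simp
  rw [hflip] at h
  exact h.symm

theorem lintegral_enorm_sq_eq_ofReal (η : 𝓢(Plane, ℂ)) :
    ∫⁻ ξ, ‖η ξ‖ₑ ^ 2 = ENNReal.ofReal (∫ ξ, ‖η ξ‖ ^ 2) := by
  rw [ofReal_integral_eq_lintegral_ofReal]
  · refine lintegral_congr fun ξ => ?_
    rw [ENNReal.ofReal_pow (norm_nonneg _), ofReal_norm]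
  · have := (η.memLp 2 volume).integrable_norm_rpow (by simp) (by simp)
    simpa using this
  · exact Eventually.of_forall fun ξ => by positivity

theorem integral_norm_sq_le_of_bound {f : Plane → ℂ} {R A : ℝ} (hA : ∀ y, ‖f y‖ ≤ A)
    (hR : ∀ y, R < ‖y‖ → f y = 0) :
    ∫ y, ‖f y‖ ^ 2 ≤ volume.real (Metric.closedBall (0 : Plane) R) * A ^ 2 := by
  have h0 : ∫ y, ‖f y‖ ^ 2 = ∫ y in Metric.closedBall (0 : Plane) R, ‖f y‖ ^ 2 := by
    refine (setIntegral_eq_integral_of_forall_compl_eq_zero fun y hy => ?_).symm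
    rw [hR y (by simpa using hy)]
    simp
  rw [h0]
  refine (le_abs_self _).trans ?_
  have := norm_setIntegral_le_of_norm_le_const (μ := volume)
    (s := Metric.closedBall (0 : Plane) R) (f := fun y => ‖f y‖ ^ 2) (C := A ^ 2)
    (isCompact_closedBall _ _).measure_lt_top
    (fun y _ => by
      rw [Real.norm_eq_abs, abs_of_nonneg (by positivity)]
      exact pow_le_pow_left₀ (norm_nonneg _) (hA y) 2)
  rw [mul_comm]
  exact this

theorem norm_sq_eq_sum_single (ξ : Plane) :
    ‖ξ‖ ^ 2 = ∑ i : Fin 2, (inner ℝ ξ (EuclideanSpace.single i (1 : ℝ))) ^ 2 := by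
  rw [EuclideanSpace.norm_sq_eq]
  simp [EuclideanSpace.inner_single_right]

/-- Plancherel bounds for the inverse Fourier transform of a bump function. -/
theorem exists_schwartz_fourier_eq {χ : Plane → ℝ} (hχ : ContDiff ℝ ∞ χ) {R A₀ A₁ : ℝ}
    (hR : ∀ y, R < ‖y‖ → χ y = 0) (hA₀ : ∀ y, |χ y| ≤ A₀) (hA₁ : ∀ y, ‖fderiv ℝ χ y‖ ≤ A₁) :
    ∃ η : 𝓢(Plane, ℂ), (∀ y, 𝓕 η y = χ y) ∧
      ∫⁻ ξ, ‖η ξ‖ₑ ^ 2 ≤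
        ENNReal.ofReal (volume.real (Metric.closedBall (0 : Plane) R) * A₀ ^ 2) ∧
      ∫⁻ ξ, ENNReal.ofReal (‖ξ‖ ^ 2) * ‖η ξ‖ₑ ^ 2 ≤
        ENNReal.ofReal (2 * (volume.real (Metric.closedBall (0 : Plane) R) * A₁ ^ 2)) := by
  have hsm : ContDiff ℝ ∞ fun y => (χ y : ℂ) := ofRealCLM.contDiff.comp hχ
  have hcs : HasCompactSupport fun y => (χ y : ℂ) := by
    refine HasCompactSupport.intro (isCompact_closedBall (0 : Plane) R) fun y hy => ?_
    rw [hR y (by simpa using hy)]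
    simp
  set X : 𝓢(Plane, ℂ) := hcs.toSchwartzMap hsm with hX
  have hXc : ∀ y, X y = χ y := fun y => rfl
  refine ⟨𝓕⁻ X, fun y => ?_, ?_, ?_⟩
  · rw [FourierTransform.fourier_fourierInv_eq, hXc]
  · rw [lintegral_enorm_sq_eq_ofReal]
    refine ENNReal.ofReal_le_ofReal ?_
    have h := integral_norm_sq_fourier (𝓕⁻ X)
    rw [FourierTransform.fourier_fourierInv_eq] at h
    rw [← h]
    exact integral_norm_sq_le_of_bound (f := fun y => X y) (fun y => by simpa [hXc] using hA₀ y)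
      fun y hy => by rw [hXc, hR y hy]; simp
  · have hA1 : 0 ≤ A₁ := (norm_nonneg _).trans (hA₁ 0)
    have key : ∀ i : Fin 2, ∫⁻ ξ, ENNReal.ofReal ((inner ℝ ξ (EuclideanSpace.single i (1 : ℝ))) ^ 2) *
        ‖(𝓕⁻ X) ξ‖ₑ ^ 2 ≤
        ENNReal.ofReal (volume.real (Metric.closedBall (0 : Plane) R) * A₁ ^ 2) := by
      intro i
      set m : Plane := EuclideanSpace.single i (1 : ℝ)
      have hm : ‖m‖ = 1 := by simp [m]
      set Y : 𝓢(Plane, ℂ) := ∂_{m} X with hY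
      have hYd : ∀ y, Y y = ((fderiv ℝ χ y m : ℝ) : ℂ) := by
        intro y
        rw [hY, lineDerivOp_apply_eq_fderiv]
        have : HasFDerivAt (fun y => (χ y : ℂ)) (ofRealCLM.comp (fderiv ℝ χ y)) y :=
          HasFDerivAt.comp (g := fun t : ℝ => (t : ℂ)) y ofRealCLM.hasFDerivAt
            (hχ.differentiable (by simp) y).hasFDerivAt
        have h2 : fderiv ℝ (fun y => (χ y : ℂ)) y = _ := this.fderiv
        change fderiv ℝ (fun y => (χ y : ℂ)) y m = _
        rw [h2]
        simp
      have h1 : ∀ ξ, ENNReal.ofReal ((inner ℝ ξ m) ^ 2) * ‖(𝓕⁻ X) ξ‖ₑ ^ 2 ≤ ‖(𝓕⁻ Y) ξ‖ₑ ^ 2 := by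
        intro ξ
        have htg : (fun x : Plane => inner ℝ x m).HasTemperateGrowth := by fun_prop
        rw [hY, fourierInv_lineDerivOp_eq]
        simp only [smul_apply, smulLeftCLM_apply_apply htg]
        rw [← ofReal_norm, ← ofReal_norm, ← ENNReal.ofReal_pow (norm_nonneg _),
          ← ENNReal.ofReal_pow (norm_nonneg _), ← ENNReal.ofReal_mul (by positivity)]
        refine ENNReal.ofReal_le_ofReal ?_
        rw [norm_smul, norm_smul, mul_pow, mul_pow, Real.norm_eq_abs, sq_abs]
        -- The factor `2π` produced by differentiation only helps and is discarded.
        have : (1 : ℝ) ≤ ‖-(2 * (Real.pi : ℂ) * I)‖ ^ 2 := by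
          rw [norm_neg, norm_mul, norm_mul, norm_I, Complex.norm_real, Real.norm_eq_abs,
            abs_of_pos Real.pi_pos]
          have : ‖(2 : ℂ)‖ = 2 := by simp
          rw [this]
          nlinarith [Real.pi_gt_three]
        exact le_mul_of_one_le_left (by positivity) this
      refine (lintegral_mono h1).trans ?_
      rw [lintegral_enorm_sq_eq_ofReal]
      refine ENNReal.ofReal_le_ofReal ?_
      have h := integral_norm_sq_fourier (𝓕⁻ Y)
      rw [FourierTransform.fourier_fourierInv_eq] at h
      rw [← h]
      refine integral_norm_sq_le_of_bound (f := fun y => Y y) (fun y => ?_) fun y hy => ?_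
      · simp only [hYd, Complex.norm_real]
        refine ((fderiv ℝ χ y).le_opNorm m).trans ?_
        rw [hm, mul_one]
        exact hA₁ y
      · have : χ =ᶠ[𝓝 y] fun _ => 0 := by
          filter_upwards [(isOpen_lt continuous_const continuous_norm).mem_nhds hy] with w hw
          exact hR w hw
        simp only [hYd, this.fderiv_eq]
        simp
    have hs : ∀ ξ : Plane, ENNReal.ofReal (‖ξ‖ ^ 2) * ‖(𝓕⁻ X) ξ‖ₑ ^ 2 =
        ENNReal.ofReal ((inner ℝ ξ (EuclideanSpace.single (0 : Fin 2) (1 : ℝ))) ^ 2) *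
          ‖(𝓕⁻ X) ξ‖ₑ ^ 2 +
        ENNReal.ofReal ((inner ℝ ξ (EuclideanSpace.single (1 : Fin 2) (1 : ℝ))) ^ 2) *
          ‖(𝓕⁻ X) ξ‖ₑ ^ 2 := by
      intro ξ
      rw [norm_sq_eq_sum_single, Fin.sum_univ_two, ENNReal.ofReal_add (sq_nonneg _) (sq_nonneg _),
        add_mul]
    simp_rw [hs]
    rw [lintegral_add_left]
    · refine (add_le_add (key 0) (key 1)).trans (le_of_eq ?_)
      rw [← ENNReal.ofReal_add (by positivity) (by positivity), two_mul]
    · have : Continuous fun ξ => (𝓕⁻ X) ξ := (𝓕⁻ X).continuous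
      fun_prop

/-- The sum of the two weights dominates `x^{-1+2e'}`, through the first one for `x ≥ 1` and through
the second for `x ≤ 1`. Its inverse `x^{1-2e'}` is bounded separately on the two sides of `x = T`;
the condition `e' ≤ 1/2` makes the power nondecreasing. -/
theorem rpow_le_weight {x T e e' : ℝ} (hx : 0 < x) (hT : 0 < T) (he' : 0 ≤ e') (hee : e' ≤ e)
    (he2 : e' ≤ 1 / 2) :
    (x ^ (2 * (-(1 / 2) + e)) + x ^ (2 * (-(1 / 2 : ℝ))))⁻¹ ≤
      T ^ (1 - 2 * e') + x ^ 2 * T ^ (-1 - 2 * e') := by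
  have h1 : x ^ (-(1 - 2 * e')) ≤ x ^ (2 * (-(1 / 2) + e)) + x ^ (2 * (-(1 / 2 : ℝ))) := by
    rcases le_total 1 x with h | h
    · refine (Real.rpow_le_rpow_of_exponent_le h (by linarith)).trans
        (le_add_of_nonneg_right (by positivity))
    · refine (Real.rpow_le_rpow_of_exponent_ge hx h (by linarith)).trans
        (le_add_of_nonneg_left (by positivity))
  have h2 := inv_anti₀ (by positivity) h1
  rw [Real.rpow_neg hx.le, inv_inv] at h2
  refine h2.trans ?_
  rcases le_total x T with h | h
  · exact (Real.rpow_le_rpow hx.le h (by linarith)).trans (le_add_of_nonneg_right (by positivity))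
  · have : x ^ (1 - 2 * e') = x ^ 2 * x ^ (-1 - 2 * e') := by
      rw [← Real.rpow_natCast x 2, ← Real.rpow_add hx]
      congr 1
      push_cast
      ring
    rw [this]
    refine le_trans ?_ (le_add_of_nonneg_left (by positivity))
    exact mul_le_mul_of_nonneg_left
      (Real.rpow_le_rpow_of_nonpos hT h (by linarith)) (by positivity)

theorem lintegral_mul_sq_le {α : Type*} [MeasurableSpace α] {μ : Measure α} {p q : α → ℝ≥0∞}
    (hp : AEMeasurable p μ) (hq : AEMeasurable q μ) :
    (∫⁻ a, p a * q a ∂μ) ^ 2 ≤ (∫⁻ a, p a ^ 2 ∂μ) * ∫⁻ a, q a ^ 2 ∂μ := by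
  have h := ENNReal.lintegral_mul_le_Lp_mul_Lq μ Real.HolderConjugate.two_two hp hq
  simp only [Pi.mul_apply, ENNReal.rpow_two] at h
  refine (pow_le_pow_left' h 2).trans (le_of_eq ?_)
  rw [mul_pow, ← ENNReal.rpow_two, ← ENNReal.rpow_two, ← ENNReal.rpow_mul, ← ENNReal.rpow_mul]
  norm_num

/-- Duality between homogeneous Sobolev norms of negative order and smooth bumps. -/
theorem enorm_integral_mul_sq_le {g : Plane → ℂ} (hg : Integrable g) {χ : Plane → ℝ}
    (hχ : ContDiff ℝ ∞ χ) {R A₀ A₁ : ℝ} (hR : ∀ y, R < ‖y‖ → χ y = 0) (hA₀ : ∀ y, |χ y| ≤ A₀)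
    (hA₁ : ∀ y, ‖fderiv ℝ χ y‖ ≤ A₁) {T e e' : ℝ} (hT : 0 < T) (he' : 0 ≤ e') (hee : e' ≤ e)
    (he2 : e' ≤ 1 / 2) :
    ‖∫ y, g y * (χ y : ℂ)‖ₑ ^ 2 ≤
      ENNReal.ofReal (2 * volume.real (Metric.closedBall (0 : Plane) R) *
        (T ^ (1 - 2 * e') * A₀ ^ 2 + T ^ (-1 - 2 * e') * A₁ ^ 2)) *
        (sobolevNormSq (-(1 / 2) + e) g + sobolevNormSq (-(1 / 2)) g) := by
  obtain ⟨η, hη, hb0, hb1⟩ := exists_schwartz_fourier_eq hχ hR hA₀ hA₁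
  set W : Plane → ℝ := fun ξ => ‖ξ‖ ^ (2 * (-(1 / 2) + e)) + ‖ξ‖ ^ (2 * (-(1 / 2 : ℝ))) with hW
  have hW0 : ∀ ξ, 0 ≤ W ξ := fun ξ => by positivity
  have hWm : Measurable W := by fun_prop
  have hgc : Continuous (𝓕 g) :=
    VectorFourier.fourierIntegral_continuous Real.continuous_fourierChar
      (L := innerₗ Plane) continuous_inner hg
  have hηc : Continuous fun ξ => η ξ := η.continuous
  -- Preparation for Cauchy–Schwarz: the square root of the weight goes with `𝓕 g` and its inverse
  -- with `η`. The weight is positive off the null set `ξ = 0`.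
  have step1 : ‖∫ y, g y * (χ y : ℂ)‖ₑ ≤
      ∫⁻ ξ, (ENNReal.ofReal (√(W ξ)) * ‖𝓕 g ξ‖ₑ) * (ENNReal.ofReal (√(W ξ))⁻¹ * ‖η ξ‖ₑ) := by
    have e1 : ∫ y, g y * (χ y : ℂ) = ∫ ξ, 𝓕 g ξ * η ξ := by
      rw [← integral_mul_fourier_schwartz hg]
      simp_rw [hη]
    rw [e1]
    refine (enorm_integral_le_lintegral_enorm _).trans (lintegral_mono_ae ?_)
    have : ∀ᵐ ξ : Plane, ξ ≠ 0 := by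
      simp [ae_iff]
    filter_upwards [this] with ξ hξ
    have hWp : 0 < W ξ := by
      have : 0 < ‖ξ‖ := norm_pos_iff.2 hξ
      simp only [hW]
      positivity
    rw [enorm_mul]
    have : ENNReal.ofReal (√(W ξ)) * ENNReal.ofReal (√(W ξ))⁻¹ = 1 := by
      rw [← ENNReal.ofReal_mul (by positivity), mul_inv_cancel₀ (by positivity), ENNReal.ofReal_one]
    calc ‖𝓕 g ξ‖ₑ * ‖η ξ‖ₑ = (ENNReal.ofReal (√(W ξ)) * ENNReal.ofReal (√(W ξ))⁻¹) *
          (‖𝓕 g ξ‖ₑ * ‖η ξ‖ₑ) := by rw [this, one_mul]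
      _ ≤ _ := le_of_eq (by ring)
  have step2 := (pow_le_pow_left' step1 2).trans (lintegral_mul_sq_le (by fun_prop) (by fun_prop))
  refine step2.trans ?_
  rw [mul_comm]
  refine mul_le_mul' ?_ (le_of_eq ?_)
  · have hpt : ∀ᵐ ξ : Plane, (ENNReal.ofReal (√(W ξ))⁻¹ * ‖η ξ‖ₑ) ^ 2 ≤
        ENNReal.ofReal (T ^ (1 - 2 * e')) * ‖η ξ‖ₑ ^ 2 +
          ENNReal.ofReal (T ^ (-1 - 2 * e')) * (ENNReal.ofReal (‖ξ‖ ^ 2) * ‖η ξ‖ₑ ^ 2) := by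
      have : ∀ᵐ ξ : Plane, ξ ≠ 0 := by
        simp [ae_iff]
      filter_upwards [this] with ξ hξ
      rw [mul_pow, ← mul_assoc, ← add_mul, ← ENNReal.ofReal_mul (by positivity),
        ← ENNReal.ofReal_add (by positivity) (by positivity), ← ENNReal.ofReal_pow (by positivity)]
      refine mul_le_mul_left (ENNReal.ofReal_le_ofReal ?_) _
      rw [inv_pow, Real.sq_sqrt (hW0 ξ), mul_comm (T ^ (-1 - 2 * e'))]
      exact rpow_le_weight (norm_pos_iff.2 hξ) hT he' hee he2
    refine (lintegral_mono_ae hpt).trans ?_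
    rw [lintegral_add_left (by fun_prop), lintegral_const_mul _ (by fun_prop),
      lintegral_const_mul _ (by fun_prop)]
    refine (add_le_add (mul_le_mul_right hb0 _) (mul_le_mul_right hb1 _)).trans ?_
    rw [← ENNReal.ofReal_mul (by positivity), ← ENNReal.ofReal_mul (by positivity),
      ← ENNReal.ofReal_add (by positivity) (by positivity)]
    refine ENNReal.ofReal_le_ofReal ?_
    have : 0 ≤ T ^ (1 - 2 * e') * (volume.real (Metric.closedBall (0 : Plane) R) * A₀ ^ 2) := by
      positivity
    linarith
  · have : ∀ ξ, (ENNReal.ofReal (√(W ξ)) * ‖𝓕 g ξ‖ₑ) ^ 2 =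
        ENNReal.ofReal (‖ξ‖ ^ (2 * (-(1 / 2) + e))) * ‖𝓕 g ξ‖ₑ ^ 2 +
          ENNReal.ofReal (‖ξ‖ ^ (2 * (-(1 / 2 : ℝ)))) * ‖𝓕 g ξ‖ₑ ^ 2 := by
      intro ξ
      rw [mul_pow, ← ENNReal.ofReal_pow (by positivity), Real.sq_sqrt (hW0 ξ), ← add_mul,
        ← ENNReal.ofReal_add (by positivity) (by positivity)]
    simp_rw [this]
    rw [lintegral_add_left (by fun_prop)]
    rfl

/-- The contribution of a family of bumps which decays in the dual parameter. -/
theorem exists_family_bound {E : ℝ → Plane → ℝ} {R C : ℝ} (hE : ∀ r, ContDiff ℝ ∞ (E r))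
    (hR : ∀ r y, R < ‖y‖ → E r y = 0)
    (hb : ∀ (r : ℝ) (y : Plane), 0 < r → (r ≤ 1 → |E r y| ≤ C / √r) ∧
      (1 ≤ r → |E r y| ≤ C / (r * √r)) ∧ ‖fderiv ℝ (E r) y‖ ≤ C / √r) {e : ℝ} (he : 0 < e) :
    ∃ Q : ℝ → ℝ≥0∞, Measurable Q ∧ ∫⁻ r in Ioi (0 : ℝ), Q r * ENNReal.ofReal r < ⊤ ∧
      ∀ g : Plane → ℂ, Integrable g → ∀ r, 0 < r → ‖∫ y, g y * (E r y : ℂ)‖ₑ ^ 2 ≤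
        Q r * (sobolevNormSq (-(1 / 2) + e) g + sobolevNormSq (-(1 / 2)) g) := by
  -- Positivity of `e'` makes the tail in `r` converge; `e' ≤ 1/2` is required by the weight
  -- inequality.
  set e' : ℝ := min e (1 / 2) with he'
  have he'0 : 0 < e' := lt_min he (by norm_num)
  set c : ℝ := 2 * volume.real (Metric.closedBall (0 : Plane) R) * (2 * C ^ 2) with hc
  have hc0 : 0 ≤ c := by positivity
  -- The splitting frequency is `T = 1` for `r ≤ 1` and `T = r` beyond. For `T = r` the
  -- contributions `r^{1-2e'} · r^{-3}` and `r^{-1-2e'} · r^{-1}` coincide, whence the `2 * C ^ 2`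
  -- in `c`.
  set Q : ℝ → ℝ≥0∞ := fun r => if r ≤ 1 then ENNReal.ofReal (c * r⁻¹) else
    ENNReal.ofReal (c * r ^ (-2 - 2 * e')) with hQ
  refine ⟨Q, ?_, ?_, fun g hg r hr => ?_⟩
  · exact Measurable.ite measurableSet_Iic (by fun_prop) (by fun_prop)
  · have hle : ∀ r ∈ Ioi (0 : ℝ), Q r * ENNReal.ofReal r ≤
        (Ioc (0 : ℝ) 1).indicator (fun _ => ENNReal.ofReal c) r +
        (Ioi (1 : ℝ)).indicator (fun r => ENNReal.ofReal (c * r ^ (-1 - 2 * e'))) r := by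
      intro r hr
      have hr : (0 : ℝ) < r := hr
      rcases le_or_gt r 1 with h | h
      · refine le_trans (le_of_eq ?_) le_self_add
        rw [indicator_of_mem (show r ∈ Ioc (0 : ℝ) 1 from ⟨hr, h⟩)]
        simp only [hQ, if_pos h]
        rw [← ENNReal.ofReal_mul (by positivity), mul_assoc, inv_mul_cancel₀ hr.ne', mul_one]
      · refine le_trans (le_of_eq ?_) le_add_self
        rw [indicator_of_mem (show r ∈ Ioi (1 : ℝ) from h)]
        simp only [hQ, if_neg h.not_ge]
        rw [← ENNReal.ofReal_mul (by positivity), mul_assoc, ← Real.rpow_add_one hr.ne']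
        congr 3
        ring
    refine (setLIntegral_mono' measurableSet_Ioi hle).trans_lt ?_
    refine (lintegral_mono' Measure.restrict_le_self le_rfl).trans_lt ?_
    rw [lintegral_add_left (measurable_const.indicator measurableSet_Ioc),
      lintegral_indicator measurableSet_Ioc,
      lintegral_indicator measurableSet_Ioi]
    refine ENNReal.add_lt_top.2 ⟨by simp, ?_⟩
    have hint : IntegrableOn (fun r : ℝ => c * r ^ (-1 - 2 * e')) (Ioi 1) :=
      (integrableOn_Ioi_rpow_of_lt (by linarith) one_pos).const_mul c
    exact hint.lintegral_lt_top
  · have hsr : (√r) ^ 2 = r := Real.sq_sqrt hr.le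
    rcases le_or_gt r 1 with h | h
    · have := enorm_integral_mul_sq_le hg (hE r) (hR r) (fun y => (hb r y hr).1 h)
        (fun y => (hb r y hr).2.2) one_pos he'0.le (min_le_left _ _) (min_le_right _ _)
      refine this.trans (mul_le_mul_left (le_of_eq ?_) _)
      simp only [hQ, if_pos h, hc]
      congr 1
      simp only [Real.one_rpow, div_pow, hsr]
      field_simp
      ring
    · have := enorm_integral_mul_sq_le hg (hE r) (hR r) (fun y => (hb r y hr).2.1 h.le)
        (fun y => (hb r y hr).2.2) hr he'0.le (min_le_left _ _) (min_le_right _ _)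
      refine this.trans (mul_le_mul_left (le_of_eq ?_) _)
      simp only [hQ, if_neg h.not_ge, hc]
      congr 1
      simp only [div_pow, mul_pow, hsr]
      have e1 : r ^ (1 - 2 * e') = r ^ (-2 - 2 * e') * r ^ 3 := by
        rw [← Real.rpow_natCast, ← Real.rpow_add hr]; congr 1; push_cast; ring
      have e2 : r ^ (-1 - 2 * e') = r ^ (-2 - 2 * e') * r := by
        rw [← Real.rpow_add_one hr.ne']; congr 1; ring
      rw [e1, e2]
      field_simp
      ring

theorem sobolevNormSq_comp_sub_left (s : ℝ) (f : Plane → ℂ) (x : Plane) :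
    sobolevNormSq s (fun y => f (x - y)) = sobolevNormSq s f := by
  have h : ∀ ξ : Plane, ‖𝓕 (fun y => f (x - y)) ξ‖ₑ = ‖𝓕 f (-ξ)‖ₑ := by
    intro ξ
    rw [Real.fourier_eq, Real.fourier_eq, ← integral_sub_left_eq_self _ volume x]
    have : ∀ v : Plane, Real.fourierChar (-inner ℝ (x - v) ξ) • f (x - (x - v)) =
        Real.fourierChar (-inner ℝ x ξ) • (Real.fourierChar (-inner ℝ v (-ξ)) • f v) := by
      intro v
      rw [smul_smul, ← AddChar.map_add_eq_mul, sub_sub_cancel, inner_sub_left, inner_neg_right]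
      congr 2
      ring
    simp_rw [this, Circle.smul_def (Real.fourierChar (-inner ℝ x ξ))]
    rw [integral_smul, enorm_smul, ← ofReal_norm, Circle.norm_coe, ENNReal.ofReal_one, one_mul]
  simp only [sobolevNormSq, h]
  rw [← lintegral_neg_eq_self]
  simp

end Duality

/-! ### A lower bound for the phase-shifted cosine transform. -/

section Hartley

open SchwartzMap

/-- Plancherel's identity for an integrable function with square integrable Fourier transform. -/
theorem eLpNorm_eq_of_memLp_fourier {φ : ℝ → ℂ} (hφ : Integrable φ) (hF : MemLp (𝓕 φ) 2) :
    eLpNorm φ 2 = eLpNorm (𝓕 φ) 2 := by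
  set F : Lp ℂ 2 (volume : Measure ℝ) := hF.toLp (𝓕 φ) with hFdef
  set ψ : Lp ℂ 2 (volume : Measure ℝ) := 𝓕⁻ F with hψ
  have hψF : 𝓕 ψ = F := FourierTransform.fourier_fourierInv_eq F
  -- The given function and the inverse `L²` transform of its Fourier transform are identified by
  -- testing against bumps, each bump being the transform of a Schwartz function.
  have hae : ∀ᵐ s : ℝ, φ s = ψ s := by
    refine ae_eq_of_integral_contDiff_smul_eq hφ.locallyIntegrable
      ((Lp.memLp ψ).locallyIntegrable (by norm_num)) fun χ hχ hcs => ?_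
    have hsm : ContDiff ℝ ∞ fun y => (χ y : ℂ) := ofRealCLM.contDiff.comp hχ
    have hcs' : HasCompactSupport fun y => (χ y : ℂ) := hcs.comp_left ofReal_zero
    set X : 𝓢(ℝ, ℂ) := hcs'.toSchwartzMap hsm with hX
    have hXc : ∀ y, X y = χ y := fun y => rfl
    set η : 𝓢(ℝ, ℂ) := 𝓕⁻ X with hη
    have hηX : 𝓕 η = X := FourierTransform.fourier_fourierInv_eq X
    have h1 : ∫ x, χ x • ψ x = (ψ : TemperedDistribution ℝ ℂ) (𝓕 η) := by
      rw [Lp.toTemperedDistribution_apply, hηX]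
      simp [hXc]
    have h2 : (ψ : TemperedDistribution ℝ ℂ) (𝓕 η) = ∫ ξ, η ξ • F ξ := by
      rw [← TemperedDistribution.fourier_apply, Lp.fourier_toTemperedDistribution_eq, hψF,
        Lp.toTemperedDistribution_apply]
    have h3 : ∫ ξ, η ξ • F ξ = ∫ ξ, 𝓕 φ ξ * η ξ := by
      refine integral_congr_ae ?_
      filter_upwards [hF.coeFn_toLp] with ξ hξ
      rw [hFdef, hξ, smul_eq_mul, mul_comm]
    rw [h1, h2, h3, ← integral_mul_fourier_schwartz hφ, hηX]
    simp [hXc, mul_comm]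
  rw [eLpNorm_congr_ae hae]
  have : ‖ψ‖ = ‖F‖ := by rw [← hψF, Lp.norm_fourier_eq]
  rw [Lp.norm_def, Lp.norm_def, ENNReal.toReal_eq_toReal_iff' (Lp.eLpNorm_ne_top _)
    (Lp.eLpNorm_ne_top _)] at this
  rw [this, hFdef, eLpNorm_congr_ae hF.coeFn_toLp]

theorem lintegral_enorm_sq_eq_eLpNorm {μ : Measure ℝ} (φ : ℝ → ℂ) :
    ∫⁻ s, ‖φ s‖ₑ ^ 2 ∂μ = eLpNorm φ 2 μ ^ 2 := by
  have := eLpNorm_nnreal_pow_eq_lintegral (μ := μ) (f := φ) (p := 2) (by norm_num)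
  simpa using this.symm

/-- Either the right side is infinite or Plancherel applies; square integrability of `φ` need not be
assumed. -/
theorem lintegral_enorm_sq_le_fourier {φ : ℝ → ℂ} (hφ : Integrable φ) :
    ∫⁻ s, ‖φ s‖ₑ ^ 2 ≤ ∫⁻ r, ‖𝓕 φ r‖ₑ ^ 2 := by
  rw [lintegral_enorm_sq_eq_eLpNorm, lintegral_enorm_sq_eq_eLpNorm]
  by_cases h : eLpNorm (𝓕 φ) 2 = ⊤
  · rw [h]; simp
  · have hc : Continuous (𝓕 φ) :=
      VectorFourier.fourierIntegral_continuous Real.continuous_fourierChar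
        (L := innerₗ ℝ) continuous_inner hφ
    rw [eLpNorm_eq_of_memLp_fourier hφ ⟨hc.aestronglyMeasurable, Ne.lt_top h⟩]

/-- The kernel of the cross term after an exponential regularization. -/
theorem integral_exp_regularized {d u : ℝ} (hd : 0 < d) :
    ∫ r in Ioi (0 : ℝ), cexp (-(d * r : ℝ)) * cexp ((2 * Real.pi * r * u : ℝ) * I) =
      1 / (d - 2 * Real.pi * u * I) := by
  have h := integral_exp_mul_complex_Ioi (a := -(d : ℂ) + 2 * Real.pi * u * I) (by simp [hd]) 0
  have e : ∀ r : ℝ, cexp (-(d * r : ℝ)) * cexp ((2 * Real.pi * r * u : ℝ) * I) =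
      cexp ((-(d : ℂ) + 2 * Real.pi * u * I) * r) := fun r => by
    rw [← Complex.exp_add]
    congr 1
    push_cast
    ring
  simp_rw [e]
  rw [h]
  simp only [ofReal_zero, mul_zero, Complex.exp_zero]
  rw [← neg_div_neg_eq]
  congr 1 <;> ring

variable {φ : ℝ → ℂ} {a : ℝ}

/-- The inverse Fourier transform, as an explicit integral. -/
def expTransform (φ : ℝ → ℂ) (r : ℝ) : ℂ := ∫ s, φ s * cexp ((2 * Real.pi * r * s : ℝ) * I)

theorem expTransform_neg (φ : ℝ → ℂ) (r : ℝ) : expTransform φ (-r) = 𝓕 φ r := by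
  rw [expTransform, Real.fourier_eq']
  refine integral_congr_ae (Eventually.of_forall fun s => ?_)
  simp only [smul_eq_mul]
  rw [mul_comm]
  congr 3
  simp
  ring

theorem norm_expTransform_le (r : ℝ) : ‖expTransform φ r‖ ≤ ∫ s, ‖φ s‖ := by
  refine (norm_integral_le_integral_norm _).trans (le_of_eq ?_)
  refine integral_congr_ae (Eventually.of_forall fun s => ?_)
  simp only [norm_mul, norm_exp_ofReal_mul_I, mul_one]

theorem integrable_mul_exp (hφ : Integrable φ) (r : ℝ) :
    Integrable fun s => φ s * cexp ((2 * Real.pi * r * s : ℝ) * I) := by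
  refine hφ.mul_bdd (c := 1) (Continuous.aestronglyMeasurable (by fun_prop)) ?_
  exact Eventually.of_forall fun s => (norm_exp_ofReal_mul_I _).le

theorem continuous_expTransform (hφ : Integrable φ) : Continuous (expTransform φ) := by
  have hc : Continuous (𝓕 φ) :=
    VectorFourier.fourierIntegral_continuous Real.continuous_fourierChar
      (L := innerₗ ℝ) continuous_inner hφ
  have : expTransform φ = fun r => 𝓕 φ (-r) := by
    ext r
    rw [← expTransform_neg, neg_neg]
  rw [this]
  exact hc.comp continuous_neg

theorem conj_expTransform_neg (φ : ℝ → ℂ) (r : ℝ) :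
    (starRingEnd ℂ) (expTransform φ (-r)) = ∫ s, (starRingEnd ℂ) (φ s) *
      cexp ((2 * Real.pi * r * s : ℝ) * I) := by
  rw [expTransform, ← integral_conj]
  refine integral_congr_ae (Eventually.of_forall fun s => ?_)
  simp only [map_mul, ← Complex.exp_conj, conj_I, conj_ofReal]
  congr 2
  push_cast
  ring

theorem integral_mul_cos_eq (hφ : Integrable φ) (r : ℝ) :
    ∫ s, φ s * (Real.cos (2 * Real.pi * r * s - Real.pi / 4) : ℂ) =
      (cexp (-(Real.pi / 4 : ℝ) * I) * expTransform φ r +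
        cexp ((Real.pi / 4 : ℝ) * I) * expTransform φ (-r)) / 2 := by
  rw [expTransform, expTransform, ← integral_const_mul, ← integral_const_mul,
    ← integral_add ((integrable_mul_exp hφ r).const_mul _)
      ((integrable_mul_exp hφ (-r)).const_mul _), ← integral_div]
  refine integral_congr_ae (Eventually.of_forall fun s => ?_)
  simp only
  rw [ofReal_cos, Complex.cos]
  have e1 : cexp (((2 * Real.pi * r * s - Real.pi / 4 : ℝ) : ℂ) * I) =
      cexp (-(Real.pi / 4 : ℝ) * I) * cexp ((2 * Real.pi * r * s : ℝ) * I) := by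
    rw [← Complex.exp_add]; congr 1; push_cast; ring
  have e2 : cexp (-((2 * Real.pi * r * s - Real.pi / 4 : ℝ) : ℂ) * I) =
      cexp ((Real.pi / 4 : ℝ) * I) * cexp ((2 * Real.pi * (-r) * s : ℝ) * I) := by
    rw [← Complex.exp_add]; congr 1; push_cast; ring
  rw [e1, e2]
  ring

/-- Rotation by `π/4` in opposite directions turns the cross term into `-i z w̄`, the phase for
which `cross_nonneg` gives a sign. -/
theorem norm_sq_rotated_add (z w : ℂ) :
    ‖z‖ ^ 2 + ‖w‖ ^ 2 = 4 * ‖(cexp (-(Real.pi / 4 : ℝ) * I) * z +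
      cexp ((Real.pi / 4 : ℝ) * I) * w) / 2‖ ^ 2 - 2 * (-I * z * (starRingEnd ℂ) w).re := by
  set c := cexp ((Real.pi / 4 : ℝ) * I) with hc
  have hcn : ‖c‖ = 1 := norm_exp_ofReal_mul_I _
  have hcc : cexp (-(Real.pi / 4 : ℝ) * I) = (starRingEnd ℂ) c := by
    rw [hc, ← Complex.exp_conj, map_mul, conj_I, conj_ofReal]
    congr 1
    ring
  have hsq : (starRingEnd ℂ) c * (starRingEnd ℂ) c = -I := by
    rw [← hcc, ← Complex.exp_add]
    have : -((Real.pi / 4 : ℝ) : ℂ) * I + -((Real.pi / 4 : ℝ) : ℂ) * I =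
        -(Real.pi / 2 * I) := by push_cast; ring
    rw [this, Complex.exp_neg, Complex.exp_pi_div_two_mul_I, inv_I]
  rw [hcc, norm_div, div_pow]
  have h := Complex.normSq_add ((starRingEnd ℂ) c * z) (c * w)
  simp only [Complex.normSq_eq_norm_sq] at h
  rw [h, norm_mul, norm_mul, norm_conj, hcn, map_mul, ← hsq]
  have : (starRingEnd ℂ) c * z * ((starRingEnd ℂ) c * (starRingEnd ℂ) w) =
    (starRingEnd ℂ) c * (starRingEnd ℂ) c * z * (starRingEnd ℂ) w := by ring
  rw [this]
  simp only [RCLike.norm_ofNat]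
  ring

/-- The cross term of the Hartley transform, as a double integral. -/
theorem integral_cross_regularized (hφ : Integrable φ) {d : ℝ} (hd : 0 < d) :
    ∫ r in Ioi (0 : ℝ), cexp (-(d * r : ℝ)) *
      (expTransform φ r * (starRingEnd ℂ) (expTransform φ (-r))) =
      ∫ p : ℝ × ℝ, (φ p.1 * (starRingEnd ℂ) (φ p.2)) *
        (1 / (d - 2 * Real.pi * (p.1 + p.2 : ℝ) * I)) := by
  have hφ' : Integrable fun s => (starRingEnd ℂ) (φ s) := by
    exact (conjCLE : ℂ →L[ℝ] ℂ).integrable_comp hφ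
  have hΘ : Integrable (fun p : ℝ × ℝ => φ p.1 * (starRingEnd ℂ) (φ p.2)) := hφ.mul_prod hφ'
  have hexp : IntegrableOn (fun r : ℝ => cexp (-(d * r : ℝ))) (Ioi 0) := by
    have := integrableOn_exp_mul_complex_Ioi (a := -(d : ℂ)) (by simpa using hd) 0
    refine this.congr (Eventually.of_forall fun r => ?_)
    simp
  have e1 : ∀ r : ℝ, expTransform φ r * (starRingEnd ℂ) (expTransform φ (-r)) =
      ∫ p : ℝ × ℝ, (φ p.1 * (starRingEnd ℂ) (φ p.2)) *
        cexp ((2 * Real.pi * r * (p.1 + p.2) : ℝ) * I) := by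
    intro r
    rw [conj_expTransform_neg, expTransform, ← integral_prod_mul]
    refine integral_congr_ae (Eventually.of_forall fun p => ?_)
    have : cexp ((2 * Real.pi * r * (p.1 + p.2) : ℝ) * I) =
      cexp ((2 * Real.pi * r * p.1 : ℝ) * I) * cexp ((2 * Real.pi * r * p.2 : ℝ) * I) := by
      rw [← Complex.exp_add]; congr 1; push_cast; ring
    simp only [this]
    ring
  simp_rw [e1, ← integral_const_mul]
  rw [integral_integral_swap]
  · refine integral_congr_ae (Eventually.of_forall fun p => ?_)
    simp only
    rw [← integral_exp_regularized hd, ← integral_const_mul]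
    refine integral_congr_ae (Eventually.of_forall fun r => ?_)
    simp only
    ring
  · refine ((hexp.mul_prod hΘ).mul_bdd (c := 1)
      (g := fun q : ℝ × ℝ × ℝ => cexp ((2 * Real.pi * q.1 * (q.2.1 + q.2.2) : ℝ) * I))
      (Continuous.aestronglyMeasurable (by fun_prop))
      (Eventually.of_forall fun q => (norm_exp_ofReal_mul_I _).le)).congr
      (Eventually.of_forall fun q => ?_)
    simp only [Function.uncurry]
    ring

/-- On the support of the integrand `p.1 + p.2 ≥ 2a`, so the kernel is bounded uniformly in `d` and
dominated convergence applies. -/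
theorem tendsto_cross (hφ : Integrable φ) (ha : 0 < a) (hs : ∀ s, s < a → φ s = 0) :
    Tendsto (fun d : ℝ => ∫ p : ℝ × ℝ, (φ p.1 * (starRingEnd ℂ) (φ p.2)) *
        (1 / (d - 2 * Real.pi * (p.1 + p.2 : ℝ) * I))) (𝓝[>] 0)
      (𝓝 (∫ p : ℝ × ℝ, (φ p.1 * (starRingEnd ℂ) (φ p.2)) *
        (1 / ((0 : ℝ) - 2 * Real.pi * (p.1 + p.2 : ℝ) * I)))) := by
  have hφ' : Integrable fun s => (starRingEnd ℂ) (φ s) := by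
    exact (conjCLE : ℂ →L[ℝ] ℂ).integrable_comp hφ
  have hΘ : Integrable (fun p : ℝ × ℝ => φ p.1 * (starRingEnd ℂ) (φ p.2)) := hφ.mul_prod hφ'
  have hzero : ∀ p : ℝ × ℝ, ¬ (a ≤ p.1 ∧ a ≤ p.2) → φ p.1 * (starRingEnd ℂ) (φ p.2) = 0 := by
    intro p hp
    rw [not_and_or, not_le, not_le] at hp
    rcases hp with h | h <;> simp [hs _ h]
  refine tendsto_integral_filter_of_dominated_convergence
    (fun p => ‖φ p.1 * (starRingEnd ℂ) (φ p.2)‖ * (1 / (2 * Real.pi * (2 * a)))) ?_ ?_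
    (hΘ.norm.mul_const _) ?_
  · refine Eventually.of_forall fun d => hΘ.aestronglyMeasurable.mul ?_
    exact Measurable.aestronglyMeasurable (by fun_prop)
  · refine Eventually.of_forall fun d => Eventually.of_forall fun p => ?_
    by_cases hp : a ≤ p.1 ∧ a ≤ p.2
    · rw [norm_mul, norm_div, norm_one]
      refine mul_le_mul_of_nonneg_left ?_ (norm_nonneg _)
      refine one_div_le_one_div_of_le (by positivity) ?_
      have := Complex.abs_im_le_norm (d - 2 * Real.pi * (p.1 + p.2 : ℝ) * I)
      simp only [sub_im, ofReal_im, mul_im, I_im, I_re, mul_one, mul_zero, add_zero, mul_re,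
        ofReal_re, re_ofNat, im_ofNat, zero_mul, sub_zero, zero_sub, abs_neg] at this
      refine le_trans ?_ this
      refine le_trans ?_ (le_abs_self _)
      nlinarith [Real.pi_pos, hp.1, hp.2]
    · rw [hzero p hp]
      simp
  · refine Eventually.of_forall fun p => ?_
    by_cases hp : a ≤ p.1 ∧ a ≤ p.2
    · refine tendsto_const_nhds.mul ?_
      have hc : ContinuousAt (fun d : ℝ => 1 / ((d : ℂ) - 2 * Real.pi * (p.1 + p.2 : ℝ) * I)) 0 := by
        refine continuousAt_const.div (by fun_prop) ?_
        intro h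
        have := congrArg Complex.im h
        simp [Real.pi_ne_zero] at this
        linarith [hp.1, hp.2]
      exact hc.tendsto.mono_left nhdsWithin_le_nhds
    · rw [hzero p hp]
      simp

/-- With `u = s + s' > 0`, the kernel times `-i` is `1 / (2πu) = ∫₀^∞ e^{-2πyu} dy`, and the
exponential splits into a product. The double integral becomes `∫₀^∞ |L(y)|² dy`, with `L` the
Laplace transform of `φ`. -/
theorem cross_nonneg (hφ : Integrable φ) (ha : 0 < a) (hs : ∀ s, s < a → φ s = 0) :
    0 ≤ (-I * ∫ p : ℝ × ℝ, (φ p.1 * (starRingEnd ℂ) (φ p.2)) *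
        (1 / ((0 : ℝ) - 2 * Real.pi * (p.1 + p.2 : ℝ) * I))).re := by
  have hφ' : Integrable fun s => (starRingEnd ℂ) (φ s) := by
    exact (conjCLE : ℂ →L[ℝ] ℂ).integrable_comp hφ
  have hΘ : Integrable (fun p : ℝ × ℝ => φ p.1 * (starRingEnd ℂ) (φ p.2)) := hφ.mul_prod hφ'
  have hzero : ∀ p : ℝ × ℝ, ¬ (a ≤ p.1 ∧ a ≤ p.2) → φ p.1 * (starRingEnd ℂ) (φ p.2) = 0 := by
    intro p hp
    rw [not_and_or, not_le, not_le] at hp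
    rcases hp with h | h <;> simp [hs _ h]
  set L : ℝ → ℂ := fun y => ∫ s, φ s * cexp (-(2 * Real.pi * y * s : ℝ)) with hL
  have key : -I * ∫ p : ℝ × ℝ, (φ p.1 * (starRingEnd ℂ) (φ p.2)) *
        (1 / ((0 : ℝ) - 2 * Real.pi * (p.1 + p.2 : ℝ) * I)) =
      ∫ y in Ioi (0 : ℝ), L y * (starRingEnd ℂ) (L y) := by
    have e1 : ∀ y : ℝ, L y * (starRingEnd ℂ) (L y) =
        ∫ p : ℝ × ℝ, (φ p.1 * (starRingEnd ℂ) (φ p.2)) *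
          cexp (-(2 * Real.pi * y * (p.1 + p.2) : ℝ)) := by
      intro y
      simp only [hL]
      rw [← integral_conj, ← integral_prod_mul]
      refine integral_congr_ae (Eventually.of_forall fun p => ?_)
      have : cexp (-(2 * Real.pi * y * (p.1 + p.2) : ℝ)) =
        cexp (-(2 * Real.pi * y * p.1 : ℝ)) * cexp (-(2 * Real.pi * y * p.2 : ℝ)) := by
        rw [← Complex.exp_add]; congr 1; push_cast; ring
      simp only [this, map_mul, ← Complex.exp_conj, map_neg, conj_ofReal]
      ring
    simp_rw [e1]
    rw [integral_integral_swap, ← integral_const_mul]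
    · refine integral_congr_ae (Eventually.of_forall fun p => ?_)
      simp only
      by_cases hp : a ≤ p.1 ∧ a ≤ p.2
      · rw [integral_const_mul]
        have hu : 0 < p.1 + p.2 := by linarith [hp.1, hp.2]
        have h := integral_exp_mul_complex_Ioi (a := -((2 * Real.pi * (p.1 + p.2) : ℝ) : ℂ))
          (by rw [neg_re, ofReal_re, neg_lt_zero]; positivity) 0
        have e : ∀ y : ℝ, cexp (-(2 * Real.pi * y * (p.1 + p.2) : ℝ)) =
            cexp (-((2 * Real.pi * (p.1 + p.2) : ℝ) : ℂ) * y) := fun y => by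
          congr 1; push_cast; ring
        simp_rw [e]
        rw [h]
        have hu' : ((p.1 + p.2 : ℝ) : ℂ) ≠ 0 := by exact_mod_cast hu.ne'
        have hpi : (Real.pi : ℂ) ≠ 0 := by exact_mod_cast Real.pi_ne_zero
        simp only [ofReal_zero, mul_zero, Complex.exp_zero, zero_sub, ofReal_mul, ofReal_ofNat]
        field_simp
      · rw [hzero p hp]
        simp
    · have hexp : IntegrableOn (fun y : ℝ => cexp ((-(4 * Real.pi * a : ℝ) : ℂ) * y)) (Ioi 0) :=
        integrableOn_exp_mul_complex_Ioi
          (by rw [neg_re, ofReal_re, neg_lt_zero]; positivity) 0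
      have hdom := hexp.norm.mul_prod hΘ.norm
      refine hdom.mono' ?_ ?_
      · have hm : AEStronglyMeasurable (fun q : ℝ × ℝ × ℝ => φ q.2.1 * (starRingEnd ℂ) (φ q.2.2))
            ((volume.restrict (Ioi 0)).prod volume) := hΘ.aestronglyMeasurable.comp_snd
        exact hm.mul (Continuous.aestronglyMeasurable (by fun_prop))
      · have hmem : ∀ᵐ q : ℝ × ℝ × ℝ ∂((volume.restrict (Ioi 0)).prod volume), 0 < q.1 := by
          have := Measure.quasiMeasurePreserving_fst (μ := volume.restrict (Ioi (0 : ℝ)))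
            (ν := (volume : Measure (ℝ × ℝ)))
          exact this.ae (ae_restrict_mem measurableSet_Ioi)
        filter_upwards [hmem] with q hq
        simp only [Function.uncurry]
        by_cases hp : a ≤ q.2.1 ∧ a ≤ q.2.2
        · rw [norm_mul, mul_comm]
          refine mul_le_mul_of_nonneg_right ?_ (norm_nonneg _)
          rw [Complex.norm_exp, Complex.norm_exp]
          refine Real.exp_le_exp.2 ?_
          rw [← ofReal_neg, ← ofReal_neg, ← ofReal_mul, ofReal_re, ofReal_re]
          have : 2 * Real.pi * q.1 * (2 * a) ≤ 2 * Real.pi * q.1 * (q.2.1 + q.2.2) :=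
            mul_le_mul_of_nonneg_left (by linarith [hp.1, hp.2]) (by positivity)
          linarith
        · rw [hzero _ hp]
          simp
  rw [key]
  have : ∀ y, L y * (starRingEnd ℂ) (L y) = ((‖L y‖ ^ 2 : ℝ) : ℂ) := fun y => by
    rw [Complex.mul_conj, Complex.normSq_eq_norm_sq]
  simp_rw [this]
  rw [show ∫ y in Ioi (0 : ℝ), ((‖L y‖ ^ 2 : ℝ) : ℂ) = ((∫ y in Ioi (0 : ℝ), ‖L y‖ ^ 2 : ℝ) : ℂ)
    from integral_ofReal, ofReal_re]
  exact integral_nonneg fun y => by positivity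

/-- A lower bound for the phase-shifted cosine transform of a function supported in a half line. -/
theorem lintegral_enorm_sq_le_cos (hφ : Integrable φ) (ha : 0 < a) (hs : ∀ s, s < a → φ s = 0) :
    ∫⁻ s, ‖φ s‖ₑ ^ 2 ≤ 4 * ∫⁻ r in Ioi (0 : ℝ),
      ‖∫ s, φ s * (Real.cos (2 * Real.pi * r * s - Real.pi / 4) : ℂ)‖ₑ ^ 2 := by
  set V : ℝ → ℂ := fun r => ∫ s, φ s * (Real.cos (2 * Real.pi * r * s - Real.pi / 4) : ℂ) with hV
  set B : ℝ := ∫ s, ‖φ s‖ with hB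
  have hA := continuous_expTransform hφ
  have hAm : Continuous fun r => expTransform φ (-r) := hA.comp continuous_neg
  have hVeq : ∀ r, V r = (cexp (-(Real.pi / 4 : ℝ) * I) * expTransform φ r +
        cexp ((Real.pi / 4 : ℝ) * I) * expTransform φ (-r)) / 2 := integral_mul_cos_eq hφ
  have hVc : Continuous V := by
    rw [funext hVeq]
    fun_prop
  have hsplit : ∫⁻ r, ‖𝓕 φ r‖ₑ ^ 2 = ∫⁻ r in Ioi (0 : ℝ),
      ENNReal.ofReal (‖expTransform φ r‖ ^ 2 + ‖expTransform φ (-r)‖ ^ 2) := by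
    have h0 : ∀ r, ‖𝓕 φ r‖ₑ ^ 2 = ENNReal.ofReal (‖expTransform φ (-r)‖ ^ 2) := fun r => by
      rw [expTransform_neg, ENNReal.ofReal_pow (norm_nonneg _), ofReal_norm]
    simp_rw [h0]
    rw [← lintegral_add_compl _ (measurableSet_Ioi (a := (0 : ℝ))), compl_Ioi]
    have h1 : ∫⁻ r in Iic (0 : ℝ), ENNReal.ofReal (‖expTransform φ (-r)‖ ^ 2) =
        ∫⁻ r in Ioi (0 : ℝ), ENNReal.ofReal (‖expTransform φ r‖ ^ 2) := by
      rw [setLIntegral_congr Iio_ae_eq_Iic.symm]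
      have := (Measure.measurePreserving_neg (volume : Measure ℝ)).setLIntegral_comp_preimage
        (s := Ioi (0 : ℝ)) measurableSet_Ioi
        (f := fun r => ENNReal.ofReal (‖expTransform φ r‖ ^ 2)) (by fun_prop)
      rw [← this]
      simp
    rw [h1, add_comm, ← lintegral_add_left (by fun_prop)]
    refine lintegral_congr fun r => ?_
    rw [ENNReal.ofReal_add (by positivity) (by positivity)]
  refine (lintegral_enorm_sq_le_fourier hφ).trans ?_
  rw [hsplit]
  -- The transforms are only known to be bounded, so integrals over `r` are damped by `e^{-dr}` with
  -- `d = 1 / (k + 1)`. The damping is removed on the left by Fatou's lemma, and on the right by the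
  -- convergence of the cross term to a nonnegative limit.
  set D : ℕ → ℝ := fun k => 1 / ((k : ℝ) + 1) with hD
  have hD0 : ∀ k, 0 < D k := fun k => by simp only [hD]; positivity
  have hDt : Tendsto D atTop (𝓝 0) := tendsto_one_div_add_atTop_nhds_zero_nat
  have hDt' : Tendsto D atTop (𝓝[>] 0) :=
    tendsto_nhdsWithin_iff.2 ⟨hDt, Eventually.of_forall hD0⟩
  set S : ℝ → ℝ := fun r => ‖expTransform φ r‖ ^ 2 + ‖expTransform φ (-r)‖ ^ 2 with hS
  have hSc : Continuous S := by fun_prop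
  set X : ℝ → ℝ := fun r => (-I * expTransform φ r * (starRingEnd ℂ) (expTransform φ (-r))).re
  have hXc : Continuous X := by
    have : Continuous fun r => (starRingEnd ℂ) (expTransform φ (-r)) :=
      Complex.continuous_conj.comp hAm
    fun_prop
  have hSX : ∀ r, S r = 4 * ‖V r‖ ^ 2 - 2 * X r := fun r => by
    rw [hVeq]; exact norm_sq_rotated_add _ _
  have hB0 : 0 ≤ B := integral_nonneg fun s => norm_nonneg _
  have hSb : ∀ r, ‖S r‖ ≤ 2 * B ^ 2 := fun r => by
    have h1 := pow_le_pow_left₀ (norm_nonneg _) (norm_expTransform_le (φ := φ) r) 2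
    have h2 := pow_le_pow_left₀ (norm_nonneg _) (norm_expTransform_le (φ := φ) (-r)) 2
    rw [Real.norm_eq_abs, abs_of_nonneg (by positivity)]
    simp only [hS]
    linarith
  have hXb : ∀ r, ‖X r‖ ≤ B ^ 2 := fun r => by
    refine (Complex.abs_re_le_norm _).trans ?_
    rw [norm_mul, norm_mul, norm_neg, norm_I, one_mul, norm_conj, sq]
    exact mul_le_mul (norm_expTransform_le r) (norm_expTransform_le (-r)) (norm_nonneg _) hB0
  have hexp : ∀ d : ℝ, 0 < d → IntegrableOn (fun r : ℝ => Real.exp (-(d * r))) (Ioi 0) :=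
    fun d hd => by simpa using exp_neg_integrableOn_Ioi 0 hd
  have hSi : ∀ d : ℝ, 0 < d → IntegrableOn (fun r => Real.exp (-(d * r)) * S r) (Ioi 0) :=
    fun d hd => (hexp d hd).mul_bdd (c := 2 * B ^ 2) hSc.aestronglyMeasurable
      (Eventually.of_forall hSb)
  have hXi : ∀ d : ℝ, 0 < d → IntegrableOn (fun r => Real.exp (-(d * r)) * X r) (Ioi 0) :=
    fun d hd => (hexp d hd).mul_bdd (c := B ^ 2) hXc.aestronglyMeasurable
      (Eventually.of_forall hXb)
  set x : ℝ → ℝ := fun d => ∫ r in Ioi (0 : ℝ), Real.exp (-(d * r)) * X r with hx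
  obtain ⟨l, hl, hxl⟩ : ∃ l, 0 ≤ l ∧ Tendsto (fun k => x (D k)) atTop (𝓝 l) := by
    refine ⟨_, cross_nonneg hφ ha hs, ?_⟩
    have h1 := ((tendsto_cross hφ ha hs).comp hDt').const_mul (-I)
    have h2 := (Complex.continuous_re.tendsto _).comp h1
    refine h2.congr fun k => ?_
    simp only [Function.comp, hx]
    rw [← integral_cross_regularized hφ (hD0 k), ← integral_const_mul]
    have e : ∀ r : ℝ, -I * (cexp (-(D k * r : ℝ)) *
        (expTransform φ r * (starRingEnd ℂ) (expTransform φ (-r)))) =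
        ((Real.exp (-(D k * r)) : ℝ) : ℂ) *
          (-I * expTransform φ r * (starRingEnd ℂ) (expTransform φ (-r))) := fun r => by
      push_cast
      ring
    simp_rw [e]
    rw [← RCLike.re_eq_complex_re, ← integral_re]
    · refine integral_congr_ae (Eventually.of_forall fun r => ?_)
      simp only [RCLike.re_eq_complex_re, re_ofReal_mul, X]
    · refine (hexp _ (hD0 k)).ofReal.mul_bdd (c := B ^ 2) ?_ (Eventually.of_forall fun r => ?_)
      · have : Continuous fun r => (starRingEnd ℂ) (expTransform φ (-r)) :=
          Complex.continuous_conj.comp hAm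
        exact Continuous.aestronglyMeasurable (by fun_prop)
      · rw [norm_mul, norm_mul, norm_neg, norm_I, one_mul, norm_conj, sq]
        exact mul_le_mul (norm_expTransform_le r) (norm_expTransform_le (-r)) (norm_nonneg _) hB0
  have hup : ∀ k, ∫⁻ r in Ioi (0 : ℝ), ENNReal.ofReal (Real.exp (-(D k * r)) * S r) ≤
      4 * (∫⁻ r in Ioi (0 : ℝ), ‖V r‖ₑ ^ 2) + ENNReal.ofReal (-(2 * x (D k))) := by
    intro k
    have hd := hD0 k
    have hVi : IntegrableOn (fun r => Real.exp (-(D k * r)) * ‖V r‖ ^ 2) (Ioi 0) := by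
      refine (((hSi _ hd).add ((hXi _ hd).const_mul 2)).div_const 4).congr
        (Eventually.of_forall fun r => ?_)
      simp only [Pi.add_apply, hSX]
      ring
    rw [← ofReal_integral_eq_lintegral_ofReal (hSi _ hd)
      (Eventually.of_forall fun r => mul_nonneg (Real.exp_pos _).le (by simp only [hS]; positivity))]
    have e : ∫ r in Ioi (0 : ℝ), Real.exp (-(D k * r)) * S r =
        4 * (∫ r in Ioi (0 : ℝ), Real.exp (-(D k * r)) * ‖V r‖ ^ 2) + -(2 * x (D k)) := by
      rw [hx, ← integral_const_mul, ← integral_const_mul, ← sub_eq_add_neg,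
        ← integral_sub (hVi.const_mul 4) ((hXi _ hd).const_mul 2)]
      refine integral_congr_ae (Eventually.of_forall fun r => ?_)
      simp only [hSX]
      ring
    rw [e]
    refine ENNReal.ofReal_add_le.trans (add_le_add_left ?_ _)
    rw [ENNReal.ofReal_mul (by norm_num), ENNReal.ofReal_ofNat]
    refine mul_le_mul_right ?_ _
    rw [ofReal_integral_eq_lintegral_ofReal hVi (Eventually.of_forall fun r => by positivity)]
    refine setLIntegral_mono' measurableSet_Ioi fun r hr => ?_
    rw [← ofReal_norm, ← ENNReal.ofReal_pow (norm_nonneg _)]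
    refine ENNReal.ofReal_le_ofReal (mul_le_of_le_one_left (by positivity) ?_)
    rw [Real.exp_le_one_iff]
    have : 0 < r := hr
    have := mul_pos hd this
    linarith
  have hfatou : ∫⁻ r in Ioi (0 : ℝ), ENNReal.ofReal (S r) ≤
      liminf (fun k => ∫⁻ r in Ioi (0 : ℝ), ENNReal.ofReal (Real.exp (-(D k * r)) * S r)) atTop := by
    have h1 : ∀ r, liminf (fun k => ENNReal.ofReal (Real.exp (-(D k * r)) * S r)) atTop =
        ENNReal.ofReal (S r) := fun r => by
      refine Tendsto.liminf_eq (ENNReal.tendsto_ofReal ?_)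
      have : Tendsto (fun k => Real.exp (-(D k * r)) * S r) atTop
          (𝓝 (Real.exp (-(0 * r)) * S r)) :=
        ((Real.continuous_exp.tendsto _).comp (hDt.mul_const r).neg).mul_const _
      simpa using this
    simp_rw [← h1]
    exact lintegral_liminf_le fun k => by fun_prop
  refine hfatou.trans ?_
  refine (liminf_le_liminf (Eventually.of_forall hup)).trans (le_of_eq ?_)
  refine Tendsto.liminf_eq ?_
  -- The cross terms may be negative for positive `d`; only their limit has a sign, and
  -- `ENNReal.ofReal` sends the nonpositive limit `-2l` to `0`.
  have h2 : Tendsto (fun k => ENNReal.ofReal (-(2 * x (D k)))) atTop (𝓝 0) := by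
    have := ENNReal.tendsto_ofReal (hxl.const_mul 2).neg
    rwa [ENNReal.ofReal_of_nonpos (by linarith)] at this
  have h3 := h2.const_add (4 * ∫⁻ r in Ioi (0 : ℝ), ‖V r‖ₑ ^ 2)
  rwa [add_zero] at h3

end Hartley

/-! ### Hausdorff measure of parametrized curves. -/

section Curve

open Measure

variable {γ γ' : ℝ → Plane} {a b : ℝ}

theorem hausdorffMeasure_image_le_of_norm_deriv_le (hγ : ∀ t, HasDerivAt γ (γ' t) t) {c d C : ℝ}
    (hC : ∀ t ∈ Icc c d, ‖γ' t‖ ≤ C) (hC0 : 0 ≤ C) :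
    μH[1] (γ '' Ioc c d) ≤ ENNReal.ofReal (C * (d - c)) := by
  have hlip : LipschitzOnWith C.toNNReal γ (Icc c d) :=
    (convex_Icc c d).lipschitzOnWith_of_nnnorm_hasDerivWithin_le
      (fun t _ => (hγ t).hasDerivWithinAt) fun t ht => by
        rw [← NNReal.coe_le_coe, coe_nnnorm, Real.coe_toNNReal _ hC0]
        exact hC t ht
  have h := (hlip.mono Ioc_subset_Icc_self).hausdorffMeasure_image_le (d := 1) zero_le_one
  rw [hausdorffMeasure_real, Real.volume_Ioc, ENNReal.rpow_one] at h
  refine h.trans (le_of_eq ?_)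
  rw [ENNReal.ofReal_mul hC0]
  rfl

/-- The distance to `γ c` is a 1-Lipschitz function, so it does not increase the measure; by the
intermediate value theorem it maps the arc onto a set covering an interval of the required length.
-/
theorem dist_le_hausdorffMeasure_image (hc : Continuous γ) {c d : ℝ} (hcd : c ≤ d) :
    ENNReal.ofReal (dist (γ d) (γ c)) ≤ μH[1] (γ '' Ioc c d) := by
  have h1 : Ioc 0 (dist (γ d) (γ c)) ⊆ (fun y => dist y (γ c)) '' (γ '' Ioc c d) := by
    rw [image_image]
    have := intermediate_value_Ioc hcd (f := fun t => dist (γ t) (γ c)) (by fun_prop)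
    simpa using this
  have h2 : μH[1] ((fun y => dist y (γ c)) '' (γ '' Ioc c d)) ≤ μH[1] (γ '' Ioc c d) := by
    have := (LipschitzWith.dist_left (γ c)).hausdorffMeasure_image_le (d := 1) zero_le_one
      (γ '' Ioc c d)
    simpa using this
  calc ENNReal.ofReal (dist (γ d) (γ c)) = volume (Ioc 0 (dist (γ d) (γ c))) := by simp
    _ ≤ _ := by
      rw [← hausdorffMeasure_real]
      exact (measure_mono h1).trans h2

/-- Over `[c, d]` the length function grows by at least the chord and by at most `sup ‖γ'‖ · (d -
c)`. Both bounds force the right derivative `‖γ'‖`, and the fundamental theorem of calculus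
concludes. Injectivity makes the length function additive. -/
theorem hausdorffMeasure_image_Ioc (hγ : ∀ t, HasDerivAt γ (γ' t) t) (hγ' : Continuous γ')
    (hab : a ≤ b) (hinj : InjOn γ (Ioc a b)) :
    μH[1] (γ '' Ioc a b) = ENNReal.ofReal (∫ t in a..b, ‖γ' t‖) := by
  have hc : Continuous γ := continuous_iff_continuousAt.2 fun t => (hγ t).continuousAt
  obtain ⟨C, hC⟩ := (isCompact_Icc (a := a) (b := b)).exists_bound_of_continuousOn hγ'.continuousOn
  have hC0 : 0 ≤ C := (norm_nonneg _).trans (hC a ⟨le_rfl, hab⟩)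
  have hup : ∀ c d, a ≤ c → d ≤ b → μH[1] (γ '' Ioc c d) ≤ ENNReal.ofReal (C * (d - c)) :=
    fun c d hac hdb => hausdorffMeasure_image_le_of_norm_deriv_le hγ
      (fun t ht => hC t ⟨hac.trans ht.1, ht.2.trans hdb⟩) hC0
  have hfin : ∀ c d, a ≤ c → d ≤ b → μH[1] (γ '' Ioc c d) ≠ ⊤ := fun c d h1 h2 =>
    ((hup c d h1 h2).trans_lt ENNReal.ofReal_lt_top).ne
  set F : ℝ → ℝ := fun t => (μH[1] (γ '' Ioc a t)).toReal with hF
  have hadd : ∀ c d, a ≤ c → c ≤ d → d ≤ b → F d - F c = (μH[1] (γ '' Ioc c d)).toReal := by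
    intro c d hac hcd hdb
    have hu : γ '' Ioc a d = γ '' Ioc a c ∪ γ '' Ioc c d := by
      rw [← image_union, Ioc_union_Ioc_eq_Ioc hac hcd]
    have hdisj : Disjoint (γ '' Ioc a c) (γ '' Ioc c d) := by
      rw [disjoint_iff_inter_eq_empty, ← hinj.image_inter (Ioc_subset_Ioc_right (hcd.trans hdb))
        (Ioc_subset_Ioc hac hdb), Ioc_inter_Ioc]
      simp [hac, hcd]
    have hm : MeasurableSet (γ '' Ioc c d) :=
      measurableSet_Ioc.image_of_continuousOn_injOn hc.continuousOn
        (hinj.mono (Ioc_subset_Ioc hac hdb))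
    simp only [hF]
    rw [hu, measure_union hdisj hm, ENNReal.toReal_add (hfin _ _ le_rfl (hcd.trans hdb))
      (hfin _ _ hac hdb)]
    ring
  have hFle : ∀ c d, a ≤ c → c ≤ d → d ≤ b → ∀ B, 0 ≤ B → (∀ t ∈ Icc c d, ‖γ' t‖ ≤ B) →
      F d - F c ≤ B * (d - c) := by
    intro c d hac hcd hdb B hB0 hB
    rw [hadd c d hac hcd hdb]
    exact ENNReal.toReal_le_of_le_ofReal (mul_nonneg hB0 (by linarith))
      (hausdorffMeasure_image_le_of_norm_deriv_le hγ hB hB0)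
  have hleF : ∀ c d, a ≤ c → c ≤ d → d ≤ b → dist (γ d) (γ c) ≤ F d - F c := by
    intro c d hac hcd hdb
    rw [hadd c d hac hcd hdb]
    have := ENNReal.toReal_mono (hfin _ _ hac hdb) (dist_le_hausdorffMeasure_image hc hcd)
    rwa [ENNReal.toReal_ofReal dist_nonneg] at this
  have hFc : ContinuousOn F (Icc a b) := by
    have : LipschitzOnWith C.toNNReal F (Icc a b) := by
      refine LipschitzOnWith.of_le_add_mul _ fun x hx y hy => ?_
      rw [Real.coe_toNNReal _ hC0]
      rcases le_total x y with h | h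
      · have := hleF x y hx.1 h hy.2
        have := mul_nonneg hC0 (dist_nonneg (x := x) (y := y))
        have := dist_nonneg (x := γ y) (y := γ x)
        linarith
      · have := hFle y x hy.1 h hx.2 C hC0 fun t ht => hC t ⟨hy.1.trans ht.1, ht.2.trans hx.2⟩
        rw [Real.dist_eq, abs_of_nonneg (by linarith)]
        linarith
    exact this.continuousOn
  have hderiv : ∀ t ∈ Ioo a b, HasDerivWithinAt F ‖γ' t‖ (Ioi t) t := by
    intro t ht
    rw [hasDerivWithinAt_iff_tendsto_slope' (by simp)]
    have hmem : ∀ᶠ u in 𝓝[>] t, u ∈ Ioc t b := Ioc_mem_nhdsGT ht.2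
    refine tendsto_order.2 ⟨fun l hl => ?_, fun l hl => ?_⟩
    · have h1 : Tendsto (fun u => ‖slope γ t u‖) (𝓝[>] t) (𝓝 ‖γ' t‖) :=
        ((hasDerivWithinAt_iff_tendsto_slope' (by simp)).1 (hγ t).hasDerivWithinAt).norm
      filter_upwards [h1.eventually (lt_mem_nhds hl), hmem] with u hu hut
      refine hu.trans_le ?_
      have hpos : 0 < u - t := sub_pos.2 hut.1
      rw [slope_def_module, norm_smul, slope_def_field, norm_inv, Real.norm_eq_abs,
        abs_of_pos hpos, ← dist_eq_norm, inv_mul_eq_div]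
      exact div_le_div_of_nonneg_right (hleF t u ht.1.le hut.1.le hut.2) hpos.le
    · obtain ⟨l', hl1, hl2⟩ := exists_between hl
      have h1 : ∀ᶠ u in 𝓝 t, ‖γ' u‖ < l' :=
        hγ'.norm.continuousAt.eventually (gt_mem_nhds hl1)
      obtain ⟨δ, hδ, hball⟩ := Metric.eventually_nhds_iff.1 h1
      have h2 : ∀ᶠ u in 𝓝[>] t, u ∈ Ioo t (t + δ) := Ioo_mem_nhdsGT (by linarith)
      filter_upwards [h2, hmem] with u hu hut
      have hpos : 0 < u - t := sub_pos.2 hut.1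
      refine lt_of_le_of_lt ?_ hl2
      rw [slope_def_field, div_le_iff₀ hpos]
      refine hFle t u ht.1.le hut.1.le hut.2 l' ((norm_nonneg _).trans hl1.le) fun v hv => ?_
      refine (hball ?_).le
      rw [Real.dist_eq, abs_of_nonneg (by linarith [hv.1])]
      linarith [hv.2, hu.2]
  have hint := intervalIntegral.integral_eq_sub_of_hasDeriv_right_of_le hab hFc hderiv
    (hγ'.norm.intervalIntegrable a b)
  rw [hint]
  simp only [hF, Ioc_self, image_empty, measure_empty, ENNReal.toReal_zero, sub_zero]
  rw [ENNReal.ofReal_toReal (hfin _ _ le_rfl le_rfl)]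

/-- Measures on the line are determined by their values on half-open intervals, where the length
formula applies. Half-open intervals also allow a closed curve to be parametrized injectively over a
full period. -/
theorem comap_restrict_hausdorffMeasure (hγ : ∀ t, HasDerivAt γ (γ' t) t) (hγ' : Continuous γ')
    (hinj : InjOn γ (Ioc a b)) :
    (μH[1] : Measure Plane).comap ((Ioc a b).domRestrict γ) =
      ((volume.withDensity fun t => (‖γ' t‖₊ : ℝ≥0∞)).comap (Subtype.val : Ioc a b → ℝ)) := by
  have hc : Continuous γ := continuous_iff_continuousAt.2 fun t => (hγ t).continuousAt
  have he : MeasurableEmbedding ((Ioc a b).domRestrict γ) :=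
    hc.continuousOn.measurableEmbedding measurableSet_Ioc hinj
  have hv : MeasurableEmbedding (Subtype.val : Ioc a b → ℝ) :=
    MeasurableEmbedding.subtype_coe measurableSet_Ioc
  suffices h : ((μH[1] : Measure Plane).comap ((Ioc a b).domRestrict γ)).map Subtype.val =
      (volume.withDensity fun t => (‖γ' t‖₊ : ℝ≥0∞)).restrict (Ioc a b) by
    have h2 := congrArg (fun m => m.comap (Subtype.val : Ioc a b → ℝ)) h
    simp only [hv.comap_map] at h2
    rw [h2]
    have := hv.comap_map ((volume.withDensity fun t => (‖γ' t‖₊ : ℝ≥0∞)).comap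
      (Subtype.val : Ioc a b → ℝ))
    rw [hv.map_comap, Subtype.range_coe] at this
    exact this
  have hm : Measurable fun t => (‖γ' t‖₊ : ℝ≥0∞) := by
    have := hγ'.measurable
    fun_prop
  have hval : ∀ c d, (volume.withDensity fun t => (‖γ' t‖₊ : ℝ≥0∞)).restrict (Ioc a b) (Ioc c d) =
      ((μH[1] : Measure Plane).comap ((Ioc a b).domRestrict γ)).map Subtype.val (Ioc c d) := by
    intro c d
    rw [hv.map_apply, he.comap_apply, Measure.restrict_apply measurableSet_Ioc,
      withDensity_apply _ (measurableSet_Ioc.inter measurableSet_Ioc)]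
    have himg : (Ioc a b).domRestrict γ '' (Subtype.val ⁻¹' Ioc c d) = γ '' (Ioc c d ∩ Ioc a b) := by
      ext y
      constructor
      · rintro ⟨t, ht, rfl⟩
        exact ⟨t, ⟨ht, t.2⟩, rfl⟩
      · rintro ⟨t, ht, rfl⟩
        exact ⟨⟨t, ht.2⟩, ht.1, rfl⟩
    rw [himg, Ioc_inter_Ioc]
    rcases le_or_gt (max c a) (min d b) with h | h
    · rw [hausdorffMeasure_image_Ioc hγ hγ' h (hinj.mono (Ioc_subset_Ioc (le_max_right _ _)
        (min_le_right _ _))), intervalIntegral.integral_of_le h,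
        ofReal_integral_eq_lintegral_ofReal
          ((hγ'.norm.intervalIntegrable _ _).1) (Eventually.of_forall fun t => norm_nonneg _)]
      refine lintegral_congr fun t => ?_
      rw [ofReal_norm]
      rfl
    · rw [Ioc_eq_empty_of_le h.le]
      simp
  have : IsLocallyFiniteMeasure
      ((volume.withDensity fun t => (‖γ' t‖₊ : ℝ≥0∞)).restrict (Ioc a b)) := by
    have : IsFiniteMeasure ((volume.withDensity fun t => (‖γ' t‖₊ : ℝ≥0∞)).restrict (Ioc a b)) := by
      refine ⟨?_⟩
      rw [Measure.restrict_apply_univ, withDensity_apply _ measurableSet_Ioc]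
      exact ((hγ'.intervalIntegrable (μ := volume) a b).1).2
    infer_instance
  exact (Measure.ext_of_Ioc _ _ fun c d _ => hval c d).symm

theorem arcLength_image (hγ : ∀ t, HasDerivAt γ (γ' t) t) (hγ' : Continuous γ')
    (hinj : InjOn γ (Ioc a b)) :
    arcLength (γ '' Ioc a b) = ((volume.withDensity fun t => (‖γ' t‖₊ : ℝ≥0∞)).comap
      (Subtype.val : Ioc a b → ℝ)).map ((Ioc a b).domRestrict γ) := by
  have hc : Continuous γ := continuous_iff_continuousAt.2 fun t => (hγ t).continuousAt
  have he : MeasurableEmbedding ((Ioc a b).domRestrict γ) :=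
    hc.continuousOn.measurableEmbedding measurableSet_Ioc hinj
  rw [← comap_restrict_hausdorffMeasure hγ hγ' hinj, he.map_comap, range_domRestrict]
  rfl

/-- Integration with respect to arc length along a parametrized curve. -/
theorem integral_arcLength_image {E : Type*} [NormedAddCommGroup E] [NormedSpace ℝ E]
    (hγ : ∀ t, HasDerivAt γ (γ' t) t) (hγ' : Continuous γ')
    (hinj : InjOn γ (Ioc a b)) (f : Plane → E) :
    ∫ y, f y ∂(arcLength (γ '' Ioc a b)) = ∫ t in Ioc a b, ‖γ' t‖ • f (γ t) := by
  have hc : Continuous γ := continuous_iff_continuousAt.2 fun t => (hγ t).continuousAt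
  have he : MeasurableEmbedding ((Ioc a b).domRestrict γ) :=
    hc.continuousOn.measurableEmbedding measurableSet_Ioc hinj
  rw [arcLength_image hγ hγ' hinj, he.integral_map]
  simp only [domRestrict_apply]
  have h1 := integral_subtype_comap (μ := volume.withDensity fun t => (‖γ' t‖₊ : ℝ≥0∞))
    (measurableSet_Ioc (a := a) (b := b)) (fun t => f (γ t))
  rw [h1, restrict_withDensity measurableSet_Ioc,
    integral_withDensity_eq_integral_smul (hγ'.measurable.nnnorm)]
  rfl

theorem arcLength_image_univ (hγ : ∀ t, HasDerivAt γ (γ' t) t) (hγ' : Continuous γ')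
    (hab : a ≤ b) (hinj : InjOn γ (Ioc a b)) :
    arcLength (γ '' Ioc a b) univ = ENNReal.ofReal (∫ t in a..b, ‖γ' t‖) := by
  rw [arcLength, Measure.restrict_apply_univ, hausdorffMeasure_image_Ioc hγ hγ' hab hinj]

end Curve

/-! ### Regularity and convexity of the norm in terms of the direction. -/

section Body

variable {K : ConvexBody Plane}

/-- The norm with unit ball `K`, as a function of the direction. -/
def bodyRadius (K : ConvexBody Plane) (α : ℝ) : ℝ := bodyNorm K (unitVec α)

theorem IsSmoothCurvedBody.mem_nhds_zero (hK : IsSmoothCurvedBody K) : (K : Set Plane) ∈ 𝓝 0 := by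
  obtain ⟨v, hv⟩ := hK.interior_nonempty
  have hneg : -v ∈ interior (K : Set Plane) := by
    have h1 : -v ∈ -interior (K : Set Plane) := by simpa using hv
    have h2 : -interior (K : Set Plane) ⊆ interior (K : Set Plane) := by
      refine interior_maximal (fun w hw => ?_) isOpen_interior.neg
      have := hK.symmetric _ (interior_subset (mem_neg.1 hw))
      rwa [neg_neg] at this
    exact h2 h1
  have h := K.convex.interior hv hneg (a := 1 / 2) (b := 1 / 2) (by norm_num) (by norm_num)
    (by norm_num)
  rw [smul_neg, add_neg_cancel] at h
  exact mem_interior_iff_mem_nhds.1 h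

theorem IsSmoothCurvedBody.continuous_bodyNorm (hK : IsSmoothCurvedBody K) :
    Continuous (bodyNorm K) := continuous_gauge K.convex hK.mem_nhds_zero

theorem IsSmoothCurvedBody.bodyNorm_pos (hK : IsSmoothCurvedBody K) {y : Plane} (hy : y ≠ 0) :
    0 < bodyNorm K y :=
  (gauge_pos (absorbent_nhds_zero hK.mem_nhds_zero)
    (K.isCompact.isVonNBounded ℝ)).2 hy

theorem bodyNorm_smul {t : ℝ} (ht : 0 ≤ t) (y : Plane) : bodyNorm K (t • y) = t * bodyNorm K y := by
  rw [bodyNorm, gauge_smul_of_nonneg ht]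
  rfl

theorem IsSmoothCurvedBody.bodyNorm_neg (hK : IsSmoothCurvedBody K) (y : Plane) :
    bodyNorm K (-y) = bodyNorm K y := gauge_neg hK.symmetric y

theorem IsSmoothCurvedBody.mem_iff (hK : IsSmoothCurvedBody K) (y : Plane) :
    y ∈ (K : Set Plane) ↔ bodyNorm K y ≤ 1 := by
  rw [bodyNorm, gauge_le_one_iff_mem_closure K.convex hK.mem_nhds_zero,
    K.isCompact.isClosed.closure_eq]

theorem IsSmoothCurvedBody.mem_frontier_iff (hK : IsSmoothCurvedBody K) (y : Plane) :
    y ∈ frontier (K : Set Plane) ↔ bodyNorm K y = 1 :=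
  (gauge_eq_one_iff_mem_frontier K.convex hK.mem_nhds_zero).symm

theorem unitVec_ne_zero (α : ℝ) : unitVec α ≠ 0 := fun h => by
  have := norm_unitVec α
  rw [h, norm_zero] at this
  exact zero_ne_one this

theorem IsSmoothCurvedBody.bodyRadius_pos (hK : IsSmoothCurvedBody K) (α : ℝ) :
    0 < bodyRadius K α := hK.bodyNorm_pos (unitVec_ne_zero α)

theorem bodyNorm_polar {ρ : ℝ} (hρ : 0 ≤ ρ) (α : ℝ) :
    bodyNorm K (ρ • unitVec α) = ρ * bodyRadius K α := bodyNorm_smul hρ _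

/-- The boundary point of the body in a given direction. -/
def boundaryPoint (n : ℝ → ℝ) (α : ℝ) : Plane := (n α)⁻¹ • unitVec α

theorem IsSmoothCurvedBody.boundaryPoint_mem (hK : IsSmoothCurvedBody K) (α : ℝ) :
    boundaryPoint (bodyRadius K) α ∈ frontier (K : Set Plane) := by
  have := hK.bodyRadius_pos α
  rw [hK.mem_frontier_iff, boundaryPoint, bodyNorm_polar (by positivity), inv_mul_cancel₀ this.ne']

section LocalDefiningFunction

variable {U : Set Plane} {ρ : Plane → ℝ} {p : Plane}

theorem eq_zero_of_mem_frontier (hU : IsOpen U) (hρ : ContDiffOn ℝ ∞ ρ U)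
    (hUK : ∀ q ∈ U, q ∈ (K : Set Plane) ↔ ρ q ≤ 0) (hpU : p ∈ U)
    (hp : p ∈ frontier (K : Set Plane)) : ρ p = 0 := by
  have hpK : p ∈ (K : Set Plane) := K.isCompact.isClosed.frontier_subset hp
  refine le_antisymm ((hUK p hpU).1 hpK) (not_lt.1 fun hneg => ?_)
  have hc : ContinuousAt ρ p := hρ.continuousOn.continuousAt (hU.mem_nhds hpU)
  have : (K : Set Plane) ∈ 𝓝 p := by
    filter_upwards [hc.eventually (gt_mem_nhds hneg), hU.mem_nhds hpU] with q h1 h2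
    exact (hUK q h2).2 h1.le
  exact hp.2 (mem_interior_iff_mem_nhds.2 this)

theorem differentiableAt_of_contDiffOn (hU : IsOpen U) (hρ : ContDiffOn ℝ ∞ ρ U) (hpU : p ∈ U) :
    DifferentiableAt ℝ ρ p :=
  (hρ.contDiffAt (hU.mem_nhds hpU)).differentiableAt (by simp)

/-- The segment from `p` to `v` stays in `K`, so `ρ ≤ 0` near its start while `ρ p = 0`, and the
one-sided derivative at `p` is nonpositive. The body lies behind its tangent line. -/
theorem fderiv_le_of_mem (hU : IsOpen U) (hρ : ContDiffOn ℝ ∞ ρ U)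
    (hUK : ∀ q ∈ U, q ∈ (K : Set Plane) ↔ ρ q ≤ 0) (hpU : p ∈ U)
    (hp : p ∈ frontier (K : Set Plane)) {v : Plane} (hv : v ∈ (K : Set Plane)) :
    fderiv ℝ ρ p v ≤ fderiv ℝ ρ p p := by
  have hpK : p ∈ (K : Set Plane) := K.isCompact.isClosed.frontier_subset hp
  have h0 : HasDerivAt (fun t : ℝ => p + t • (v - p)) (v - p) 0 := by
    have := ((hasDerivAt_id (0 : ℝ)).smul_const (v - p)).const_add p
    exact this.congr_deriv (by simp)
  have h1 : HasDerivAt (fun t : ℝ => ρ (p + t • (v - p))) (fderiv ℝ ρ p (v - p)) 0 := by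
    have h2 : HasFDerivAt ρ (fderiv ℝ ρ p) (p + (0 : ℝ) • (v - p)) := by
      rw [zero_smul, add_zero]
      exact (differentiableAt_of_contDiffOn hU hρ hpU).hasFDerivAt
    exact HasFDerivAt.comp_hasDerivAt (f := fun t : ℝ => p + t • (v - p)) 0 h2 h0
  have h2 := (hasDerivWithinAt_iff_tendsto_slope' (by simp)).1
    (h1.hasDerivWithinAt (s := Ioi 0))
  have h3 : ∀ᶠ t in 𝓝[>] (0 : ℝ), slope (fun t : ℝ => ρ (p + t • (v - p))) 0 t ≤ 0 := by
    have hU' : ∀ᶠ t in 𝓝[>] (0 : ℝ), p + t • (v - p) ∈ U := by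
      refine (h0.continuousAt.eventually ?_).filter_mono nhdsWithin_le_nhds
      change ∀ᶠ y in 𝓝 (p + (0 : ℝ) • (v - p)), y ∈ U
      rw [zero_smul, add_zero]
      exact hU.mem_nhds hpU
    filter_upwards [hU', Ioo_mem_nhdsGT (show (0 : ℝ) < 1 by norm_num)] with t ht ht1
    rw [slope_def_field, zero_smul, add_zero, eq_zero_of_mem_frontier hU hρ hUK hpU hp, sub_zero,
      sub_zero]
    refine div_nonpos_of_nonpos_of_nonneg ((hUK _ ht).1 ?_) ht1.1.le
    exact K.convex.add_smul_sub_mem hpK hv ⟨ht1.1.le, ht1.2.le⟩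
  have := le_of_tendsto h2 h3
  rw [map_sub] at this
  linarith

/-- Rays from the origin cross the boundary transversally: `K` contains a positive multiple of some
vector on which the differential is positive, and `p` maximizes the differential over `K`. -/
theorem IsSmoothCurvedBody.fderiv_self_pos (hK : IsSmoothCurvedBody K) (hU : IsOpen U)
    (hρ : ContDiffOn ℝ ∞ ρ U) (hUK : ∀ q ∈ U, q ∈ (K : Set Plane) ↔ ρ q ≤ 0) (hpU : p ∈ U)
    (hp : p ∈ frontier (K : Set Plane)) (h0 : fderiv ℝ ρ p ≠ 0) : 0 < fderiv ℝ ρ p p := by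
  obtain ⟨v, hv⟩ : ∃ v, fderiv ℝ ρ p v ≠ 0 := by
    by_contra! h
    exact h0 (ContinuousLinearMap.ext h)
  obtain ⟨w, hw⟩ : ∃ w, 0 < fderiv ℝ ρ p w := by
    rcases lt_or_gt_of_ne hv with h | h
    · exact ⟨-v, by rw [map_neg]; linarith⟩
    · exact ⟨v, h⟩
  have hw0 : w ≠ 0 := fun h => by simp [h] at hw
  have hN := hK.bodyNorm_pos hw0
  have hm : (bodyNorm K w)⁻¹ • w ∈ (K : Set Plane) := by
    rw [hK.mem_iff, bodyNorm_smul (by positivity), inv_mul_cancel₀ hN.ne']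
  have h := fderiv_le_of_mem hU hρ hUK hpU hp hm
  rw [map_smul, smul_eq_mul] at h
  exact (mul_pos (inv_pos.2 hN) hw).trans_le h

end LocalDefiningFunction

theorem IsSmoothCurvedBody.continuous_bodyRadius (hK : IsSmoothCurvedBody K) :
    Continuous (bodyRadius K) := hK.continuous_bodyNorm.comp contDiff_unitVec.continuous

/-- The implicit function theorem for `ρ(s · unitVec α) = 0` at `s = 1 / n(α)`; its nondegeneracy is
the transversality of rays. Continuity of the gauge ensures that the implicit solution is the actual
boundary point. -/
theorem IsSmoothCurvedBody.contDiff_bodyRadius (hK : IsSmoothCurvedBody K) :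
    ContDiff ℝ ∞ (bodyRadius K) := by
  rw [contDiff_iff_contDiffAt]
  intro α
  set p := boundaryPoint (bodyRadius K) α with hpdef
  have hp := hK.boundaryPoint_mem α
  obtain ⟨ρ, ⟨U, hU, hpU, hρ, hUK, hne⟩, -⟩ := hK.smooth_curved p hp
  have hn := hK.bodyRadius_pos
  have hpos := hK.fderiv_self_pos hU hρ hUK hpU hp hne
  set u : ℝ × ℝ := (α, (bodyRadius K α)⁻¹) with hu
  set g : ℝ × ℝ → Plane := fun q => q.2 • unitVec q.1 with hg
  have hgs : ContDiff ℝ ∞ g := contDiff_snd.smul (contDiff_unitVec.comp contDiff_fst)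
  have hgu : g u = p := rfl
  have hρp : ContDiffAt ℝ ∞ ρ (g u) := hρ.contDiffAt (hU.mem_nhds hpU)
  set Φ : ℝ × ℝ → ℝ := fun q => ρ (g q) with hΦ
  have hΦs : ContDiffAt ℝ ∞ Φ u := ContDiffAt.comp (g := ρ) (f := g) u hρp hgs.contDiffAt
  have hpart : fderiv ℝ Φ u ∘L .inr ℝ ℝ ℝ =
      (ContinuousLinearMap.toSpanSingleton ℝ (fderiv ℝ ρ p (unitVec α))) := by
    have h1 : HasDerivAt (fun s : ℝ => Φ (α, s)) (fderiv ℝ Φ u (0, 1)) (bodyRadius K α)⁻¹ :=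
      HasFDerivAt.comp_hasDerivAt (f := fun s : ℝ => (α, s)) (bodyRadius K α)⁻¹
        (hΦs.differentiableAt (by simp)).hasFDerivAt
        ((hasDerivAt_const _ α).prodMk (hasDerivAt_id _))
    have h2 : HasDerivAt (fun s : ℝ => Φ (α, s)) (fderiv ℝ ρ p (unitVec α)) (bodyRadius K α)⁻¹ := by
      have h3 : HasDerivAt (fun s : ℝ => s • unitVec α) (unitVec α) (bodyRadius K α)⁻¹ :=
        ((hasDerivAt_id _).smul_const (unitVec α)).congr_deriv (by simp)
      exact HasFDerivAt.comp_hasDerivAt (f := fun s : ℝ => s • unitVec α) (bodyRadius K α)⁻¹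
        (differentiableAt_of_contDiffOn hU hρ hpU).hasFDerivAt h3
    ext
    simp [h1.unique h2]
  have hval : 0 < fderiv ℝ ρ p (unitVec α) := by
    have : p = (bodyRadius K α)⁻¹ • unitVec α := rfl
    rw [this, map_smul, smul_eq_mul, ← this] at hpos
    exact (pos_iff_pos_of_mul_pos hpos).1 (inv_pos.2 (hn α))
  have hinv : (fderiv ℝ Φ u ∘L .inr ℝ ℝ ℝ).IsInvertible := by
    rw [hpart]
    refine ⟨ContinuousLinearEquiv.unitsEquivAut ℝ (Units.mk0 _ hval.ne'), ?_⟩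
    ext
    simp
  have hψ := hΦs.contDiffAt_implicitFunction (by simp) hinv
  have hev := hΦs.eventually_apply_eq_iff_implicitFunction (by simp) hinv
  set ψ := hΦs.implicitFunction (by simp) hinv with hψdef
  have hcont : Tendsto (fun β => (β, (bodyRadius K β)⁻¹)) (𝓝 α) (𝓝 u) :=
    (continuous_id.prodMk (hK.continuous_bodyRadius.inv₀ fun β => (hn β).ne')).continuousAt
  have hΦu : Φ u = 0 := eq_zero_of_mem_frontier hU hρ hUK hpU hp
  have hUev : ∀ᶠ q in 𝓝 u, g q ∈ U :=
    hgs.continuous.continuousAt.eventually (hU.mem_nhds hpU)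
  have heq : ∀ᶠ β in 𝓝 α, bodyRadius K β = (ψ β)⁻¹ := by
    filter_upwards [hcont.eventually hev, hcont.eventually hUev] with β h1 h2
    have h3 : Φ (β, (bodyRadius K β)⁻¹) = Φ u := by
      rw [hΦu]
      exact eq_zero_of_mem_frontier hU hρ hUK h2 (hK.boundaryPoint_mem β)
    rw [h1.1 h3, inv_inv]
  have hψα : ψ α ≠ 0 := by
    have := heq.self_of_nhds
    intro h
    rw [h, inv_zero] at this
    exact (hn α).ne' this
  exact (hψ.inv hψα).congr_of_eventuallyEq heq

theorem hasDerivAt_unitVec' (β : ℝ) : HasDerivAt unitVec' (-unitVec β) β := by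
  have h : ∀ β, unitVec' β = unitVec (β + Real.pi / 2) := fun β => by
    ext i; fin_cases i <;> simp [unitVec, unitVec', Real.cos_add_pi_div_two, Real.sin_add_pi_div_two]
  have h1 := (hasDerivAt_unitVec (β + Real.pi / 2)).comp_add_const β (Real.pi / 2)
  have e : unitVec' (β + Real.pi / 2) = -unitVec β := by
    ext i; fin_cases i <;> simp [unitVec, unitVec', Real.cos_add_pi_div_two, Real.sin_add_pi_div_two]
  rw [e] at h1
  exact h1.congr_of_eventuallyEq (Eventually.of_forall h)

/-- The tangent `τ = n u' - n' u` satisfies `dρ(τ) = 0` along the boundary and `τ' = -(n + n'') u`,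
with `u` the unit vector and `u'` its derivative. Differentiating `dρ(τ) = 0` gives `(n + n'') dρ(u)
= n⁻² D²ρ(τ, τ)`, and both `dρ(u)` and `D²ρ(τ, τ)` are positive. -/
theorem IsSmoothCurvedBody.curvRadius_pos (hK : IsSmoothCurvedBody K) (α : ℝ) :
    0 < bodyRadius K α + deriv (deriv (bodyRadius K)) α := by
  set n := bodyRadius K
  have hns : ContDiff ℝ ∞ n := hK.contDiff_bodyRadius
  have hn := hK.bodyRadius_pos
  have hn' : ∀ β, HasDerivAt n (deriv n β) β := fun β =>
    (hns.differentiable (by simp) β).hasDerivAt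
  have hn'' : HasDerivAt (deriv n) (deriv (deriv n) α) α :=
    ((contDiff_infty_iff_deriv.1 hns).2.differentiable (by simp) α).hasDerivAt
  set p := boundaryPoint n α with hpdef
  have hp : p ∈ frontier (K : Set Plane) := hK.boundaryPoint_mem α
  obtain ⟨ρ, ⟨U, hU, hpU, hρ, hUK, hne⟩, hcurv⟩ := hK.smooth_curved p hp
  have hpos := hK.fderiv_self_pos hU hρ hUK hpU hp hne
  set τ : ℝ → Plane := fun β => n β • unitVec' β - deriv n β • unitVec β with hτ
  have hγ : ∀ β, HasDerivAt (boundaryPoint n) (((n β) ^ 2)⁻¹ • τ β) β := by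
    intro β
    have h := ((hn' β).inv (hn β).ne').smul (hasDerivAt_unitVec β)
    refine h.congr_deriv ?_
    simp only [hτ, Pi.inv_apply]
    have := (hn β).ne'
    rw [smul_sub, smul_smul, smul_smul, sub_eq_add_neg, ← neg_smul]
    congr 2 <;> field_simp
  have hτ' : HasDerivAt τ (-(n α + deriv (deriv n) α) • unitVec α) α := by
    have h := ((hn' α).smul (hasDerivAt_unitVec' α)).sub (hn''.smul (hasDerivAt_unitVec α))
    refine h.congr_deriv ?_
    module
  have hev : ∀ᶠ β in 𝓝 α, boundaryPoint n β ∈ U :=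
    (hγ α).continuousAt.eventually (hU.mem_nhds hpU)
  have hzero : ∀ᶠ β in 𝓝 α, fderiv ℝ ρ (boundaryPoint n β) (τ β) = 0 := by
    filter_upwards [eventually_eventually_nhds.2 hev] with β hβ
    have h1 : HasDerivAt (fun β => ρ (boundaryPoint n β)) _ β :=
      HasFDerivAt.comp_hasDerivAt β
        (differentiableAt_of_contDiffOn hU hρ hβ.self_of_nhds).hasFDerivAt (hγ β)
    have h2 : HasDerivAt (fun β => ρ (boundaryPoint n β)) 0 β := by
      refine (hasDerivAt_const β (0 : ℝ)).congr_of_eventuallyEq ?_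
      filter_upwards [hβ] with β' hβ'
      exact eq_zero_of_mem_frontier hU hρ hUK hβ' (hK.boundaryPoint_mem β')
    have h3 := h1.unique h2
    rw [map_smul, smul_eq_mul] at h3
    exact (mul_eq_zero.1 h3).resolve_left (inv_ne_zero (pow_ne_zero _ (hn β).ne'))
  have hD : HasFDerivAt (fderiv ℝ ρ) (fderiv ℝ (fderiv ℝ ρ) p) p :=
    (((hρ.contDiffAt (hU.mem_nhds hpU)).fderiv_right (m := ∞) (by simp)).differentiableAt
      (by simp)).hasFDerivAt
  have hDγ : HasDerivAt (fun β => fderiv ℝ ρ (boundaryPoint n β))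
      (fderiv ℝ (fderiv ℝ ρ) p (((n α) ^ 2)⁻¹ • τ α)) α := hD.comp_hasDerivAt α (hγ α)
  have h1 := hDγ.clm_apply hτ'
  have h2 : HasDerivAt (fun β => fderiv ℝ ρ (boundaryPoint n β) (τ β)) 0 α :=
    (hasDerivAt_const α (0 : ℝ)).congr_of_eventuallyEq hzero
  have h3 := h1.unique h2
  have hval : 0 < fderiv ℝ ρ p (unitVec α) := by
    have : p = (n α)⁻¹ • unitVec α := rfl
    rw [this, map_smul, smul_eq_mul, ← this] at hpos
    exact (pos_iff_pos_of_mul_pos hpos).1 (inv_pos.2 (hn α))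
  have hτ0 : τ α ≠ 0 := by
    intro h
    have hi : inner ℝ (τ α) (unitVec' α) = n α := by
      simp only [hτ, inner_plane, unitVec, unitVec', PiLp.sub_apply, PiLp.smul_apply, smul_eq_mul,
        Matrix.cons_val_zero, Matrix.cons_val_one]
      simp
      linear_combination n α * Real.sin_sq_add_cos_sq α
    rw [h, inner_zero_left] at hi
    exact (hn α).ne hi
  have hτn : 0 < ‖τ α‖ := norm_pos_iff.2 hτ0
  have hc := hcurv (‖τ α‖⁻¹ • τ α) (by rw [norm_smul, norm_inv, norm_norm, inv_mul_cancel₀ hτn.ne'])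
    (by rw [map_smul, hzero.self_of_nhds, smul_zero])
  simp only [levelCurvature, map_smul, smul_apply, smul_eq_mul] at hc
  have hc' : 0 < fderiv ℝ (fderiv ℝ ρ) p (τ α) (τ α) := by
    by_contra hle
    have : ‖τ α‖⁻¹ * (‖τ α‖⁻¹ * fderiv ℝ (fderiv ℝ ρ) p (τ α) (τ α)) / ‖fderiv ℝ ρ p‖ ≤ 0 :=
      div_nonpos_of_nonpos_of_nonneg (mul_nonpos_of_nonneg_of_nonpos (by positivity)
        (mul_nonpos_of_nonneg_of_nonpos (by positivity) (not_lt.1 hle))) (norm_nonneg _)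
    linarith
  simp only [map_smul, smul_apply, smul_eq_mul] at h3
  have h4 : 0 < ((n α) ^ 2)⁻¹ * fderiv ℝ (fderiv ℝ ρ) p (τ α) (τ α) :=
    mul_pos (inv_pos.2 (pow_pos (hn α) 2)) hc'
  have h5 : 0 < (n α + deriv (deriv n) α) * fderiv ℝ ρ p (unitVec α) := by
    change _ + -(n α + deriv (deriv n) α) * fderiv ℝ ρ p (unitVec α) = 0 at h3
    linarith
  exact (pos_iff_pos_of_mul_pos h5).2 hval

theorem unitVec_add_pi (α : ℝ) : unitVec (α + Real.pi) = -unitVec α := by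
  ext i; fin_cases i <;> simp [unitVec]

theorem IsSmoothCurvedBody.isSupport (hK : IsSmoothCurvedBody K) : IsSupport (bodyRadius K) where
  smooth := hK.contDiff_bodyRadius
  periodic α := by rw [bodyRadius, unitVec_add_pi, hK.bodyNorm_neg]; rfl
  pos := hK.bodyRadius_pos
  curv := hK.curvRadius_pos

end Body

/-! ### The curve with a given support function. -/

section SupportCurve

variable {n : ℝ → ℝ}

/-- A convex curve lies on one side of its tangents, in terms of the support function. -/
theorem IsSupport.tangent_le (hn : IsSupport n) (α β : ℝ) :
    n α * Real.cos (α - β) - deriv n α * Real.sin (α - β) ≤ n β := by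
  set F : ℝ → ℝ := fun x => n (α + x) - n α * Real.cos x - deriv n α * Real.sin x with hF
  set F' : ℝ → ℝ := fun x => deriv n (α + x) + n α * Real.sin x - deriv n α * Real.cos x with hF'
  have hFd : ∀ x, HasDerivAt F (F' x) x := fun x => by
    have h := (((hn.hasDerivAt (α + x)).comp_const_add α x).sub
      ((Real.hasDerivAt_cos x).const_mul (n α))).sub
      ((Real.hasDerivAt_sin x).const_mul (deriv n α))
    refine h.congr_deriv ?_
    simp only [hF']
    ring
  have hF'd : ∀ x, HasDerivAt F' (curvRadius n (α + x) - F x) x := fun x => by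
    have h := (((hn.hasDerivAt_deriv (α + x)).comp_const_add α x).add
      ((Real.hasDerivAt_sin x).const_mul (n α))).sub
      ((Real.hasDerivAt_cos x).const_mul (deriv n α))
    refine h.congr_deriv ?_
    simp only [hF, curvRadius]
    ring
  have hF0 : F 0 = 0 := by simp [hF]
  have hF'0 : F' 0 = 0 := by simp [hF']
  have key : ∀ x ∈ Ioc (-Real.pi) (-Real.pi + 2 * Real.pi), 0 ≤ F x := by
    intro x hx
    -- Variation of constants for `F'' + F = curvRadius n (α + ·)` with zero initial data: `W` goes
    -- from `0` at `t = 0` to `F x` at `t = x`, and its derivative has the sign of `sin (x - t)`,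
    -- which is constant for `|x| ≤ π`.
    set W : ℝ → ℝ := fun t => F' t * Real.sin (x - t) + F t * Real.cos (x - t) with hW
    have hWd : ∀ t, HasDerivAt W (curvRadius n (α + t) * Real.sin (x - t)) t := fun t => by
      have h1 : HasDerivAt (fun t => x - t) (-1) t := (hasDerivAt_id t).const_sub x
      have h := ((hF'd t).mul h1.sin).add ((hFd t).mul h1.cos)
      refine h.congr_deriv ?_
      ring
    have hW0 : W 0 = 0 := by simp [hW, hF0, hF'0]
    have hWx : W x = F x := by simp [hW]
    have hWc : Continuous W := continuous_iff_continuousAt.2 fun t => (hWd t).continuousAt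
    rcases le_total 0 x with h | h
    · have hm : MonotoneOn W (Icc 0 x) := monotoneOn_of_deriv_nonneg (convex_Icc _ _)
        hWc.continuousOn (fun t _ => (hWd t).differentiableAt.differentiableWithinAt) fun t ht => by
          rw [interior_Icc] at ht
          rw [(hWd t).deriv]
          exact mul_nonneg (hn.curvRadius_pos _).le
            (Real.sin_nonneg_of_nonneg_of_le_pi (by linarith [ht.2]) (by linarith [ht.1, hx.2]))
      have := hm ⟨le_rfl, h⟩ ⟨h, le_rfl⟩ h
      rwa [hW0, hWx] at this
    · have hm : AntitoneOn W (Icc x 0) := antitoneOn_of_deriv_nonpos (convex_Icc _ _)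
        hWc.continuousOn (fun t _ => (hWd t).differentiableAt.differentiableWithinAt) fun t ht => by
          rw [interior_Icc] at ht
          rw [(hWd t).deriv]
          exact mul_nonpos_of_nonneg_of_nonpos (hn.curvRadius_pos _).le
            (Real.sin_nonpos_of_nonpos_of_neg_pi_le (by linarith [ht.1])
              (by linarith [ht.2, hx.1]))
      have := hm ⟨le_rfl, h⟩ ⟨h, le_rfl⟩ h
      rwa [hW0, hWx] at this
  have hper : Function.Periodic F (2 * Real.pi) := fun x => by
    simp only [hF, ← add_assoc, IsSupport.two_pi_of_pi hn.periodic, Real.cos_add_two_pi,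
      Real.sin_add_two_pi]
  obtain ⟨y, hy, hxy⟩ := hper.exists_mem_Ioc Real.two_pi_pos (β - α) (-Real.pi)
  have h := key y hy
  rw [← hxy] at h
  simp only [hF, add_sub_cancel] at h
  have e1 : Real.cos (α - β) = Real.cos (β - α) := by rw [← Real.cos_neg, neg_sub]
  have e2 : Real.sin (α - β) = -Real.sin (β - α) := by rw [← Real.sin_neg, neg_sub]
  rw [e1, e2]
  linarith

/-- The polar angle of the point of the support curve with outer normal at angle `α`. -/
def supportAngle (n : ℝ → ℝ) (α : ℝ) : ℝ := α + Real.arctan (deriv n α / n α)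

/-- The polar radius of the point of the support curve with outer normal at angle `α`. -/
def supportRadius (n : ℝ → ℝ) (α : ℝ) : ℝ := √(n α ^ 2 + deriv n α ^ 2)

theorem IsSupport.supportRadius_pos (hn : IsSupport n) (α : ℝ) : 0 < supportRadius n α := by
  have := hn.pos α
  exact Real.sqrt_pos.2 (by positivity)

theorem IsSupport.supportPoint_eq_polar (hn : IsSupport n) (α : ℝ) :
    supportPoint n α = supportRadius n α • unitVec (supportAngle n α) := by
  have h0 := hn.pos α
  have hs : √(1 + (deriv n α / n α) ^ 2) = supportRadius n α / n α := by
    rw [supportRadius, ← Real.sqrt_sq h0.le, ← Real.sqrt_div (by positivity), Real.sqrt_sq h0.le]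
    congr 1
    field_simp
  have hr := hn.supportRadius_pos α
  have hc : supportRadius n α * Real.cos (Real.arctan (deriv n α / n α)) = n α := by
    rw [Real.cos_arctan, hs]
    field_simp
  have hsn : supportRadius n α * Real.sin (Real.arctan (deriv n α / n α)) = deriv n α := by
    rw [Real.sin_arctan, hs]
    field_simp
  ext i
  fin_cases i
  · simp [supportPoint, unitVec, unitVec', supportAngle, Real.cos_add]
    linear_combination (-Real.cos α) * hc + Real.sin α * hsn
  · simp [supportPoint, unitVec, unitVec', supportAngle, Real.sin_add]
    linear_combination (-Real.sin α) * hc - Real.cos α * hsn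

theorem IsSupport.norm_supportPoint (hn : IsSupport n) (α : ℝ) :
    ‖supportPoint n α‖ = supportRadius n α := by
  rw [hn.supportPoint_eq_polar, norm_polar (hn.supportRadius_pos α).le]

theorem IsSupport.supportAngle_smooth (hn : IsSupport n) : ContDiff ℝ ∞ (supportAngle n) :=
  contDiff_id.add ((hn.deriv_smooth.div hn.smooth fun α => (hn.pos α).ne').arctan)

/-- Positivity of this derivative makes the polar angle a smooth coordinate on the dual curve, so
that functions of the normal become smooth functions of position. -/
theorem IsSupport.hasDerivAt_supportAngle (hn : IsSupport n) (α : ℝ) :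
    HasDerivAt (supportAngle n) (n α * curvRadius n α / (n α ^ 2 + deriv n α ^ 2)) α := by
  have h0 := hn.pos α
  have h := (hasDerivAt_id α).add ((hn.hasDerivAt_deriv α).div (hn.hasDerivAt α) h0.ne').arctan
  refine h.congr_deriv ?_
  simp only [Pi.div_apply, curvRadius]
  have : n α ^ 2 + deriv n α ^ 2 ≠ 0 := by positivity
  have h3 : 1 + (deriv n α / n α) ^ 2 ≠ 0 := by positivity
  field_simp
  ring

theorem IsSupport.supportAngle_deriv_pos (hn : IsSupport n) (α : ℝ) :
    0 < n α * curvRadius n α / (n α ^ 2 + deriv n α ^ 2) := by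
  have h0 := hn.pos α
  have := hn.curvRadius_pos α
  positivity

theorem IsSupport.supportAngle_strictMono (hn : IsSupport n) : StrictMono (supportAngle n) :=
  strictMono_of_deriv_pos fun α => by
    rw [(hn.hasDerivAt_supportAngle α).deriv]
    exact hn.supportAngle_deriv_pos α

theorem IsSupport.supportAngle_add_two_pi_mul (hn : IsSupport n) (α : ℝ) (k : ℤ) :
    supportAngle n (α + k * (2 * Real.pi)) = supportAngle n α + k * (2 * Real.pi) := by
  have h1 : Function.Periodic n (2 * Real.pi) := IsSupport.two_pi_of_pi hn.periodic
  have h2 : Function.Periodic (deriv n) (2 * Real.pi) := IsSupport.two_pi_of_pi hn.deriv_periodic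
  simp only [supportAngle, h1.int_mul k α, h2.int_mul k α]
  ring

theorem IsSupport.supportAngle_surjective (hn : IsSupport n) :
    Function.Surjective (supportAngle n) := by
  have hpi := Real.pi_pos
  have h1 : ∀ α, α - Real.pi ≤ supportAngle n α := fun α => by
    have := Real.neg_pi_div_two_lt_arctan (deriv n α / n α)
    simp only [supportAngle]
    linarith
  have h2 : ∀ α, supportAngle n α ≤ α + Real.pi := fun α => by
    have := Real.arctan_lt_pi_div_two (deriv n α / n α)
    simp only [supportAngle]
    linarith
  exact hn.supportAngle_smooth.continuous.surjective
    (tendsto_atTop_mono h1 (tendsto_atTop_add_const_right _ _ tendsto_id))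
    (tendsto_atBot_mono h2 (tendsto_atBot_add_const_right _ _ tendsto_id))

/-- The polar angle of the support curve as a homeomorphism of the line. -/
def IsSupport.angleHomeo (hn : IsSupport n) : ℝ ≃ₜ ℝ :=
  (hn.supportAngle_strictMono.orderIsoOfSurjective _ hn.supportAngle_surjective).toHomeomorph

theorem IsSupport.angleHomeo_apply (hn : IsSupport n) (α : ℝ) :
    hn.angleHomeo α = supportAngle n α := rfl

theorem IsSupport.angleHomeo_symm_apply (hn : IsSupport n) (α : ℝ) :
    hn.angleHomeo.symm (supportAngle n α) = α := by
  rw [← hn.angleHomeo_apply, Homeomorph.symm_apply_apply]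

theorem IsSupport.contDiff_angleHomeo_symm (hn : IsSupport n) :
    ContDiff ℝ ∞ hn.angleHomeo.symm :=
  hn.angleHomeo.contDiff_symm_deriv (fun α => (hn.supportAngle_deriv_pos α).ne')
    hn.hasDerivAt_supportAngle hn.supportAngle_smooth

theorem IsSupport.angleHomeo_symm_add (hn : IsSupport n) (t : ℝ) :
    hn.angleHomeo.symm (t + 2 * Real.pi) = hn.angleHomeo.symm t + 2 * Real.pi := by
  obtain ⟨α, rfl⟩ := hn.supportAngle_surjective t
  have h := hn.supportAngle_add_two_pi_mul α 1
  rw [Int.cast_one, one_mul] at h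
  rw [← h, hn.angleHomeo_symm_apply, hn.angleHomeo_symm_apply]

theorem IsSupport.supportPoint_periodic (hn : IsSupport n) :
    Function.Periodic (supportPoint n) (2 * Real.pi) := fun α => by
  simp only [supportPoint, IsSupport.two_pi_of_pi hn.periodic,
    IsSupport.two_pi_of_pi hn.deriv_periodic]
  congr 2 <;> (ext i; fin_cases i <;> simp [unitVec, unitVec'])

theorem IsSupport.supportPoint_add_pi (hn : IsSupport n) (α : ℝ) :
    supportPoint n (α + Real.pi) = -supportPoint n α := by
  simp only [supportPoint, hn.periodic, hn.deriv_periodic]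
  ext i; fin_cases i <;> simp [unitVec, unitVec'] <;> ring

theorem unitVec_eq_imp {θ ψ : ℝ} (h : unitVec θ = unitVec ψ) :
    ∃ k : ℤ, θ - ψ = 2 * Real.pi * k := by
  refine Real.Angle.angle_eq_iff_two_pi_dvd_sub.1 (Real.Angle.cos_sin_inj ?_ ?_)
  · simpa [unitVec] using congrArg (fun v : Plane => v 0) h
  · simpa [unitVec] using congrArg (fun v : Plane => v 1) h

theorem eq_of_mem_Ioc_of_sub_eq {α β : ℝ} {k : ℤ} (hα : α ∈ Ioc (-Real.pi) Real.pi)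
    (hβ : β ∈ Ioc (-Real.pi) Real.pi) (h : α = β + k * (2 * Real.pi)) : α = β := by
  have hpi := Real.pi_pos
  have h1 : (k : ℝ) < 1 := by nlinarith [hα.2, hβ.1]
  have h2 : (-1 : ℝ) < k := by nlinarith [hα.1, hβ.2]
  have h3 : k = 0 := by
    have : k < 1 := by exact_mod_cast h1
    have : -1 < k := by exact_mod_cast h2
    omega
  rw [h, h3]
  simp

theorem IsSupport.supportPoint_injOn (hn : IsSupport n) :
    InjOn (supportPoint n) (Ioc (-Real.pi) Real.pi) := by
  intro α hα β hβ h
  have hr : supportRadius n α = supportRadius n β := by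
    rw [← hn.norm_supportPoint, h, hn.norm_supportPoint]
  have hu : unitVec (supportAngle n α) = unitVec (supportAngle n β) := by
    rw [hn.supportPoint_eq_polar, hn.supportPoint_eq_polar, hr] at h
    exact smul_right_injective _ (hn.supportRadius_pos β).ne' h
  obtain ⟨k, hk⟩ := unitVec_eq_imp hu
  refine eq_of_mem_Ioc_of_sub_eq (k := k) hα hβ (hn.supportAngle_strictMono.injective ?_)
  rw [hn.supportAngle_add_two_pi_mul]
  linarith

theorem IsSupport.hasDerivAt_supportPoint (hn : IsSupport n) (α : ℝ) :
    HasDerivAt (supportPoint n) (curvRadius n α • unitVec' α) α := by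
  have h := ((hn.hasDerivAt α).smul (hasDerivAt_unitVec α)).add
    ((hn.hasDerivAt_deriv α).smul (hasDerivAt_unitVec' α))
  refine h.congr_deriv ?_
  simp only [curvRadius]
  module

theorem norm_unitVec' (α : ℝ) : ‖unitVec' α‖ = 1 := by
  rw [EuclideanSpace.norm_eq, Fin.sum_univ_two]
  simp [unitVec']

theorem exists_cutoff_near_zero {c : ℝ} (hc : 0 < c) : ∃ τ : Plane → ℝ, ContDiff ℝ ∞ τ ∧
    (0 : Plane) ∉ tsupport τ ∧ (∀ y, 0 ≤ τ y) ∧ ∀ y, c ≤ ‖y‖ → τ y = 1 := by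
  refine ⟨fun y => Real.smoothTransition (2 * (‖y‖ / c) ^ 2 - 1), ?_, ?_, ?_, ?_⟩
  · have : ∀ y : Plane, 2 * (‖y‖ / c) ^ 2 - 1 = 2 / c ^ 2 * ‖y‖ ^ 2 - 1 := fun y => by
      field_simp
    simp_rw [this]
    exact Real.smoothTransition.contDiff.comp
      ((contDiff_const.mul (contDiff_norm_sq ℝ)).sub contDiff_const)
  · rw [notMem_tsupport_iff_eventuallyEq]
    filter_upwards [Metric.ball_mem_nhds (0 : Plane) (half_pos hc)] with y hy
    have h1 : ‖y‖ < c / 2 := by simpa using hy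
    have h2 : ‖y‖ / c ≤ 1 / 2 := by rw [div_le_iff₀ hc]; linarith
    have h3 : 0 ≤ ‖y‖ / c := by positivity
    exact Real.smoothTransition.zero_of_nonpos (by nlinarith)
  · exact fun y => Real.smoothTransition.nonneg _
  · intro y hy
    have h2 : 1 ≤ ‖y‖ / c := by rwa [le_div_iff₀ hc, one_mul]
    exact Real.smoothTransition.one_of_one_le (by nlinarith)

theorem exists_cutoff_annulus {c R : ℝ} (hc : 0 < c) (hR : 0 < R) : ∃ ψ : Plane → ℝ,
    ContDiff ℝ ∞ ψ ∧ HasCompactSupport ψ ∧ (0 : Plane) ∉ tsupport ψ ∧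
      ∀ y, c ≤ ‖y‖ → ‖y‖ ≤ R → ψ y = 1 := by
  obtain ⟨τ, hτ, h0, -, h1⟩ := exists_cutoff_near_zero hc
  let κ : ContDiffBump (0 : Plane) := ⟨R, 2 * R, hR, by linarith⟩
  refine ⟨fun y => κ y * τ y, κ.contDiff.mul hτ, κ.hasCompactSupport.mul_right, fun h => h0 ?_, ?_⟩
  · exact tsupport_mul_subset_right h
  · intro y hy hyR
    simp only [h1 y hy, mul_one]
    exact κ.one_of_mem_closedBall (by simpa using hyR)

/-- The density with respect to arc length of the measure with Fourier transform `sigHat`. -/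
theorem IsSupport.exists_density (hn : IsSupport n) : ∃ g : Plane → ℝ, ContDiff ℝ ∞ g ∧
    (∀ y, 0 ≤ g y) ∧ ∀ α, curvRadius n α * g (supportPoint n α) = angDensity n α := by
  obtain ⟨c, hc, hcn⟩ := exists_pos_le_of_periodic hn.smooth.continuous hn.periodic hn.pos
  obtain ⟨τ, hτ, h0, hτ0, h1⟩ := exists_cutoff_near_zero hc
  set h : ℝ → ℝ := fun α => angDensity n α / curvRadius n α with hh
  have hhs : ContDiff ℝ ∞ h := hn.angDensity_smooth.div hn.curvRadius_smooth
    fun α => (hn.curvRadius_pos α).ne'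
  have hhp : ∀ α, h (α + 2 * Real.pi) = h α := IsSupport.two_pi_of_pi fun α => by
    simp only [hh, hn.angDensity_periodic, hn.curvRadius_periodic]
  -- The density as a function of the polar angle. It extends to the plane as a function homogeneous
  -- of degree `0`, cut off near the origin; the curve stays at distance at least `min n` from
  -- there.
  set q : ℝ → ℝ := fun t => h (hn.angleHomeo.symm t) with hq
  have hqs : ContDiff ℝ ∞ q := hhs.comp hn.contDiff_angleHomeo_symm
  have hqp : ∀ t, q (t + 2 * Real.pi) = q t := fun t => by
    simp only [hq, hn.angleHomeo_symm_add, hhp]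
  refine ⟨fun y => τ y * q (angle y), ?_, fun y => ?_, fun α => ?_⟩
  · rw [contDiff_iff_contDiffAt]
    intro y
    rcases eq_or_ne y 0 with rfl | hy
    · have : (fun y : Plane => τ y * q (angle y)) =ᶠ[𝓝 0] fun _ => 0 := by
        filter_upwards [notMem_tsupport_iff_eventuallyEq.1 h0] with w hw
        simp only [Pi.zero_apply] at hw
        rw [hw, zero_mul]
      exact contDiffAt_const.congr_of_eventuallyEq this
    · exact hτ.contDiffAt.mul (contDiffAt_comp_angle hqs hqp hy)
  · exact mul_nonneg (hτ0 y) (div_pos (hn.angDensity_pos _) (hn.curvRadius_pos _)).le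
  · have hr := hn.supportRadius_pos α
    have hcr : c ≤ supportRadius n α :=
      (hcn α).trans (Real.le_sqrt_of_sq_le (le_add_of_nonneg_right (sq_nonneg _)))
    simp only
    rw [h1 _ (by rwa [hn.norm_supportPoint]), one_mul, hn.supportPoint_eq_polar,
      angle_polar hqp hr]
    simp only [hq, hn.angleHomeo_symm_apply, hh]
    have := (hn.curvRadius_pos α).ne'
    field_simp

end SupportCurve

/-! ### The dual unit circle and the measure on it. -/

section DualCircle

variable {K : ConvexBody Plane}

theorem IsSmoothCurvedBody.inner_supportPoint_le (hK : IsSmoothCurvedBody K) (α : ℝ) (v : Plane) :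
    inner ℝ (supportPoint (bodyRadius K) α) v ≤ bodyNorm K v := by
  rw [← norm_smul_unitVec_angle v, inner_supportPoint, bodyNorm_polar (norm_nonneg _)]
  exact mul_le_mul_of_nonneg_left (hK.isSupport.tangent_le _ _) (norm_nonneg _)

/-- The supremum is attained at the boundary point of `K` in the direction of the normal;
`inner_supportPoint_le` is the upper bound. -/
theorem IsSmoothCurvedBody.dualNorm_smul_supportPoint (hK : IsSmoothCurvedBody K) {c : ℝ}
    (hc : 0 ≤ c) (α : ℝ) : dualNorm K (c • supportPoint (bodyRadius K) α) = c := by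
  refine IsGreatest.csSup_eq ⟨⟨boundaryPoint (bodyRadius K) α, ?_, ?_⟩, ?_⟩
  · exact K.isCompact.isClosed.frontier_subset (hK.boundaryPoint_mem α)
  · simp only
    have := (hK.bodyRadius_pos α).ne'
    rw [inner_smul_left, boundaryPoint, inner_supportPoint]
    simp [this]
  · rintro _ ⟨v, hv, rfl⟩
    simp only
    rw [inner_smul_left]
    have := (hK.inner_supportPoint_le α v).trans ((hK.mem_iff v).1 hv)
    simpa using mul_le_mul_of_nonneg_left this hc

/-- Every vector is a nonnegative multiple of the support point with the same polar angle, and the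
multiple is its dual norm. -/
theorem IsSmoothCurvedBody.dualUnitCircle_eq (hK : IsSmoothCurvedBody K) :
    dualUnitCircle K = supportPoint (bodyRadius K) '' Ioc (-Real.pi) Real.pi := by
  have hn := hK.isSupport
  ext w
  constructor
  · intro hw
    have hw : dualNorm K w = 1 := hw
    obtain ⟨α, hα⟩ := hn.supportAngle_surjective (angle w)
    have hr := hn.supportRadius_pos α
    have e : w = (‖w‖ / supportRadius (bodyRadius K) α) • supportPoint (bodyRadius K) α := by
      rw [hn.supportPoint_eq_polar, smul_smul, div_mul_cancel₀ _ hr.ne', hα,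
        norm_smul_unitVec_angle]
    rw [e, hK.dualNorm_smul_supportPoint (by positivity)] at hw
    rw [hw, one_smul] at e
    obtain ⟨β, hβ, hβα⟩ := hn.supportPoint_periodic.exists_mem_Ioc Real.two_pi_pos α (-Real.pi)
    refine ⟨β, ?_, by rw [← hβα, ← e]⟩
    rwa [show -Real.pi + 2 * Real.pi = Real.pi by ring] at hβ
  · rintro ⟨α, -, rfl⟩
    have := hK.dualNorm_smul_supportPoint zero_le_one α
    rwa [one_smul] at this

/-- A smooth measure on the dual unit circle whose dilates have the Fourier transform `sigHat`. -/
theorem IsSmoothCurvedBody.exists_dual_measure (hK : IsSmoothCurvedBody K) :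
    ∃ σ : SignedMeasure Plane, IsSmoothMeasureOn (dualUnitCircle K) σ ∧
      ∀ r, 0 < r → ∀ ξ, fourierMeasure (dilate σ r) ξ = sigHat (bodyRadius K) (r • ξ) := by
  have hn := hK.isSupport
  set n := bodyRadius K
  obtain ⟨g, hg, hg0, hgd⟩ := hn.exists_density
  set Γ := dualUnitCircle K with hΓ
  have hγ' : Continuous fun α => curvRadius n α • unitVec' α :=
    hn.curvRadius_smooth.continuous.smul contDiff_unitVec'.continuous
  have hΓe : Γ = supportPoint n '' Ioc (-Real.pi) Real.pi := hK.dualUnitCircle_eq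
  have hfin : IsFiniteMeasure (arcLength Γ) := by
    refine ⟨?_⟩
    rw [hΓe, arcLength_image_univ hn.hasDerivAt_supportPoint hγ' (by linarith [Real.pi_pos])
      hn.supportPoint_injOn]
    exact ENNReal.ofReal_lt_top
  have hmeas : MeasurableSet Γ := by
    rw [hΓe]
    exact measurableSet_Ioc.image_of_continuousOn_injOn
      hn.contDiff_supportPoint.continuous.continuousOn hn.supportPoint_injOn
  obtain ⟨B, hB⟩ : ∃ B, ∀ y ∈ Γ, ‖g y‖ ≤ B := by
    have hc : IsCompact (supportPoint n '' Icc (-Real.pi) Real.pi) :=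
      isCompact_Icc.image hn.contDiff_supportPoint.continuous
    obtain ⟨B, hB⟩ := hc.exists_bound_of_continuousOn hg.continuous.continuousOn
    exact ⟨B, fun y hy => hB y (image_mono Ioc_subset_Icc_self (hΓe ▸ hy))⟩
  have hint : Integrable g (arcLength Γ) := by
    refine Integrable.of_bound hg.continuous.aestronglyMeasurable B ?_
    rw [arcLength, ae_restrict_iff' hmeas]
    exact Eventually.of_forall hB
  refine ⟨(arcLength Γ).withDensityᵥ g, ⟨g, hg, hint, rfl⟩, fun r hr ξ => ?_⟩
  have hgm : Measurable fun y => ENNReal.ofReal (g y) := hg.continuous.measurable.ennreal_ofReal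
  have hlt : ∫⁻ y, ENNReal.ofReal (g y) ∂(arcLength Γ) ≠ ⊤ := hint.lintegral_lt_top.ne
  -- The density constructed here is nonnegative, so the signed measure comes from a finite positive
  -- one and its integrals are ordinary integrals.
  have hσ : (arcLength Γ).withDensityᵥ g =
      @Measure.toSignedMeasure _ _ ((arcLength Γ).withDensity fun y => ENNReal.ofReal (g y))
        (isFiniteMeasure_withDensity hlt) := by
    rw [← withDensityᵥ_toReal hgm.aemeasurable hlt]
    congr 1
    ext y
    rw [ENNReal.toReal_ofReal (hg0 y)]
  have hfinσ := isFiniteMeasure_withDensity hlt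
  have hemb : MeasurableEmbedding fun θ : Plane => r • θ :=
    (Homeomorph.smulOfNeZero r hr.ne').measurableEmbedding
  rw [fourierMeasure, dilate, hemb.integral_map_vectorMeasure, hσ,
    VectorMeasure.integral_toSignedMeasure]
  have hw : (fun y => ENNReal.ofReal (g y)) = fun y => ((g y).toNNReal : ℝ≥0∞) := rfl
  rw [hw, integral_withDensity_eq_integral_smul hg.continuous.measurable.real_toNNReal, hΓe,
    integral_arcLength_image hn.hasDerivAt_supportPoint hγ' hn.supportPoint_injOn,
    ← intervalIntegral.integral_of_le (by linarith [Real.pi_pos])]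
  set y := r • ξ with hy
  set c : ℝ → ℝ := fun α => angDensity n α *
    Real.cos (2 * Real.pi * inner ℝ (supportPoint n α) y) with hc
  set s : ℝ → ℝ := fun α => angDensity n α *
    Real.sin (2 * Real.pi * inner ℝ (supportPoint n α) y) with hs
  have hpc : Continuous (supportPoint n) := hn.contDiff_supportPoint.continuous
  have had : Continuous (angDensity n) := hn.angDensity_smooth.continuous
  have hcc : Continuous c := by fun_prop
  have hsc : Continuous s := by fun_prop
  have hpt : ∀ α, ‖curvRadius n α • unitVec' α‖ • (g (supportPoint n α)).toNNReal •
      cexp (-(2 * Real.pi * inner ℝ (r • supportPoint n α) ξ : ℝ) * I) =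
      (c α : ℂ) - (s α : ℂ) * I := by
    intro α
    have h1 : inner ℝ (r • supportPoint n α) ξ = inner ℝ (supportPoint n α) y := by
      rw [hy, inner_smul_left, inner_smul_right]; rfl
    rw [h1, norm_smul, norm_unitVec', mul_one, Real.norm_eq_abs, abs_of_pos (hn.curvRadius_pos α),
      NNReal.smul_def, Real.coe_toNNReal _ (hg0 _), smul_smul, hgd, ← ofReal_neg,
      Complex.exp_mul_I, ← ofReal_cos, ← ofReal_sin, Real.cos_neg, Real.sin_neg, Complex.real_smul]
    simp only [hc, hs]
    push_cast
    ring
  -- The measure is invariant under `θ ↦ -θ`, so its Fourier transform is real.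
  have hs0 : ∫ α in (-Real.pi)..Real.pi, s α = 0 := by
    have hodd : ∀ α, s (α + Real.pi) = -s α := fun α => by
      simp only [hs, hn.angDensity_periodic, hn.supportPoint_add_pi, inner_neg_left, mul_neg,
        Real.sin_neg]
    rw [← intervalIntegral.integral_add_adjacent_intervals (b := 0) (hsc.intervalIntegrable _ _)
      (hsc.intervalIntegrable _ _)]
    have h := intervalIntegral.integral_comp_add_right (a := -Real.pi) (b := 0) s Real.pi
    rw [neg_add_cancel, zero_add] at h
    rw [← h]
    simp_rw [hodd]
    rw [intervalIntegral.integral_neg, add_neg_cancel]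
  simp_rw [hpt]
  rw [intervalIntegral.integral_sub ((by fun_prop : Continuous fun α => (c α : ℂ)).intervalIntegrable
    _ _) ((by fun_prop : Continuous fun α => (s α : ℂ) * I).intervalIntegrable _ _),
    intervalIntegral.integral_mul_const, intervalIntegral.integral_ofReal,
    intervalIntegral.integral_ofReal, hs0, ofReal_zero, zero_mul, sub_zero]
  rfl

end DualCircle

/-! ### Polar coordinates adapted to `K`. -/

section Polar

theorem lintegral_plane_polar {h : Plane → ℝ≥0∞} (hh : Measurable h) :
    ∫⁻ y, h y = ∫⁻ α in Ioo (-Real.pi) Real.pi, ∫⁻ s in Ioi (0 : ℝ),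
      ENNReal.ofReal s * h (s • unitVec α) := by
  have hmp : MeasurePreserving (fun y : Plane => ((y 0, y 1) : ℝ × ℝ)) :=
    (volume_preserving_finTwoArrow ℝ).comp (PiLp.volume_preserving_ofLp (Fin 2))
  have hm2 : Measurable fun q : ℝ × ℝ => (!₂[q.1, q.2] : Plane) := by
    have : Continuous fun q : ℝ × ℝ => (!₂[q.1, q.2] : Plane) := by
      refine (PiLp.continuous_toLp 2 _).comp (continuous_pi fun i => ?_)
      fin_cases i
      · exact continuous_fst
      · exact continuous_snd
    exact this.measurable
  have h1 := hmp.lintegral_comp (f := fun q => h !₂[q.1, q.2]) (hh.comp hm2)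
  have e : ∀ y : Plane, (!₂[y 0, y 1] : Plane) = y := fun y => by
    ext i; fin_cases i <;> rfl
  simp only [e] at h1
  rw [h1, ← lintegral_comp_polarCoord_symm]
  have e2 : ∀ p : ℝ × ℝ, (!₂[(polarCoord.symm p).1, (polarCoord.symm p).2] : Plane) =
      p.1 • unitVec p.2 := fun p => by
    ext i; fin_cases i <;> simp [unitVec]
  simp only [e2, smul_eq_mul]
  have hu : Measurable fun p : ℝ × ℝ => p.1 • unitVec p.2 := by
    have : Continuous fun p : ℝ × ℝ => p.1 • unitVec p.2 :=
      continuous_fst.smul (contDiff_unitVec.continuous.comp continuous_snd)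
    exact this.measurable
  have hm : Measurable fun p : ℝ × ℝ => ENNReal.ofReal p.1 * h (p.1 • unitVec p.2) :=
    measurable_fst.ennreal_ofReal.mul (hh.comp hu)
  change ∫⁻ p in Ioi (0 : ℝ) ×ˢ Ioo (-Real.pi) Real.pi, _ = _
  rw [Measure.volume_eq_prod, ← Measure.prod_restrict, lintegral_prod_symm _ hm.aemeasurable]

theorem lintegral_Ioi_comp_div {c : ℝ} (hc : 0 < c) (F : ℝ → ℝ≥0∞) :
    ∫⁻ s in Ioi (0 : ℝ), F s = ∫⁻ s in Ioi (0 : ℝ), ENNReal.ofReal (1 / c) * F (s / c) := by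
  have h := lintegral_image_eq_lintegral_abs_deriv_mul (f := fun s : ℝ => s / c)
    (f' := fun _ => 1 / c) (measurableSet_Ioi (a := (0 : ℝ)))
    (fun x _ => ((hasDerivAt_id x).div_const c).hasDerivWithinAt)
    (fun x _ y _ hxy => by simpa [hc.ne'] using hxy) F
  have himg : (fun s : ℝ => s / c) '' Ioi 0 = Ioi 0 := by
    ext s
    constructor
    · rintro ⟨t, ht, rfl⟩
      exact div_pos ht hc
    · intro hs
      exact ⟨s * c, mul_pos hs hc, by field_simp⟩
  rw [himg, abs_of_pos (by positivity)] at h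
  exact h

variable {n : ℝ → ℝ}

/-- The density of Lebesgue measure in the coordinates `(s, α) ↦ s • boundaryPoint n α`. -/
def polarDensity (n : ℝ → ℝ) (p : ℝ × ℝ) : ℝ≥0 := (p.1 / n p.2 ^ 2).toNNReal

/-- Lebesgue measure in the coordinates `(s, α) ↦ s • boundaryPoint n α`. -/
def polarMeasure (n : ℝ → ℝ) : Measure (ℝ × ℝ) :=
  ((volume.restrict (Ioi (0 : ℝ))).prod (volume.restrict (Ioo (-Real.pi) Real.pi))).withDensity
    fun p => (polarDensity n p : ℝ≥0∞)

theorem IsSupport.continuous_boundaryPoint (hn : IsSupport n) : Continuous (boundaryPoint n) :=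
  (hn.smooth.continuous.inv₀ fun α => (hn.pos α).ne').smul contDiff_unitVec.continuous

theorem IsSupport.measurable_polarDensity (hn : IsSupport n) : Measurable (polarDensity n) := by
  have := hn.smooth.continuous.measurable
  unfold polarDensity
  fun_prop

/-- Euclidean polar coordinates with radius `s / n(α)`: the area element becomes `(s / n(α)²) ds
dα`. -/
theorem IsSupport.measurePreserving_polar (hn : IsSupport n) :
    MeasurePreserving (fun p : ℝ × ℝ => p.1 • boundaryPoint n p.2) (polarMeasure n) volume := by
  have hc : Continuous fun p : ℝ × ℝ => p.1 • boundaryPoint n p.2 :=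
    continuous_fst.smul (hn.continuous_boundaryPoint.comp continuous_snd)
  refine ⟨hc.measurable, ?_⟩
  ext A hA
  have hpre := hc.measurable hA
  have hmd : Measurable fun p => (polarDensity n p : ℝ≥0∞) := hn.measurable_polarDensity.coe_nnreal_ennreal
  rw [Measure.map_apply hc.measurable hA, polarMeasure, withDensity_apply _ hpre,
    ← lintegral_indicator hpre, ← lintegral_indicator_one hA,
    lintegral_plane_polar (measurable_one.indicator hA),
    lintegral_prod_symm _ (hmd.indicator hpre).aemeasurable]
  refine lintegral_congr fun α => ?_
  have h0 := hn.pos α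
  rw [lintegral_Ioi_comp_div h0 fun s => ENNReal.ofReal s * A.indicator 1 (s • unitVec α)]
  refine setLIntegral_congr_fun measurableSet_Ioi fun s hs => ?_
  have hs : 0 < s := hs
  have e : s • boundaryPoint n α = (s / n α) • unitVec α := by
    rw [boundaryPoint, smul_smul, div_eq_mul_inv]
  by_cases hA' : (s / n α) • unitVec α ∈ A
  · rw [indicator_of_mem (by simpa [e] using hA'), indicator_of_mem hA', Pi.one_apply, mul_one,
      ← ENNReal.ofReal_mul (by positivity)]
    change ENNReal.ofReal (s / n α ^ 2) = _
    congr 1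
    field_simp
  · rw [indicator_of_notMem (by simpa [e] using hA'), indicator_of_notMem hA', mul_zero, mul_zero]

theorem IsSupport.integrable_polar (hn : IsSupport n) {F : Plane → ℂ} (hF : Integrable F) :
    Integrable (fun p : ℝ × ℝ => (polarDensity n p : ℝ) • F (p.1 • boundaryPoint n p.2))
      ((volume.restrict (Ioi (0 : ℝ))).prod (volume.restrict (Ioo (-Real.pi) Real.pi))) := by
  have h := hn.measurePreserving_polar.integrable_comp_of_integrable hF
  rw [polarMeasure, integrable_withDensity_iff_integrable_smul hn.measurable_polarDensity] at h
  exact h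

theorem IsSupport.integral_polar (hn : IsSupport n) {F : Plane → ℂ} (hF : Integrable F) :
    ∫ y, F y = ∫ s in Ioi (0 : ℝ), ∫ α in Ioo (-Real.pi) Real.pi,
      (polarDensity n (s, α) : ℝ) • F (s • boundaryPoint n α) := by
  have hmp := hn.measurePreserving_polar
  have h : ∫ y, F y = ∫ p, F (p.1 • boundaryPoint n p.2) ∂(polarMeasure n) := by
    rw [← integral_map hmp.measurable.aemeasurable (by rw [hmp.map_eq]; exact hF.aestronglyMeasurable),
      hmp.map_eq]
  rw [h, polarMeasure, integral_withDensity_eq_integral_smul hn.measurable_polarDensity]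
  exact integral_prod _ (hn.integrable_polar hF)

end Polar

/-! ### Circle averages in terms of the angle. -/

section Circles

variable {n : ℝ → ℝ}

/-- The speed of the parametrization `boundaryPoint n`. -/
def boundarySpeed (n : ℝ → ℝ) (α : ℝ) : ℝ := √(n α ^ 2 + deriv n α ^ 2) / n α ^ 2

theorem IsSupport.hasDerivAt_boundaryPoint (hn : IsSupport n) (α : ℝ) :
    HasDerivAt (boundaryPoint n)
      ((n α ^ 2)⁻¹ • (n α • unitVec' α - deriv n α • unitVec α)) α := by
  have h := ((hn.hasDerivAt α).inv (hn.pos α).ne').smul (hasDerivAt_unitVec α)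
  refine h.congr_deriv ?_
  simp only [Pi.inv_apply]
  have := (hn.pos α).ne'
  rw [smul_sub, smul_smul, smul_smul, sub_eq_add_neg, ← neg_smul]
  congr 2 <;> field_simp

theorem IsSupport.norm_deriv_boundaryPoint (hn : IsSupport n) (α : ℝ) :
    ‖(n α ^ 2)⁻¹ • (n α • unitVec' α - deriv n α • unitVec α)‖ = boundarySpeed n α := by
  have h0 := hn.pos α
  have h1 : ‖n α • unitVec' α - deriv n α • unitVec α‖ = √(n α ^ 2 + deriv n α ^ 2) := by
    rw [EuclideanSpace.norm_eq, Fin.sum_univ_two]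
    congr 1
    simp [unitVec, unitVec']
    linear_combination (n α ^ 2 + deriv n α ^ 2) * Real.sin_sq_add_cos_sq α
  rw [norm_smul, h1, Real.norm_eq_abs, abs_of_pos (by positivity), boundarySpeed, inv_mul_eq_div]

theorem IsSupport.continuous_boundarySpeed (hn : IsSupport n) : Continuous (boundarySpeed n) := by
  have h1 := hn.smooth.continuous
  have h2 := hn.deriv_smooth.continuous
  exact Continuous.div (by fun_prop) (by fun_prop) fun α => pow_ne_zero _ (hn.pos α).ne'

theorem IsSupport.boundarySpeed_pos (hn : IsSupport n) (α : ℝ) : 0 < boundarySpeed n α := by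
  have := hn.pos α
  have : 0 < √(n α ^ 2 + deriv n α ^ 2) := Real.sqrt_pos.2 (by positivity)
  have := hn.pos α
  rw [boundarySpeed]
  positivity

/-- The perimeter of the curve parametrized by `boundaryPoint n`. -/
def perimeter (n : ℝ → ℝ) : ℝ := ∫ α in (-Real.pi)..Real.pi, boundarySpeed n α

theorem IsSupport.perimeter_pos (hn : IsSupport n) : 0 < perimeter n :=
  intervalIntegral.intervalIntegral_pos_of_pos (hn.continuous_boundarySpeed.intervalIntegrable _ _)
    hn.boundarySpeed_pos (by linarith [Real.pi_pos])

theorem IsSupport.boundaryPoint_injOn (hn : IsSupport n) :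
    InjOn (boundaryPoint n) (Ioc (-Real.pi) Real.pi) := by
  intro α hα β hβ h
  have h1 : (n α)⁻¹ = (n β)⁻¹ := by
    have := congrArg norm h
    rwa [boundaryPoint, boundaryPoint, norm_polar (inv_pos.2 (hn.pos _)).le,
      norm_polar (inv_pos.2 (hn.pos _)).le] at this
  rw [boundaryPoint, boundaryPoint, h1] at h
  obtain ⟨k, hk⟩ := unitVec_eq_imp (smul_right_injective _ (inv_pos.2 (hn.pos β)).ne' h)
  exact eq_of_mem_Ioc_of_sub_eq (k := k) hα hβ (by linarith)

variable {K : ConvexBody Plane}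

theorem bodyNorm_eq_angle (y : Plane) : bodyNorm K y = ‖y‖ * bodyRadius K (angle y) := by
  conv_lhs => rw [← norm_smul_unitVec_angle y]
  exact bodyNorm_polar (norm_nonneg _) _

theorem IsSmoothCurvedBody.bodyNorm_smul_boundaryPoint (hK : IsSmoothCurvedBody K) {s : ℝ}
    (hs : 0 ≤ s) (α : ℝ) : bodyNorm K (s • boundaryPoint (bodyRadius K) α) = s := by
  rw [bodyNorm_smul hs, (hK.mem_frontier_iff _).1 (hK.boundaryPoint_mem α), mul_one]

theorem IsSmoothCurvedBody.normCircle_eq (hK : IsSmoothCurvedBody K) {t : ℝ} (ht : 0 < t) :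
    normCircle K t = (fun α => t • boundaryPoint (bodyRadius K) α) '' Ioc (-Real.pi) Real.pi := by
  ext y
  constructor
  · intro hy
    have hy : bodyNorm K y = t := hy
    refine ⟨angle y, Complex.arg_mem_Ioc _, ?_⟩
    have h0 := (hK.bodyRadius_pos (angle y)).ne'
    simp only [boundaryPoint]
    rw [smul_smul, ← hy, bodyNorm_eq_angle, mul_assoc, mul_inv_cancel₀ h0, mul_one,
      norm_smul_unitVec_angle]
  · rintro ⟨α, -, rfl⟩
    exact hK.bodyNorm_smul_boundaryPoint ht.le α

/-- Circle averages in the parametrization by angle. -/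
theorem IsSmoothCurvedBody.convMeasure_circleMeasure (hK : IsSmoothCurvedBody K) {t : ℝ}
    (ht : 0 < t) (f : Plane → ℂ) (x : Plane) :
    convMeasure f (circleMeasure K t) x = ((perimeter (bodyRadius K))⁻¹ : ℝ) •
      ∫ α in Ioc (-Real.pi) Real.pi, boundarySpeed (bodyRadius K) α •
        f (x - t • boundaryPoint (bodyRadius K) α) := by
  have hn := hK.isSupport
  set n := bodyRadius K
  have hd : ∀ α, HasDerivAt (fun α => t • boundaryPoint n α)
      (t • ((n α ^ 2)⁻¹ • (n α • unitVec' α - deriv n α • unitVec α))) α := fun α =>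
    (hn.hasDerivAt_boundaryPoint α).const_smul t
  have hdc : Continuous fun α =>
      t • ((n α ^ 2)⁻¹ • (n α • unitVec' α - deriv n α • unitVec α)) := by
    have h1 := hn.smooth.continuous
    have h2 := hn.deriv_smooth.continuous
    have h3 := contDiff_unitVec.continuous
    have h4 := contDiff_unitVec'.continuous
    have h5 : Continuous fun α => (n α ^ 2)⁻¹ :=
      (h1.pow 2).inv₀ fun α => pow_ne_zero _ (hn.pos α).ne'
    exact (h5.smul ((h1.smul h4).sub (h2.smul h3))).const_smul t
  have hinj : InjOn (fun α => t • boundaryPoint n α) (Ioc (-Real.pi) Real.pi) :=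
    fun α hα β hβ h => hn.boundaryPoint_injOn hα hβ (smul_right_injective _ ht.ne' h)
  have hnorm : ∀ α, ‖t • ((n α ^ 2)⁻¹ • (n α • unitVec' α - deriv n α • unitVec α))‖ =
      t * boundarySpeed n α := fun α => by
    rw [norm_smul, hn.norm_deriv_boundaryPoint, Real.norm_eq_abs, abs_of_pos ht]
  -- The speed and the total length are both proportional to `t`, so `t` disappears from the
  -- normalized average.
  have hmass : arcLength (normCircle K t) univ = ENNReal.ofReal (t * perimeter n) := by
    rw [hK.normCircle_eq ht, arcLength_image_univ hd hdc (by linarith [Real.pi_pos]) hinj]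
    simp_rw [hnorm]
    rw [intervalIntegral.integral_const_mul]
    rfl
  have hp := hn.perimeter_pos
  rw [convMeasure, circleMeasure, hmass, integral_smul_measure, hK.normCircle_eq ht,
    integral_arcLength_image hd hdc hinj]
  simp_rw [hnorm, mul_smul]
  rw [integral_smul, smul_smul]
  congr 1
  rw [ENNReal.toReal_inv, ENNReal.toReal_ofReal (by positivity)]
  field_simp

end Circles

/-! ### The main kernel as a cosine transform of circle averages. -/

section Radial

variable {K : ConvexBody Plane} {a b : ℝ} {ψ : Plane → ℝ}

/-- The average over the circle of radius `s`, times `√s`. -/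
def radialProfile (K : ConvexBody Plane) (g : Plane → ℂ) : ℝ → ℂ :=
  (Ioi (0 : ℝ)).indicator fun s => (√s * (perimeter (bodyRadius K))⁻¹) •
    ∫ α in Ioo (-Real.pi) Real.pi,
      boundarySpeed (bodyRadius K) α • g (s • boundaryPoint (bodyRadius K) α)

/-- The amplitude of `mainKernel`, cut off near the origin and near infinity. -/
def cutAmplitude (n : ℝ → ℝ) (ψ : Plane → ℝ) (y : Plane) : ℝ :=
  (√2)⁻¹ * (ψ y * mainKernel n (0, y))

theorem IsSupport.integrable_mul_cutAmplitude {n : ℝ → ℝ} (hn : IsSupport n)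
    (hψ : ContDiff ℝ ∞ ψ) (hcs : HasCompactSupport ψ) (h0 : (0 : Plane) ∉ tsupport ψ)
    {g : Plane → ℂ} (hg : Integrable g) : Integrable fun y => g y * (cutAmplitude n ψ y : ℂ) := by
  have hc : Continuous fun y => ψ y * mainKernel n (0, y) :=
    Continuous.comp (g := fun q : ℝ × Plane => ψ q.2 * mainKernel n q)
      (f := fun y : Plane => ((0 : ℝ), y)) (hn.contDiff_cutoff_mul_mainKernel hψ h0).continuous
      (continuous_const.prodMk continuous_id)
  obtain ⟨B, hB⟩ := hc.bounded_above_of_compact_support hcs.mul_right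
  refine hg.mul_bdd (c := (√2)⁻¹ * B) ?_ (Eventually.of_forall fun y => ?_)
  · exact (continuous_ofReal.comp (hc.const_mul _)).aestronglyMeasurable
  · rw [Complex.norm_real, cutAmplitude, norm_mul, Real.norm_of_nonneg (by positivity)]
    exact mul_le_mul_of_nonneg_left (hB y) (by positivity)

/-- In the coordinates adapted to `K` the phase `ρ n(β)` is the norm `s`, independent of the angle,
so the angular integral does not see the cosine. -/
theorem IsSupport.mainKernel_boundaryPoint {n : ℝ → ℝ} (hn : IsSupport n) (r : ℝ) {s : ℝ}
    (hs : 0 < s) (α : ℝ) : mainKernel n (r, s • boundaryPoint n α) =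
      2 * (leadAmp n α / √(s / n α)) * Real.cos (2 * Real.pi * r * s - Real.pi / 4) := by
  have h0 := hn.pos α
  rw [boundaryPoint, smul_smul, ← div_eq_mul_inv, hn.mainKernel_polar r (by positivity),
    mul_assoc (2 * Real.pi * r), div_mul_cancel₀ _ h0.ne']
  ring

/-- This identity dictates `leadAmp`: the amplitude converts the area element into arc length on
`∂K` times `√s`. -/
theorem IsSupport.polarDensity_mul_amplitude {n : ℝ → ℝ} (hn : IsSupport n) {s : ℝ}
    (hs : 0 < s) (α : ℝ) : (polarDensity n (s, α) : ℝ) * (leadAmp n α / √(s / n α)) =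
      √s * boundarySpeed n α := by
  have h0 := hn.pos α
  rw [polarDensity, Real.coe_toNNReal _ (by positivity), leadAmp, boundarySpeed,
    Real.sqrt_div (by positivity), Real.sqrt_div hs.le]
  have h1 : √s * √s = s := Real.mul_self_sqrt hs.le
  have h2 : √(n α) ≠ 0 := (Real.sqrt_pos.2 h0).ne'
  have h3 : √s ≠ 0 := (Real.sqrt_pos.2 hs).ne'
  field_simp
  rw [pow_two, h1]

/-- At `r = 0` the cosine is `cos (π/4) = 1/√2`, and with the factors `2` and `(√2)⁻¹` exactly the
amplitude remains. Defining the amplitude through `r = 0` lets it inherit the regularity of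
`mainKernel`. -/
theorem cutAmplitude_boundaryPoint {n : ℝ → ℝ} (hn : IsSupport n) {s : ℝ}
    (hs : 0 < s) {α : ℝ} (hψ : ψ (s • boundaryPoint n α) = 1) :
    cutAmplitude n ψ (s • boundaryPoint n α) = leadAmp n α / √(s / n α) := by
  rw [cutAmplitude, hψ, one_mul, hn.mainKernel_boundaryPoint 0 hs]
  simp only [mul_zero, zero_mul, zero_sub, Real.cos_neg, Real.cos_pi_div_four]
  have : √2 ≠ 0 := by positivity
  field_simp

variable (hK : IsSmoothCurvedBody K) (ha : 0 < a)
  (hψ1 : ∀ y, a ≤ bodyNorm K y → bodyNorm K y ≤ b → ψ y = 1) {g : Plane → ℂ}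
  (hsupp : ∀ y, g y ≠ 0 → a ≤ bodyNorm K y ∧ bodyNorm K y ≤ b)

include hK hψ1 hsupp in
theorem polarDensity_smul_mul_cutAmplitude {s : ℝ} (hs : 0 < s) (α : ℝ) :
    (polarDensity (bodyRadius K) (s, α) : ℝ) • (g (s • boundaryPoint (bodyRadius K) α) *
      (cutAmplitude (bodyRadius K) ψ (s • boundaryPoint (bodyRadius K) α) : ℂ)) =
      √s • boundarySpeed (bodyRadius K) α • g (s • boundaryPoint (bodyRadius K) α) := by
  by_cases h : g (s • boundaryPoint (bodyRadius K) α) = 0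
  · rw [h]; simp
  · obtain ⟨h1, h2⟩ := hsupp _ h
    rw [cutAmplitude_boundaryPoint hK.isSupport hs (hψ1 _ h1 h2), smul_smul,
      ← hK.isSupport.polarDensity_mul_amplitude hs α, Complex.real_smul, Complex.real_smul]
    push_cast
    ring

include hK hψ1 hsupp in
theorem radialProfile_eq (s : ℝ) : radialProfile K g s = (perimeter (bodyRadius K))⁻¹ •
    (Ioi (0 : ℝ)).indicator (fun s => ∫ α in Ioo (-Real.pi) Real.pi,
      (polarDensity (bodyRadius K) (s, α) : ℝ) • (g (s • boundaryPoint (bodyRadius K) α) *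
      (cutAmplitude (bodyRadius K) ψ (s • boundaryPoint (bodyRadius K) α) : ℂ))) s := by
  by_cases hs : s ∈ Ioi (0 : ℝ)
  · rw [radialProfile, indicator_of_mem hs, indicator_of_mem hs]
    simp_rw [polarDensity_smul_mul_cutAmplitude hK hψ1 hsupp hs]
    rw [integral_smul, smul_smul, mul_comm]
  · rw [radialProfile, indicator_of_notMem hs, indicator_of_notMem hs, smul_zero]

include hK hψ1 hsupp in
theorem integrable_radialProfile (hψ : ContDiff ℝ ∞ ψ) (hcs : HasCompactSupport ψ)
    (h0 : (0 : Plane) ∉ tsupport ψ) (hg : Integrable g) : Integrable (radialProfile K g) := by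
  rw [funext (radialProfile_eq hK hψ1 hsupp)]
  refine Integrable.smul (𝕜 := ℝ) ((perimeter (bodyRadius K))⁻¹) ?_
  rw [integrable_indicator_iff measurableSet_Ioi]
  exact (hK.isSupport.integrable_polar
    (hK.isSupport.integrable_mul_cutAmplitude hψ hcs h0 hg)).integral_prod_left

include hK hsupp in
theorem radialProfile_eq_zero {s : ℝ} (hs : s < a) : radialProfile K g s = 0 := by
  rw [radialProfile]
  by_cases h : s ∈ Ioi (0 : ℝ)
  · have hz : ∀ α, g (s • boundaryPoint (bodyRadius K) α) = 0 := fun α => by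
      by_contra hne
      have := (hsupp _ hne).1
      rw [hK.bodyNorm_smul_boundaryPoint (le_of_lt h)] at this
      linarith
    rw [indicator_of_mem h]
    simp [hz]
  · exact indicator_of_notMem h _

include hK ha hψ1 hsupp in
theorem mul_mainKernel_eq (r : ℝ) (y : Plane) : g y * (mainKernel (bodyRadius K) (r, y) : ℂ) =
    g y * (cutAmplitude (bodyRadius K) ψ y : ℂ) *
      (2 * Real.cos (2 * Real.pi * r * bodyNorm K y - Real.pi / 4) : ℝ) := by
  by_cases h : g y = 0
  · rw [h]; simp
  · obtain ⟨h1, h2⟩ := hsupp _ h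
    have hy : y = bodyNorm K y • boundaryPoint (bodyRadius K) (angle y) := by
      rw [boundaryPoint, smul_smul, bodyNorm_eq_angle, mul_assoc,
        mul_inv_cancel₀ (hK.bodyRadius_pos _).ne', mul_one, norm_smul_unitVec_angle]
    have hs : 0 < bodyNorm K y := ha.trans_le h1
    have hm : mainKernel (bodyRadius K) (r, y) = cutAmplitude (bodyRadius K) ψ y *
        (2 * Real.cos (2 * Real.pi * r * bodyNorm K y - Real.pi / 4)) := by
      have e1 := hK.isSupport.mainKernel_boundaryPoint r hs (angle y)
      have e2 := cutAmplitude_boundaryPoint (ψ := ψ) hK.isSupport hs (α := angle y)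
        (by rw [← hy]; exact hψ1 y h1 h2)
      rw [← hy] at e1 e2
      rw [e1, e2]
      ring
    rw [hm]
    push_cast
    ring

include hK ha hψ1 hsupp in
theorem integrable_mul_mainKernel (hψ : ContDiff ℝ ∞ ψ) (hcs : HasCompactSupport ψ)
    (h0 : (0 : Plane) ∉ tsupport ψ) (hg : Integrable g) (r : ℝ) :
    Integrable fun y => g y * (mainKernel (bodyRadius K) (r, y) : ℂ) := by
  rw [funext (mul_mainKernel_eq hK ha hψ1 hsupp r)]
  have hc := hK.continuous_bodyNorm
  refine (hK.isSupport.integrable_mul_cutAmplitude hψ hcs h0 hg).mul_bdd (c := 2)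
    (Continuous.aestronglyMeasurable (by fun_prop)) (Eventually.of_forall fun y => ?_)
  rw [Complex.norm_real, norm_mul, Real.norm_eq_abs, Real.norm_eq_abs, abs_two]
  linarith [Real.abs_cos_le_one (2 * Real.pi * r * bodyNorm K y - Real.pi / 4)]

include hK ha hψ1 hsupp in
/-- Integration against the main kernel is a cosine transform of the circle averages. -/
theorem integral_mul_mainKernel (hψ : ContDiff ℝ ∞ ψ) (hcs : HasCompactSupport ψ)
    (h0 : (0 : Plane) ∉ tsupport ψ) (hg : Integrable g) (r : ℝ) :
    ∫ y, g y * (mainKernel (bodyRadius K) (r, y) : ℂ) = (2 * perimeter (bodyRadius K) : ℝ) *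
      ∫ s, radialProfile K g s * (Real.cos (2 * Real.pi * r * s - Real.pi / 4) : ℂ) := by
  have hp := hK.isSupport.perimeter_pos
  rw [hK.isSupport.integral_polar (integrable_mul_mainKernel hK ha hψ1 hsupp hψ hcs h0 hg r)]
  have h1 : ∀ s : ℝ, radialProfile K g s * (Real.cos (2 * Real.pi * r * s - Real.pi / 4) : ℂ) =
      (Ioi (0 : ℝ)).indicator (fun s => radialProfile K g s *
        (Real.cos (2 * Real.pi * r * s - Real.pi / 4) : ℂ)) s := fun s => by
    by_cases hs : s ∈ Ioi (0 : ℝ)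
    · rw [indicator_of_mem hs]
    · rw [indicator_of_notMem hs, radialProfile, indicator_of_notMem hs, zero_mul]
  rw [integral_congr_ae (Eventually.of_forall h1), integral_indicator measurableSet_Ioi,
    ← integral_const_mul]
  refine setIntegral_congr_fun measurableSet_Ioi fun s hs => ?_
  rw [radialProfile_eq hK hψ1 hsupp, indicator_of_mem hs, Complex.real_smul]
  have h2 : ∀ α, (polarDensity (bodyRadius K) (s, α) : ℝ) •
      (g (s • boundaryPoint (bodyRadius K) α) *
        (mainKernel (bodyRadius K) (r, s • boundaryPoint (bodyRadius K) α) : ℂ)) =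
      ((polarDensity (bodyRadius K) (s, α) : ℝ) • (g (s • boundaryPoint (bodyRadius K) α) *
      (cutAmplitude (bodyRadius K) ψ (s • boundaryPoint (bodyRadius K) α) : ℂ))) *
        (2 * Real.cos (2 * Real.pi * r * s - Real.pi / 4) : ℝ) := fun α => by
    rw [mul_mainKernel_eq hK ha hψ1 hsupp, hK.bodyNorm_smul_boundaryPoint (le_of_lt hs),
      smul_mul_assoc]
  simp_rw [h2]
  rw [integral_mul_const]
  have hpc : (perimeter (bodyRadius K) : ℂ) ≠ 0 := by exact_mod_cast hp.ne'
  push_cast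
  field_simp

end Radial

theorem IsSmoothCurvedBody.exists_annulus_cutoff {K : ConvexBody Plane} (hK : IsSmoothCurvedBody K)
    {a b : ℝ} (ha : 0 < a) (hab : a ≤ b) : ∃ ψ : Plane → ℝ, ContDiff ℝ ∞ ψ ∧ HasCompactSupport ψ ∧
      (0 : Plane) ∉ tsupport ψ ∧ ∀ y, a ≤ bodyNorm K y → bodyNorm K y ≤ b → ψ y = 1 := by
  have hn := hK.isSupport
  obtain ⟨c, hc, hcn⟩ := exists_pos_le_of_periodic hn.smooth.continuous hn.periodic hn.pos
  obtain ⟨B, hB⟩ := exists_bound_of_periodic hn.smooth.continuous hn.periodic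
  have hB0 : 0 < B := (hn.pos 0).trans_le ((le_abs_self _).trans (hB 0))
  obtain ⟨ψ, h1, h2, h3, h4⟩ := exists_cutoff_annulus (c := a / B) (R := b / c) (by positivity)
    (div_pos (ha.trans_le hab) hc)
  refine ⟨ψ, h1, h2, h3, fun y hy1 hy2 => h4 y ?_ ?_⟩
  · rw [div_le_iff₀ hB0]
    rw [bodyNorm_eq_angle] at hy1
    exact hy1.trans (mul_le_mul_of_nonneg_left ((le_abs_self _).trans (hB _)) (norm_nonneg _))
  · rw [le_div_iff₀ hc]
    rw [bodyNorm_eq_angle] at hy2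
    exact (mul_le_mul_of_nonneg_left (hcn _) (norm_nonneg _)).trans hy2

theorem enorm_sq_eq_ofReal (z : ℂ) : ‖z‖ₑ ^ 2 = ENNReal.ofReal (‖z‖ ^ 2) := by
  rw [ENNReal.ofReal_pow (norm_nonneg _), ofReal_norm]

theorem conv_eq_integral (f k : Plane → ℂ) (x : Plane) :
    conv f k x = ∫ y, f (x - y) * k y := by
  rw [conv, convolution_def, ← integral_sub_left_eq_self _ volume x]
  simp

/-! ### Assembly of the estimate. -/

section Final

variable {K : ConvexBody Plane} {a b : ℝ} {ψ : Plane → ℝ}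

/-- The estimate for circle averages about a fixed centre, with the error kernel controlled by an
integrable function of the dual parameter. -/
theorem IsSmoothCurvedBody.lintegral_radialProfile_le (hK : IsSmoothCurvedBody K) (ha : 0 < a)
    (hψ : ContDiff ℝ ∞ ψ) (hcs : HasCompactSupport ψ) (h0 : (0 : Plane) ∉ tsupport ψ)
    (hψ1 : ∀ y, a ≤ bodyNorm K y → bodyNorm K y ≤ b → ψ y = 1) {g : Plane → ℂ}
    (hg : Integrable g) (hsupp : ∀ y, g y ≠ 0 → a ≤ bodyNorm K y ∧ bodyNorm K y ≤ b)
    {Q : ℝ → ℝ≥0∞} (hQ : Measurable Q) {S : ℝ≥0∞}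
    (hE : ∀ r, 0 < r → ‖∫ y, g y * (locKernel (bodyRadius K) ψ r y : ℂ)‖ₑ ^ 2 ≤ Q r * S) :
    ∫⁻ s, ‖radialProfile K g s‖ₑ ^ 2 ≤ ENNReal.ofReal (2 / perimeter (bodyRadius K) ^ 2) *
      ((∫⁻ r in Ioi (0 : ℝ), ‖∫ y, g y * (sigHat (bodyRadius K) (r • y) : ℂ)‖ₑ ^ 2 *
        ENNReal.ofReal r) + (∫⁻ r in Ioi (0 : ℝ), Q r * ENNReal.ofReal r) * S) := by
  set n := bodyRadius K
  have hn : IsSupport n := hK.isSupport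
  have hL := hn.perimeter_pos
  set L := perimeter n with hLdef
  obtain ⟨C, hC, hb⟩ := hn.exists_locKernel_bounds hψ hcs h0
  refine (lintegral_enorm_sq_le_cos (integrable_radialProfile hK hψ1 hsupp hψ hcs h0 hg) ha
    fun s hs => radialProfile_eq_zero hK hsupp hs).trans ?_
  rw [← lintegral_const_mul' _ _ (by simp), ← lintegral_mul_const _ (by fun_prop),
    ← lintegral_add_right _ (by fun_prop), ← lintegral_const_mul' _ _ ENNReal.ofReal_ne_top]
  refine setLIntegral_mono' measurableSet_Ioi fun r hr => ?_
  have hr : 0 < r := hr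
  have hsr : 0 < √r := Real.sqrt_pos.2 hr
  set T : ℂ := ∫ s, radialProfile K g s * (Real.cos (2 * Real.pi * r * s - Real.pi / 4) : ℂ) with hT
  set M : ℂ := ∫ y, g y * (mainKernel n (r, y) : ℂ) with hM
  set E : ℂ := ∫ y, g y * (locKernel n ψ r y : ℂ) with hEdef
  set F : ℂ := ∫ y, g y * (sigHat n (r • y) : ℂ) with hF
  have hMT : M = (2 * L : ℝ) * T := integral_mul_mainKernel hK ha hψ1 hsupp hψ hcs h0 hg r
  have hMi := integrable_mul_mainKernel hK ha hψ1 hsupp hψ hcs h0 hg r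
  have hEi : Integrable fun y => g y * (locKernel n ψ r y : ℂ) := by
    have hc := (hn.contDiff_locKernel hψ h0 r).continuous
    refine hg.mul_bdd (c := C / √r + C / (r * √r)) (Continuous.aestronglyMeasurable (by fun_prop))
      (Eventually.of_forall fun y => ?_)
    rw [Complex.norm_real, Real.norm_eq_abs]
    have h1 : 0 ≤ C / √r := by positivity
    have h2 : 0 ≤ C / (r * √r) := by positivity
    rcases le_total r 1 with h | h
    · linarith [(hb r y hr).1 h]
    · linarith [(hb r y hr).2.1 h]
  -- On the support of `g` the cutoff is `1`, so the localized remainder is the full remainder.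
  have hFE : F = E + ((√r)⁻¹ : ℝ) * M := by
    rw [hF, hEdef, hM, ← integral_const_mul, ← integral_add hEi (hMi.const_mul _)]
    refine integral_congr_ae (Eventually.of_forall fun y => ?_)
    simp only
    by_cases h : g y = 0
    · rw [h]; simp
    · obtain ⟨h1, h2⟩ := hsupp _ h
      rw [locKernel_eq, hψ1 y h1 h2]
      push_cast
      ring
  have hMFE : M = (√r : ℝ) * (F - E) := by
    have : ((√r : ℝ) : ℂ) ≠ 0 := by exact_mod_cast hsr.ne'
    rw [hFE]
    push_cast
    field_simp
    ring
  -- From `2 L T = M = √r (F - E)` and `|F - E|² ≤ 2|F|² + 2|E|²`; the `4` of the cosine inequality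
  -- is absorbed by `(2L)²`.
  have hTn : 4 * ‖T‖ ^ 2 ≤ 2 / L ^ 2 * (‖F‖ ^ 2 * r + ‖E‖ ^ 2 * r) := by
    have e1 : ‖M‖ = 2 * L * ‖T‖ := by
      rw [hMT, norm_mul, Complex.norm_real, Real.norm_of_nonneg (by positivity)]
    have e2 : ‖M‖ = √r * ‖F - E‖ := by
      rw [hMFE, norm_mul, Complex.norm_real, Real.norm_of_nonneg hsr.le]
    have e3 : ‖F - E‖ ^ 2 ≤ 2 * ‖F‖ ^ 2 + 2 * ‖E‖ ^ 2 := by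
      have := norm_sub_le F E
      nlinarith [norm_nonneg (F - E), norm_nonneg F, norm_nonneg E, sq_nonneg (‖F‖ - ‖E‖)]
    have e4 : (2 * L * ‖T‖) ^ 2 = r * ‖F - E‖ ^ 2 := by
      rw [← e1, e2, mul_pow, Real.sq_sqrt hr.le]
    have e5 : 4 * ‖T‖ ^ 2 = r * ‖F - E‖ ^ 2 / L ^ 2 := by
      rw [← e4]; field_simp; ring
    rw [e5, div_mul_eq_mul_div]
    refine div_le_div_of_nonneg_right ?_ (by positivity)
    nlinarith
  calc 4 * ‖T‖ₑ ^ 2 = ENNReal.ofReal (4 * ‖T‖ ^ 2) := by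
        rw [enorm_sq_eq_ofReal, ENNReal.ofReal_mul (by norm_num), ENNReal.ofReal_ofNat]
    _ ≤ ENNReal.ofReal (2 / L ^ 2 * (‖F‖ ^ 2 * r + ‖E‖ ^ 2 * r)) := ENNReal.ofReal_le_ofReal hTn
    _ = ENNReal.ofReal (2 / L ^ 2) * (‖F‖ₑ ^ 2 * ENNReal.ofReal r +
          ‖E‖ₑ ^ 2 * ENNReal.ofReal r) := by
        rw [ENNReal.ofReal_mul (by positivity), ENNReal.ofReal_add (by positivity) (by positivity),
          ENNReal.ofReal_mul (by positivity), ENNReal.ofReal_mul (by positivity),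
          enorm_sq_eq_ofReal, enorm_sq_eq_ofReal]
    _ ≤ ENNReal.ofReal (2 / L ^ 2) * (‖F‖ₑ ^ 2 * ENNReal.ofReal r +
          Q r * ENNReal.ofReal r * S) := by
        refine mul_le_mul_right (add_le_add_right ?_ _) _
        rw [mul_right_comm]
        exact mul_le_mul_left (hE r hr) _

/-- The factor `√s` in `radialProfile` accounts for the weight `t` in `t dt`. -/
theorem IsSmoothCurvedBody.lintegral_circleMeasure_eq (hK : IsSmoothCurvedBody K) (f : Plane → ℂ)
    (x : Plane) :
    ∫⁻ t in Ioi (0 : ℝ), ‖convMeasure f (circleMeasure K t) x‖ₑ ^ 2 * ENNReal.ofReal t =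
      ∫⁻ s, ‖radialProfile K (fun y => f (x - y)) s‖ₑ ^ 2 := by
  have h : ∀ s, ‖radialProfile K (fun y => f (x - y)) s‖ₑ ^ 2 = (Ioi (0 : ℝ)).indicator
      (fun t => ‖convMeasure f (circleMeasure K t) x‖ₑ ^ 2 * ENNReal.ofReal t) s := fun s => by
    by_cases hs : s ∈ Ioi (0 : ℝ)
    · have hs' : 0 < s := hs
      rw [radialProfile, indicator_of_mem hs, indicator_of_mem hs,
        hK.convMeasure_circleMeasure hs, integral_Ioc_eq_integral_Ioo, mul_smul, enorm_smul,
        mul_pow, mul_comm]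
      congr 1
      rw [Real.enorm_of_nonneg (Real.sqrt_nonneg _), ← ENNReal.ofReal_pow (Real.sqrt_nonneg _),
        Real.sq_sqrt hs'.le]
    · rw [radialProfile, indicator_of_notMem hs, indicator_of_notMem hs]
      simp
  simp_rw [h]
  rw [lintegral_indicator measurableSet_Ioi]

end Final

end CurvedNorm
end

open CurvedNorm in
theorem lemma7p5 (K : ConvexBody Plane) (hK : IsSmoothCurvedBody K) :
    ∃ σ : SignedMeasure Plane, IsSmoothMeasureOn (dualUnitCircle K) σ ∧
      ∀ a b : ℝ, 0 < a → a ≤ b →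
        ∃ C₁ : ℝ≥0, ∀ ε : ℝ, 0 < ε → ∃ C₂ : ℝ≥0,
          ∀ (x : Plane) (f : Plane → ℂ), Integrable f →
            (∀ y, f y ≠ 0 → a ≤ bodyNorm K (x - y) ∧ bodyNorm K (x - y) ≤ b) →
            ∫⁻ t in Ioi (0 : ℝ), ‖convMeasure f (circleMeasure K t) x‖ₑ ^ 2 * ENNReal.ofReal t ≤
              C₁ * (∫⁻ r in Ioi (0 : ℝ),
                ‖conv f (fourierMeasure (dilate σ r)) x‖ₑ ^ 2 * ENNReal.ofReal r) +
              C₂ * (sobolevNormSq (-(1 / 2) + ε) f + sobolevNormSq (-(1 / 2)) f) := by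
  obtain ⟨σ, hσ, hσr⟩ := hK.exists_dual_measure
  refine ⟨σ, hσ, fun a b ha hab => ?_⟩
  have hn := hK.isSupport
  obtain ⟨ψ, hψ, hcs, h0, hψ1⟩ := hK.exists_annulus_cutoff ha hab
  obtain ⟨R, hR⟩ := hcs.isCompact.isBounded.exists_norm_le
  obtain ⟨C, hC, hb⟩ := hn.exists_locKernel_bounds hψ hcs h0
  -- The first constant depends on `K` alone; `a`, `b` and `ε` enter only through `Q`.
  refine ⟨(2 / perimeter (bodyRadius K) ^ 2).toNNReal, fun ε hε => ?_⟩
  obtain ⟨Q, hQ, hQfin, hE⟩ := exists_family_bound (E := locKernel (bodyRadius K) ψ) (R := R)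
    (hn.contDiff_locKernel hψ h0)
    (fun r y hy => by
      have : ψ y = 0 := image_eq_zero_of_notMem_tsupport fun h => (hR y h).not_gt hy
      rw [locKernel, this, zero_mul]) hb hε
  refine ⟨(2 / perimeter (bodyRadius K) ^ 2).toNNReal *
    (∫⁻ r in Ioi (0 : ℝ), Q r * ENNReal.ofReal r).toNNReal, fun x f hf hsupp => ?_⟩
  -- Reflecting and translating `f` moves the centre to the origin and leaves the Sobolev norms
  -- unchanged, so all constants are independent of `x`.
  have hg : Integrable fun y => f (x - y) := hf.comp_sub_left x
  have hgs : ∀ y, f (x - y) ≠ 0 → a ≤ bodyNorm K y ∧ bodyNorm K y ≤ b := fun y hy => by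
    simpa using hsupp _ hy
  have hmain := hK.lintegral_radialProfile_le ha hψ hcs h0 hψ1 hg hgs hQ
    (S := sobolevNormSq (-(1 / 2) + ε) f + sobolevNormSq (-(1 / 2)) f) fun r hr => by
      have := hE _ hg r hr
      rwa [sobolevNormSq_comp_sub_left, sobolevNormSq_comp_sub_left] at this
  rw [hK.lintegral_circleMeasure_eq]
  refine hmain.trans (le_of_eq ?_)
  rw [mul_add, ENNReal.coe_mul, ENNReal.coe_toNNReal hQfin.ne, ← mul_assoc]
  congr 2
  refine setLIntegral_congr_fun measurableSet_Ioi fun r hr => ?_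
  rw [conv_eq_integral]
  simp_rw [hσr r hr]
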